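/- Let $P$ be a finite set of points in the plane, no three of them collinear. $CH(Q)$ denotes the convex hull of a finite point set $Q$, and $|CH(Q)|$ its number of vertices. Let $P'$ be the set of points of $P$ that are not vertices of $CH(P)$, and let $c_1,\dots,c_k$ be the vertices of $CH(P)$ in counterclockwise order (indices cyclic). $\overrightarrow{xy}$ is the ray from $x$ through $y$; "left" and "right" of it are meant strictly. *Inward triangles.* An inward triangle is a triangle $c_{i-1}ac_i$ with $a\in P'$ that has no point of $P$ in its interior; $a$ is its inward vertex and $c_ia$ its right edge. It is forbidden if there are two vertices $p_r\ne p_t$ of $CH(P)$ such that $c_{i-1}c_i$ is an edge of the clockwise boundary chain of $CH(P)$ from $p_r$ to $p_t$ and $a$ is a vertex of $CH(Q)$, where $Q$ arises from $P$ by deleting the vertices strictly between $p_r$ and $p_t$ on the counterclockwise boundary chain from $p_r$ to $p_t$. A degenerate inward triangle is a segment $c_iu$ with $u\in P'$; its inward vertex is $u$, its right edge is $c_iu$, and its interior means the open segment. It is forbidden if $u$ is a vertex of $CH(P')$ and $c_iu$ meets the interior of $CH(P')$. *Hypothesis.* A set $T_c$ of non-degenerate, non-forbidden inward triangles is compatible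 if no two of its members share an edge, an inward vertex or an interior point. Let $T_c'\subseteq T_c$ consist of the triangles whose inward vertex is a vertex of $CH(P')$, and let $\max|T_c'|$ be the maximum of $|T_c'|$ over all inclusion-maximal compatible sets $T_c$. $P$ satisfies Necessary Condition 3 if $$|P'|-|CH(P')|\ \ge\ |CH(P)|-\max|T_c'| .$$ *Good sets.* Let $\mathcal S$ be a finite multiset of inward triangles, possibly degenerate, in which only degenerate ones may be repeated. For each $i$ list the distinct triangles of $\mathcal S$ incident on $c_i$ in clockwise order around $c_i$ starting from $c_{i-1}$ (a triangle on $c_{i-1}c_i$ first, a triangle on $c_ic_{i+1}$ last); concatenating these lists for $i=1,\dots,k$ and removing repetitions gives a cyclic list $L(\mathcal S)$. A point of $P'$ is free if it is not the inward vertex of a triangle in $\mathcal S$. A segment intersects a triangle if its relative interior meets the closed triangle. $\mathcal S$ is good if: 1. $|\mathcal S|=|P'|$, counted with multiplicity. 2. $\mathcal S$ contains no forbidden triangle (degenerate or not). 3. Distinct triangles of $\mathcal S$ have disjoint interiors. 4. Every vertex of $CH(P')$ is the inward vertex of some triangle in $\mathcal S$. 5. For every edge of $CH(P)$ there is an inward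 triangle on that edge in $\mathcal S$. 6. No segment joining two free points intersects a triangle of $\mathcal S$. 7. If $t\in\mathcal S$ has right edge $c_ia_i$ and the next triangle in $L(\mathcal S)$ has the same inward vertex $a_i$, then for every free point $x$: (a) $x$ lies to the right of $\overrightarrow{c_ia_i}$; (b) if a triangle of $\mathcal S$ with right edge $c_ja_j$ intersects the segment $c_ix$, then $c_j$ lies to the right of $\overrightarrow{c_ix}$, $a_j$ lies to the left of $\overrightarrow{c_ix}$, and either $a_j=a_i$ or $a_j$ lies to the right of $\overrightarrow{c_ia_i}$. 8. If $t\in\mathcal S$ has right edge $c_ia_i$ and the next triangle in $L(\mathcal S)$ has inward vertex $a_{i+1}\ne a_i$, then for every free point $x$: (a) the segment $a_{i+1}x$ does not intersect $t$; (b) if a triangle of $\mathcal S$ with right edge $c_ja_j$ intersects the segment $a_{i+1}x$, then $c_j$ lies to the right of $\overrightarrow{a_{i+1}x}$, $a_j$ lies to the left of $\overrightarrow{a_{i+1}x}$, and the segment $a_{i+1}a_j$ does not intersect $t$. Moreover (c) no point of $P'$ lies in the interior of the triangle $a_ic_ia_{i+1}$. **Lemma.** If $P$ satisfies Necessary Condition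 3, then there exists a good multiset $\mathcal S$ of inward triangles of $P$. -/

import Mathlib

namespace PlanarPoints

/-- The Euclidean plane. -/
abbrev Plane := EuclideanSpace ℝ (Fin 2)

/-- Twice the signed area of the triangle `a b x`. -/
def orient (a b x : Plane) : ℝ :=
  (b 0 - a 0) * (x 1 - a 1) - (b 1 - a 1) * (x 0 - a 0)

/-- `x` lies strictly to the left of the ray from `a` through `b`. -/
def LeftOf (a b x : Plane) : Prop := 0 < orient a b x

/-- `x` lies strictly to the right of the ray from `a` through `b`. -/
def RightOf (a b x : Plane) : Prop := orient a b x < 0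

/-- No three points of `P` are collinear. -/
def GeneralPosition (P : Finset Plane) : Prop :=
  ∀ a ∈ P, ∀ b ∈ P, ∀ c ∈ P, a ≠ b → b ≠ c → a ≠ c → ¬ Collinear ℝ ({a, b, c} : Set Plane)

open scoped Classical in
/-- The vertices of the convex hull `CH(Q)` of a finite set `Q`. -/
noncomputable def hullVertices (Q : Finset Plane) : Finset Plane :=
  Q.filter (fun p => p ∈ (convexHull ℝ (Q : Set Plane)).extremePoints ℝ)

open scoped Classical in
/-- `P'`: the points of `P` that are not vertices of `CH(P)`. (In general position these are the
points of `P` in the interior of `CH(P)`.) -/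
noncomputable def innerPoints (P : Finset Plane) : Finset Plane :=
  P.filter (fun p => p ∉ hullVertices P)

/-- `bc` is an edge of `CH(P)`, and `c` is the vertex that follows `b` in counterclockwise order:
every other point of `P` lies to the left of the ray from `b` through `c`. -/
def IsHullEdge (P : Finset Plane) (b c : Plane) : Prop :=
  b ∈ hullVertices P ∧ c ∈ hullVertices P ∧ b ≠ c ∧
    ∀ p ∈ P, p ≠ b → p ≠ c → LeftOf b c p

/-- A triangle `c_{i-1} a c_i` is recorded by `left = c_{i-1}`, `apex = a`, `right = c_i`; a
degenerate triangle `c_i a` is recorded by `left = right = c_i`, `apex = a`. The apex is the inward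
vertex, and the right edge is the segment from `right` to `apex`. -/
@[ext]
structure Triangle where
  left : Plane
  right : Plane
  apex : Plane

namespace Triangle

/-- The closed triangle (the closed segment, if degenerate). -/
def region (t : Triangle) : Set Plane :=
  convexHull ℝ {t.left, t.right, t.apex}

open scoped Classical in
/-- The interior of the triangle; for a degenerate triangle, the open segment. -/
noncomputable def inside (t : Triangle) : Set Plane :=
  if t.left = t.right then openSegment ℝ t.right t.apex else interior t.region

/-- The three edges of the triangle. -/
def edges (t : Triangle) : Set (Sym2 Plane) :=
  {s(t.left, t.right), s(t.right, t.apex), s(t.left, t.apex)}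

end Triangle

/-- A (nondegenerate) inward triangle of `P`: an edge of `CH(P)` together with a point of `P'`,
such that the triangle is empty. -/
def IsInwardTriangle (P : Finset Plane) (t : Triangle) : Prop :=
  IsHullEdge P t.left t.right ∧ t.apex ∈ innerPoints P ∧ ∀ p ∈ P, p ∉ interior t.region

/-- A degenerate inward triangle of `P`: a segment from a vertex of `CH(P)` to a point of `P'`. -/
def IsDegenerateTriangle (P : Finset Plane) (t : Triangle) : Prop :=
  t.left = t.right ∧ t.right ∈ hullVertices P ∧ t.apex ∈ innerPoints P

open scoped Classical in
/-- The vertices of `CH(P)` strictly between the vertices `r` and `t` on the counterclockwise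
boundary of `CH(P)` from `r` to `t`; these are the vertices to the right of the ray from `r`
through `t`. -/
noncomputable def openChain (P : Finset Plane) (r t : Plane) : Finset Plane :=
  (hullVertices P).filter (fun p => RightOf r t p)

open scoped Classical in
/-- The set `Q` left after deleting the open counterclockwise chain from `r` to `t`. -/
noncomputable def deleteChain (P : Finset Plane) (r t : Plane) : Finset Plane :=
  P.filter (fun p => p ∉ openChain P r t)

/-- A nondegenerate inward triangle on an edge of the clockwise chain from `r` to `t`, whose inward
vertex becomes a vertex of the convex hull when the open counterclockwise chain from `r` to `t` is
deleted from `P`. -/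
def IsForbiddenTriangle (P : Finset Plane) (T : Triangle) : Prop :=
  IsInwardTriangle P T ∧
    ∃ r ∈ hullVertices P, ∃ t ∈ hullVertices P, r ≠ t ∧
      T.left ∉ openChain P r t ∧ T.right ∉ openChain P r t ∧
      T.apex ∈ hullVertices (deleteChain P r t)

/-- A degenerate inward triangle `c u` with `u` a vertex of `CH(P')`, such that the segment `c u`
meets the interior of `CH(P')`. -/
def IsForbiddenSegment (P : Finset Plane) (t : Triangle) : Prop :=
  IsDegenerateTriangle P t ∧ t.apex ∈ hullVertices (innerPoints P) ∧
    (segment ℝ t.right t.apex ∩ interior (convexHull ℝ (innerPoints P : Set Plane))).Nonempty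

/-- A compatible set `T_c` of nondegenerate inward triangles that are not forbidden. -/
def IsCompatible (P : Finset Plane) (T : Finset Triangle) : Prop :=
  (∀ t ∈ T, IsInwardTriangle P t ∧ ¬ IsForbiddenTriangle P t) ∧
  ∀ t ∈ T, ∀ t' ∈ T, t ≠ t' →
    Disjoint t.edges t'.edges ∧ t.apex ≠ t'.apex ∧ Disjoint t.inside t'.inside

open scoped Classical in
/-- `T_c'`: the triangles of `T_c` whose inward vertices are vertices of `CH(P')`. -/
noncomputable def hullPart (P : Finset Plane) (T : Finset Triangle) : Finset Triangle :=
  T.filter (fun t => t.apex ∈ hullVertices (innerPoints P))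

/-- `m = max |T_c'|`, the maximum over all maximal compatible sets `T_c`. -/
def IsMaxCompatible (P : Finset Plane) (m : ℕ) : Prop :=
  IsGreatest {n : ℕ | ∃ T : Finset Triangle, Maximal (IsCompatible P) T ∧
    (hullPart P T).card = n} m

/-- The inequality `|P'| - |CH(P')| ≥ |CH(P)| - max |T_c'|`. -/
def NecessaryCondition3 (P : Finset Plane) : Prop :=
  ∃ m : ℕ, IsMaxCompatible P m ∧
    ((innerPoints P).card : ℤ) - ((hullVertices (innerPoints P)).card : ℤ) ≥
      ((hullVertices P).card : ℤ) - (m : ℤ)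

/-- The segment `x y` intersects the triangle `t`; a common endpoint does not count. -/
def SegmentMeets (x y : Plane) (t : Triangle) : Prop :=
  (openSegment ℝ x y ∩ t.region).Nonempty

/-- `x ∈ P'` is not the inward vertex of a triangle in `S`. -/
def IsFree (P : Finset Plane) (S : Multiset Triangle) (x : Plane) : Prop :=
  x ∈ innerPoints P ∧ ∀ t ∈ S, t.apex ≠ x

/-- `t` and `t'` are incident on the vertex `c_i = t.right = t'.left`, and `t` precedes `t'` in the
clockwise order around `c_i` starting from `c_{i-1}`: the triangle on `c_{i-1} c_i` comes first,
then come the degenerate triangles at `c_i` by angle, and the triangle on `c_i c_{i+1}` is last. -/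
def Precedes (t t' : Triangle) : Prop :=
  t'.left = t.right ∧
    (t.left ≠ t.right ∨ t'.left ≠ t'.right ∨ RightOf t.right t.apex t'.apex)

/-- `t'` is the next triangle after `t` in the cyclic list `L(S)`, which lists the triangles of `S`
without repetition around the vertices `c_1, c_2, …, c_k` in turn. -/
def IsNext (S : Multiset Triangle) (t t' : Triangle) : Prop :=
  t ∈ S ∧ t' ∈ S ∧ Precedes t t' ∧ ∀ s ∈ S, ¬ (Precedes t s ∧ Precedes s t')

/-- Good multisets of inward triangles, possibly degenerate. -/
structure IsGoodSet (P : Finset Plane) (S : Multiset Triangle) : Prop where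
  inward : ∀ t ∈ S, IsInwardTriangle P t ∨ IsDegenerateTriangle P t
  /-- Only degenerate triangles may be repeated. -/
  nodup : ∀ t, IsInwardTriangle P t → ∀ S', S = t ::ₘ S' → t ∉ S'
  /-- As many triangles, with multiplicity, as points of `P'`. -/
  card_eq : Multiset.card S = (innerPoints P).card
  /-- No triangle is forbidden. -/
  not_forbidden : ∀ t ∈ S, ¬ IsForbiddenTriangle P t ∧ ¬ IsForbiddenSegment P t
  /-- Distinct triangles have disjoint interiors. -/
  disjoint : ∀ t ∈ S, ∀ t' ∈ S, t ≠ t' → Disjoint t.inside t'.inside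
  /-- Every vertex of `CH(P')` is an inward vertex. -/
  covers_vertices : ∀ u ∈ hullVertices (innerPoints P), ∃ t ∈ S, t.apex = u
  /-- Every edge of `CH(P)` has an inward triangle. -/
  covers_edges : ∀ b c, IsHullEdge P b c → ∃ t ∈ S, t.left = b ∧ t.right = c
  /-- Segments between free points meet no triangle. -/
  free_segment : ∀ x y, IsFree P S x → IsFree P S y → x ≠ y → ∀ t ∈ S, ¬ SegmentMeets x y t
  /-- Next triangle with the same inward vertex: free points lie right of the right edge. -/
  same_right : ∀ t t', IsNext S t t' → t'.apex = t.apex → ∀ x, IsFree P S x →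
    RightOf t.right t.apex x
  /-- Next triangle with the same inward vertex: triangles meeting `c_i x`. -/
  same_meets : ∀ t t', IsNext S t t' → t'.apex = t.apex → ∀ x, IsFree P S x →
    ∀ s ∈ S, SegmentMeets t.right x s →
      RightOf t.right x s.right ∧ LeftOf t.right x s.apex ∧
        (s.apex = t.apex ∨ RightOf t.right t.apex s.apex)
  /-- Next triangle with a different inward vertex: `a_{i+1} x` does not meet `t`. -/
  diff_segment : ∀ t t', IsNext S t t' → t'.apex ≠ t.apex → ∀ x, IsFree P S x →
    ¬ SegmentMeets t'.apex x t
  /-- Next triangle with a different inward vertex: triangles meeting `a_{i+1} x`. -/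
  diff_meets : ∀ t t', IsNext S t t' → t'.apex ≠ t.apex → ∀ x, IsFree P S x →
    ∀ s ∈ S, SegmentMeets t'.apex x s →
      RightOf t'.apex x s.right ∧ LeftOf t'.apex x s.apex ∧ ¬ SegmentMeets t'.apex s.apex t
  /-- Next triangle with a different inward vertex: `a_i c_i a_{i+1}` is empty. -/
  diff_empty : ∀ t t', IsNext S t t' → t'.apex ≠ t.apex →
    ∀ p ∈ innerPoints P, p ∉ interior (convexHull ℝ {t.apex, t.right, t'.apex})

end PlanarPoints

/-! ### Signed areas, triangles, and hull vertices as points with a strict supporting half-plane. -/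

namespace PlanarPoints

/-! Let `c i` be the vertices of CH(P) and `u n` those of CH(P'), counterclockwise and indexed
periodically by ℤ, with `k` and `h` of them per period. Call the other points of P' deep, let `d` be
their number, and call the edge from `u (n - 1)` to `u n` gate `n`.

A corner `c i` sees exactly the gates `n` with `L i < n ≤ R i` (up to the period `h`); the two
tangents `L` and `R` are monotone and go around CH(P') once per period (`Rings.window_step`,
`Rings.winding`, `Rings.exists_lifts`). A triangle on the edge from `c i` to `c (i + 1)` with apex
`u n` is inward and not forbidden exactly if `c i` sees gate `n` and `c (i + 1)` sees gate `n + 1`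
(`Rings.sees_of_not_forbidden`, `Rings.typeOne_isInward`, `Rings.typeOne_not_forbidden`). Two such
triangles with apexes in the wrong order cross, so the part T_c' of a compatible set is a strictly
increasing choice of indices (`Lifts.exists_selection`). It extends to an `Allocation`, which gives
every `u n` either to a corner, as a degenerate triangle, or to an outer edge, as the apex of a
triangle.

If `count` edges are served in this way, there are `h - count` degenerate triangles. With one
triangle on each of the `k` edges the total is `h + d = |P'|` after adding `count - (k - d)` copies
of one more degenerate triangle, and Necessary Condition 3 says that this number can be made
nonnegative. An allocation with smallest possible sums is tight (`Allocation.exists_tight`): at an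
edge that is not served, both end corners have their left tangent at the vertex reached so far.

The apexes of the edges not served are found backwards from the next served edge. At the corner `c`
with following inward vertex `y`, `RuleStep` keeps `y` if all other deep points are to the right of
the ray from `c` through `y`, and otherwise passes to the tangent point from `y` to the deep points.
The first alternative is what condition 7 asks of a repeated inward vertex. The second keeps all
deep points on one side of a line whose other side contains the corners
(`RuleStep.eq_or_chainPoint`, `exists_beams`, `exists_layout`).

Disjointness is proved by counting. For a generic point outside the hull of the deep points there is
a ray that all links between consecutive inward vertices cross nonnegatively. The winding numbers of
the edge triangles and the weights of the corner fans are then nonnegative and add up to at most the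
winding number 1 of CH(P) (`exists_weights`), so cells at different places do not overlap
(`Cell.eq_of_mem`). All free points are deep. The remaining conditions follow because a triangle of
the layout meets CH(P'), or the hull of the deep points if its apex is deep, in the apex only
(`Layout.region_eq`), and because right edges at different corners are disjoint
(`Layout.right_edges_disjoint`). -/

theorem orient_rot (a b c : Plane) : orient b c a = orient a b c := by unfold orient; ring

theorem orient_swap (a b c : Plane) : orient b a c = -orient a b c := by unfold orient; ring

theorem orient_swap_right (a b c : Plane) : orient a c b = -orient a b c := by unfold orient; ring

@[simp] theorem orient_self_left (a b : Plane) : orient a a b = 0 := by unfold orient; ring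

@[simp] theorem orient_self_right (a b : Plane) : orient a b b = 0 := by unfold orient; ring

@[simp] theorem orient_self_mid (a b : Plane) : orient a b a = 0 := by unfold orient; ring

/-- The Grassmann–Plücker relation. -/
theorem orient_pluecker (o a b c d : Plane) :
    orient o a b * orient o c d - orient o a c * orient o b d + orient o a d * orient o b c = 0 := by
  unfold orient; ring

theorem orient_sum (a b c d : Plane) :
    orient a b d + orient b c d + orient c a d = orient a b c := by
  unfold orient; ring

theorem orient_add_smul (a b x y : Plane) {s t : ℝ} (h : s + t = 1) :
    orient a b (s • x + t • y) = s * orient a b x + t * orient a b y := by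
  obtain rfl : s = 1 - t := by linarith
  simp only [orient, PiLp.add_apply, PiLp.smul_apply, smul_eq_mul]; ring

theorem convex_orient_pos (a b : Plane) : Convex ℝ {x | 0 < orient a b x} := by
  intro x hx y hy s t hs ht h
  simp only [Set.mem_ofPred_eq] at *
  rw [orient_add_smul _ _ _ _ h]
  rcases hs.eq_or_lt with rfl | hs
  · obtain rfl : t = 1 := by linarith
    simpa using hy
  · nlinarith [mul_pos hs hx, mul_nonneg ht hy.le]

theorem convex_orient_nonneg (a b : Plane) : Convex ℝ {x | 0 ≤ orient a b x} := by
  intro x hx y hy s t hs ht h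
  simp only [Set.mem_ofPred_eq] at *
  rw [orient_add_smul _ _ _ _ h]
  positivity

theorem continuous_orient (a b : Plane) : Continuous (orient a b) := by
  unfold orient; fun_prop

theorem orient_nonneg_of_mem_convexHull {S : Set Plane} {a b x : Plane}
    (h : ∀ p ∈ S, 0 ≤ orient a b p) (hx : x ∈ convexHull ℝ S) : 0 ≤ orient a b x :=
  convexHull_min (t := {x | 0 ≤ orient a b x}) h (convex_orient_nonneg a b) hx

theorem orient_nonpos_of_mem_convexHull {S : Set Plane} {a b x : Plane}
    (h : ∀ p ∈ S, orient a b p ≤ 0) (hx : x ∈ convexHull ℝ S) : orient a b x ≤ 0 := by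
  have := orient_nonneg_of_mem_convexHull (a := b) (b := a)
    (fun p hp => by rw [orient_swap]; linarith [h p hp]) hx
  rw [orient_swap] at this; linarith

theorem orient_pos_of_mem_convexHull {S : Set Plane} {a b x : Plane}
    (h : ∀ p ∈ S, 0 < orient a b p) (hx : x ∈ convexHull ℝ S) : 0 < orient a b x :=
  convexHull_min (t := {x | 0 < orient a b x}) h (convex_orient_pos a b) hx

/-- A point `x` of the closed ccw triangle is the barycentre with weights given by `orient`. -/
theorem orient_barycentric (a b c x : Plane) :
    orient a b c • x = orient b c x • a + orient c a x • b + orient a b x • c := by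
  ext i
  fin_cases i <;> simp [orient] <;> ring

theorem mem_triangle_iff {a b c x : Plane} (h : 0 < orient a b c) :
    x ∈ convexHull ℝ {a, b, c} ↔
      0 ≤ orient a b x ∧ 0 ≤ orient b c x ∧ 0 ≤ orient c a x := by
  constructor
  · intro hx
    have h1 := orient_rot a b c
    have h2 := orient_rot b c a
    refine ⟨?_, ?_, ?_⟩ <;> refine orient_nonneg_of_mem_convexHull ?_ hx <;>
      simp only [Set.mem_insert_iff, Set.mem_singleton_iff, forall_eq_or_imp, forall_eq,
        orient_self_right, orient_self_mid] <;>
      refine ⟨?_, ?_, ?_⟩ <;> linarith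
  · rintro ⟨h1, h2, h3⟩
    have hs := orient_sum a b c x
    have hx : x = (orient b c x / orient a b c) • a + (orient c a x / orient a b c) • b +
        (orient a b x / orient a b c) • c := by
      have := orient_barycentric a b c x
      have h' : (orient a b c)⁻¹ • (orient a b c • x) = x := by
        rw [smul_smul, inv_mul_cancel₀ h.ne', one_smul]
      rw [this] at h'
      simpa only [smul_add, smul_smul, div_eq_inv_mul] using h'.symm
    have hm : ∀ p ∈ ({a, b, c} : Set Plane), p ∈ convexHull ℝ {a, b, c} :=
      fun p hp => subset_convexHull ℝ _ hp
    have := (convex_convexHull ℝ ({a, b, c} : Set Plane)).sum_mem (t := Finset.univ)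
      (w := ![orient b c x / orient a b c, orient c a x / orient a b c, orient a b x / orient a b c])
      (z := ![a, b, c])
      (by intro i _; fin_cases i <;> simp <;> positivity)
      (by simp [Fin.sum_univ_three]; rw [← hs]; rw [← hs] at h; field_simp; ring)
      (by intro i _; fin_cases i <;> apply hm <;> simp)
    rw [Fin.sum_univ_three] at this
    rw [hx]; simpa using this

theorem orient_pos_of_mem_interior {S : Set Plane} {a b x : Plane} (hab : a ≠ b)
    (h : ∀ p ∈ S, 0 ≤ orient a b p) (hx : x ∈ interior S) : 0 < orient a b x := by
  obtain ⟨d, hd⟩ : ∃ d : Plane, 0 < (b 0 - a 0) * d 1 - (b 1 - a 1) * d 0 := by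
    -- The left normal of `a b`: moving `x` slightly against it stays in `S` and lowers the signed
    -- area.
    refine ⟨!₂[-(b 1 - a 1), b 0 - a 0], ?_⟩
    simp only [Matrix.cons_val_zero, Matrix.cons_val_one]
    by_contra hcon
    have h0 : b 0 - a 0 = 0 := by nlinarith [sq_nonneg (b 0 - a 0), sq_nonneg (b 1 - a 1)]
    have h1 : b 1 - a 1 = 0 := by nlinarith [sq_nonneg (b 0 - a 0), sq_nonneg (b 1 - a 1)]
    apply hab
    ext i; fin_cases i <;> simp <;> linarith
  have hc : ContinuousAt (fun e : ℝ => x - e • d) 0 := by fun_prop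
  have hmem : ∀ᶠ e : ℝ in nhds 0, x - e • d ∈ S := by
    apply hc.eventually_mem
    simpa using mem_interior_iff_mem_nhds.1 hx
  obtain ⟨e, he, he'⟩ := (Filter.Eventually.and (nhdsWithin_le_nhds hmem)
    (self_mem_nhdsWithin (s := Set.Ioi (0:ℝ)))).exists
  have := h _ he
  have he' : 0 < e := he'
  have h2 := mul_pos he' hd
  have h3 : orient a b (x - e • d) = orient a b x - e * ((b 0 - a 0) * d 1 - (b 1 - a 1) * d 0) := by
    simp only [orient, PiLp.sub_apply, PiLp.smul_apply, smul_eq_mul]; ring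
  linarith

theorem mem_interior_triangle_iff {a b c x : Plane} (h : 0 < orient a b c) :
    x ∈ interior (convexHull ℝ {a, b, c}) ↔
      0 < orient a b x ∧ 0 < orient b c x ∧ 0 < orient c a x := by
  constructor
  · intro hx
    have h1 := orient_rot a b c
    have h2 := orient_rot b c a
    have hab : a ≠ b := by rintro rfl; simp at h
    have hbc : b ≠ c := by rintro rfl; simp at h
    have hca : c ≠ a := by rintro rfl; simp at h
    have hm := fun p (hp : p ∈ convexHull ℝ {a, b, c}) => (mem_triangle_iff h).1 hp
    exact ⟨orient_pos_of_mem_interior hab (fun p hp => (hm p hp).1) hx,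
      orient_pos_of_mem_interior hbc (fun p hp => (hm p hp).2.1) hx,
      orient_pos_of_mem_interior hca (fun p hp => (hm p hp).2.2) hx⟩
  · rintro ⟨h1, h2, h3⟩
    have ho : IsOpen ({x | 0 < orient a b x} ∩ ({x | 0 < orient b c x} ∩ {x | 0 < orient c a x})) :=
      (isOpen_lt continuous_const (continuous_orient _ _)).inter
        ((isOpen_lt continuous_const (continuous_orient _ _)).inter
          (isOpen_lt continuous_const (continuous_orient _ _)))
    refine interior_maximal (fun p hp => ?_) ho ⟨h1, h2, h3⟩
    exact (mem_triangle_iff h).2 ⟨hp.1.le, hp.2.1.le, hp.2.2.le⟩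

theorem GeneralPosition.orient_ne_zero {P : Finset Plane} (hP : GeneralPosition P) {a b c : Plane}
    (ha : a ∈ P) (hb : b ∈ P) (hc : c ∈ P) (hab : a ≠ b) (hbc : b ≠ c) (hac : a ≠ c) :
    orient a b c ≠ 0 := by
  intro h
  apply hP a ha b hb c hc hab hbc hac
  rw [collinear_iff_of_mem (p₀ := a) (by simp)]
  refine ⟨b - a, ?_⟩
  have hr : ∃ r : ℝ, c = r • (b - a) + a := by
    by_cases h0 : b 0 - a 0 = 0
    · have h1 : b 1 - a 1 ≠ 0 := by
        intro h1; apply hab; ext i; fin_cases i <;> simp <;> linarith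
      refine ⟨(c 1 - a 1) / (b 1 - a 1), ?_⟩
      ext i; fin_cases i <;> simp
      · simp only [orient, h0, zero_mul, zero_sub, neg_eq_zero, mul_eq_zero, h1, false_or] at h
        rw [h0]; linarith
      · field_simp; ring
    · refine ⟨(c 0 - a 0) / (b 0 - a 0), ?_⟩
      ext i; fin_cases i <;> simp
      · field_simp; ring
      · unfold orient at h; field_simp; linarith
  intro p hp
  simp only [Set.mem_insert_iff, Set.mem_singleton_iff] at hp
  rcases hp with rfl | rfl | rfl
  · exact ⟨0, by simp⟩
  · exact ⟨1, by simp⟩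
  · simpa [vadd_eq_add] using hr

/-- An open half-plane together with one point `p` of its boundary line is convex, so it contains
the hull, and `p` is no proper convex combination of points in it. Together with the converse
`exists_halfplane` this turns extreme points into sign conditions; `w` only serves as a direction.
-/
theorem mem_hullVertices_of_halfplane {Q : Finset Plane} {p w : Plane} (hp : p ∈ Q)
    (h : ∀ x ∈ Q, x ≠ p → 0 < orient p w x) : p ∈ hullVertices Q := by
  classical
  have hc : Convex ℝ {x : Plane | x = p ∨ 0 < orient p w x} := by
    intro x hx y hy s t hs ht hst
    simp only [Set.mem_ofPred_eq] at *
    rw [orient_add_smul _ _ _ _ hst]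
    rcases hx with rfl | hx <;> rcases hy with rfl | hy
    · left; rw [← add_smul, hst, one_smul]
    · rcases ht.eq_or_lt with rfl | ht
      · left; obtain rfl : s = 1 := by linarith
        simp
      · right; simp; positivity
    · rcases hs.eq_or_lt with rfl | hs
      · left; obtain rfl : t = 1 := by linarith
        simp
      · right; simp; positivity
    · right
      have := convex_orient_pos p w hx hy hs ht hst
      simpa only [Set.mem_ofPred_eq, orient_add_smul _ _ _ _ hst] using this
  have hsub : ∀ x ∈ convexHull ℝ (Q : Set Plane), x = p ∨ 0 < orient p w x := by
    intro x hx
    refine convexHull_min (t := {x : Plane | x = p ∨ 0 < orient p w x}) ?_ hc hx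
    intro q hq
    by_cases hqp : q = p
    · exact Or.inl hqp
    · exact Or.inr (h q hq hqp)
  simp only [hullVertices, Finset.mem_filter]
  refine ⟨hp, subset_convexHull ℝ _ hp, ?_⟩
  intro x hx y hy hpxy
  obtain ⟨s, t, hs, ht, hst, rfl⟩ := hpxy
  have e := orient_add_smul (s • x + t • y) w x y hst
  rw [orient_self_mid] at e
  rcases hsub x hx with h1 | h1
  · exact h1
  · rcases hsub y hy with h2 | h2
    · rw [← h2, orient_self_mid] at e
      rw [← h2] at h1
      have := mul_pos hs h1
      linarith
    · have := mul_pos hs h1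
      have := mul_pos ht h2
      linarith

theorem mem_of_mem_hullVertices {Q : Finset Plane} {p : Plane} (h : p ∈ hullVertices Q) : p ∈ Q := by
  classical exact (Finset.mem_filter.1 h).1

theorem exists_halfplane_of_notMem {Q : Finset Plane} {p : Plane}
    (h : p ∉ convexHull ℝ (Q : Set Plane)) : ∃ w, ∀ x ∈ Q, 0 < orient p w x := by
  have hclosed : IsClosed (convexHull ℝ (Q : Set Plane)) :=
    (Q.finite_toSet.isCompact_convexHull (𝕜 := ℝ)).isClosed
  obtain ⟨f, u, hu, hf⟩ := geometric_hahn_banach_point_closed (convex_convexHull ℝ _) hclosed h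
  set e0 : Plane := EuclideanSpace.single 0 1
  set e1 : Plane := EuclideanSpace.single 1 1
  have hfx : ∀ x : Plane, f x = x 0 * f e0 + x 1 * f e1 := by
    intro x
    have hx : x = x 0 • e0 + x 1 • e1 := by
      ext i; fin_cases i <;> simp [e0, e1]
    conv_lhs => rw [hx]
    simp
  -- The direction from `p` to this point spans the kernel of `f`, scaled so that `orient p w x` is
  -- exactly `f x - f p`.
  refine ⟨p + f e1 • e0 - f e0 • e1, fun x hx => ?_⟩
  have h1 := hf x (subset_convexHull ℝ _ hx)
  rw [hfx] at hu h1
  have : orient p (p + f e1 • e0 - f e0 • e1) x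
      = (x 0 * f e0 + x 1 * f e1) - (p 0 * f e0 + p 1 * f e1) := by
    simp [orient, e0, e1]; ring
  linarith

theorem exists_halfplane {Q : Finset Plane} {p : Plane} (h : p ∈ hullVertices Q) :
    ∃ w, ∀ x ∈ Q, x ≠ p → 0 < orient p w x := by
  classical
  have h2 := (Finset.mem_filter.1 h).2
  rw [Convex.mem_extremePoints_iff_mem_sdiff_convexHull_sdiff (convex_convexHull ℝ _)] at h2
  have : p ∉ convexHull ℝ ((Q.erase p : Finset Plane) : Set Plane) := by
    intro hp
    apply h2.2
    refine convexHull_mono ?_ hp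
    intro x hx
    simp only [Finset.coe_erase, Set.mem_sdiff, Finset.mem_coe, Set.mem_singleton_iff] at hx
    exact ⟨subset_convexHull ℝ _ hx.1, hx.2⟩
  obtain ⟨w, hw⟩ := exists_halfplane_of_notMem this
  exact ⟨w, fun x hx hxp => hw x (Finset.mem_erase.2 ⟨hxp, hx⟩)⟩

theorem mem_hullVertices_mono {Q Q' : Finset Plane} {p : Plane} (hs : Q ⊆ Q') (hp : p ∈ Q)
    (h : p ∈ hullVertices Q') : p ∈ hullVertices Q := by
  obtain ⟨w, hw⟩ := exists_halfplane h
  exact mem_hullVertices_of_halfplane hp fun x hx => hw x (hs hx)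

theorem mem_innerPoints {P : Finset Plane} {p : Plane} :
    p ∈ innerPoints P ↔ p ∈ P ∧ p ∉ hullVertices P := by
  classical simp [innerPoints]

theorem notMem_interior_of_mem_hullVertices {Q : Finset Plane} {p : Plane}
    (h : p ∈ hullVertices Q) : p ∉ interior (convexHull ℝ (Q : Set Plane)) := by
  intro hp
  obtain ⟨w, hw⟩ := exists_halfplane h
  have hnn : ∀ x ∈ convexHull ℝ (Q : Set Plane), 0 ≤ orient p w x := fun x hx => by
    refine orient_nonneg_of_mem_convexHull (fun q hq => ?_) hx
    by_cases hqp : q = p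
    · simp [hqp]
    · exact (hw q hq hqp).le
  by_cases hpw : p = w
  · subst hpw
    have hQ : (Q : Set Plane) ⊆ {p} := by
      intro q hq
      by_contra hqp
      simpa using hw q hq hqp
    have h1 : convexHull ℝ (Q : Set Plane) ⊆ {p} := convexHull_min hQ (convex_singleton p)
    have h2 := interior_mono h1 hp
    rw [interior_singleton] at h2
    exact h2
  · simpa using orient_pos_of_mem_interior hpw hnn hp

/-- Inside an open half-plane at `o` the angular order is a genuine order, by the Grassmann–Plücker
relation. The half-plane is what rules out a cyclic turn. -/
theorem orient_trans {o w a b c : Plane} (ha : 0 < orient o w a) (hb : 0 < orient o w b)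
    (hc : 0 < orient o w c) (hab : 0 < orient o a b) (hbc : 0 < orient o b c) :
    0 < orient o a c := by
  have := orient_pluecker o w a b c
  by_contra hcon
  nlinarith [mul_pos ha hbc, mul_pos hc hab, mul_nonneg hb.le (sub_nonneg.2 (not_lt.1 hcon))]

/-- The first point of a finite set in a half-plane, in the angular order about `o`. -/
theorem exists_rightmost {o w : Plane} (X : Finset Plane) (hX : X.Nonempty)
    (hw : ∀ x ∈ X, 0 < orient o w x) (hne : ∀ x ∈ X, ∀ y ∈ X, x ≠ y → orient o x y ≠ 0) :
    ∃ a ∈ X, ∀ x ∈ X, x ≠ a → 0 < orient o a x := by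
  classical
  induction hX using Finset.Nonempty.cons_induction with
  | singleton a => exact ⟨a, by simp, by simp⟩
  | cons b s hb hs ih =>
    obtain ⟨a, ha, hmin⟩ := ih (fun x hx => hw x (by simp [hx]))
      (fun x hx y hy => hne x (by simp [hx]) y (by simp [hy]))
    have hab : a ≠ b := by rintro rfl; exact hb ha
    rcases lt_or_gt_of_ne (hne a (by simp [ha]) b (by simp) hab) with h | h
    · refine ⟨b, by simp, fun x hx hxb => ?_⟩
      have hxs : x ∈ s := by simpa [hxb] using hx
      have hba : 0 < orient o b a := by rw [orient_swap_right]; linarith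
      by_cases hxa : x = a
      · rwa [hxa]
      · exact orient_trans (hw b (by simp)) (hw a (by simp [ha])) (hw x hx) hba (hmin x hxs hxa)
    · refine ⟨a, by simp [ha], fun x hx hxa => ?_⟩
      rcases Finset.mem_cons.1 hx with rfl | hx
      · exact h
      · exact hmin x hx hxa

/-- The last point of a finite set in a half-plane, in the angular order about `o`. -/
theorem exists_leftmost {o w : Plane} (X : Finset Plane) (hX : X.Nonempty)
    (hw : ∀ x ∈ X, 0 < orient o w x) (hne : ∀ x ∈ X, ∀ y ∈ X, x ≠ y → orient o x y ≠ 0) :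
    ∃ a ∈ X, ∀ x ∈ X, x ≠ a → orient o a x < 0 := by
  classical
  induction hX using Finset.Nonempty.cons_induction with
  | singleton a => exact ⟨a, by simp, by simp⟩
  | cons b s hb hs ih =>
    obtain ⟨a, ha, hmax⟩ := ih (fun x hx => hw x (by simp [hx]))
      (fun x hx y hy => hne x (by simp [hx]) y (by simp [hy]))
    have hab : a ≠ b := by rintro rfl; exact hb ha
    rcases lt_or_gt_of_ne (hne a (by simp [ha]) b (by simp) hab) with h | h
    · refine ⟨a, by simp [ha], fun x hx hxa => ?_⟩
      rcases Finset.mem_cons.1 hx with rfl | hx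
      · exact h
      · exact hmax x hx hxa
    · refine ⟨b, by simp, fun x hx hxb => ?_⟩
      have hxs : x ∈ s := by simpa [hxb] using hx
      rw [orient_swap_right, neg_lt_zero]
      by_cases hxa : x = a
      · rwa [hxa]
      · have hxa' : 0 < orient o x a := by
          rw [orient_swap_right]; linarith [hmax x hxs hxa]
        exact orient_trans (hw x hx) (hw a (by simp [ha])) (hw b (by simp)) hxa' h


/-! ### Hull edges and the cyclic enumeration of the hull vertices. -/

theorem exists_pos_add_mul {Q : Finset Plane} {A B : Plane → ℝ}
    (h : ∀ x ∈ Q, 0 < A x ∨ (A x = 0 ∧ 0 < B x)) : ∃ e > (0 : ℝ), ∀ x ∈ Q, 0 < A x + e * B x := by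
  have : ∀ᶠ e : ℝ in nhdsWithin 0 (Set.Ioi 0), ∀ x ∈ Q, 0 < A x + e * B x := by
    refine (Filter.eventually_all_finset Q).2 fun x hx => ?_
    rcases h x hx with h | ⟨h0, h1⟩
    · have hc : ContinuousAt (fun e : ℝ => A x + e * B x) 0 := by fun_prop
      exact nhdsWithin_le_nhds (hc.eventually (lt_mem_nhds (by simpa using h)))
    · filter_upwards [self_mem_nhdsWithin] with e he
      rw [h0, zero_add]; exact mul_pos he h1
  obtain ⟨e, he, he'⟩ := (this.and self_mem_nhdsWithin).exists
  exact ⟨e, he', he⟩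

/-- Tilting the line `p a` slightly towards `d` makes a weak support strict: points off the line
keep their sign and points on it get the sign given by `d`. -/
theorem exists_halfplane_of_lex {Q : Finset Plane} {p a d : Plane}
    (h : ∀ x ∈ Q, x ≠ p → 0 < orient p a x ∨ (orient p a x = 0 ∧ 0 < orient p d x)) :
    ∃ w, ∀ x ∈ Q, x ≠ p → 0 < orient p w x := by
  classical
  obtain ⟨e, he, h'⟩ := exists_pos_add_mul (Q := Q.erase p) (A := orient p a) (B := orient p d)
    (fun x hx => h x (Finset.mem_of_mem_erase hx) (Finset.ne_of_mem_erase hx))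
  refine ⟨a + e • (d - p), fun x hx hxp => ?_⟩
  have := h' x (Finset.mem_erase.2 ⟨hxp, hx⟩)
  have e1 : orient p (a + e • (d - p)) x = orient p a x + e * orient p d x := by
    simp only [orient, PiLp.add_apply, PiLp.sub_apply, PiLp.smul_apply, smul_eq_mul]; ring
  rwa [e1]

theorem isHullEdge_of_left {Q : Finset Plane} {b c z : Plane} (hb : b ∈ Q) (hc : c ∈ Q)
    (hz : z ∈ Q) (hzb : z ≠ b) (hzc : z ≠ c) (hbc : b ≠ c)
    (h : ∀ p ∈ Q, p ≠ b → p ≠ c → 0 < orient b c p) : IsHullEdge Q b c := by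
  have h0 := h z hz hzb hzc
  refine ⟨?_, ?_, hbc, h⟩
  -- The line `b c` fails to be strict at `b` only because of `c`; the reflection of `z` in `b` is a
  -- tilt that puts `c` on the left.
  · obtain ⟨w, hw⟩ := exists_halfplane_of_lex (Q := Q) (p := b) (a := c) (d := (2 : ℝ) • b - z) (by
      intro x hx hxb
      by_cases hxc : x = c
      · right
        subst hxc
        have : orient b ((2 : ℝ) • b - z) x = orient b x z := by
          simp [orient]; ring
        exact ⟨by simp, by rwa [this]⟩
      · exact Or.inl (h x hx hxb hxc))
    exact mem_hullVertices_of_halfplane hb hw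
  · obtain ⟨w, hw⟩ := exists_halfplane_of_lex (Q := Q) (p := c) (a := (2 : ℝ) • c - b) (d := z) (by
      intro x hx hxc
      have e : orient c ((2 : ℝ) • c - b) x = orient b c x := by
        simp [orient]; ring
      rw [e]
      by_cases hxb : x = b
      · right
        subst hxb
        exact ⟨by simp, by rwa [orient_rot]⟩
      · exact Or.inl (h x hx hxb hxc))
    exact mem_hullVertices_of_halfplane hc hw

/-- No three points of `Q` are collinear, in terms of `orient`. -/
def OrientGeneral (Q : Finset Plane) : Prop :=
  ∀ a ∈ Q, ∀ b ∈ Q, ∀ c ∈ Q, a ≠ b → b ≠ c → a ≠ c → orient a b c ≠ 0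

theorem GeneralPosition.orientGeneral {P : Finset Plane} (hP : GeneralPosition P) :
    OrientGeneral P := fun _ ha _ hb _ hc hab hbc hac => hP.orient_ne_zero ha hb hc hab hbc hac

theorem OrientGeneral.mono {Q Q' : Finset Plane} (h : OrientGeneral Q) (hs : Q' ⊆ Q) :
    OrientGeneral Q' := fun a ha b hb c hc => h a (hs ha) b (hs hb) c (hs hc)

theorem IsHullEdge.pos {Q : Finset Plane} {b c p : Plane} (h : IsHullEdge Q b c) (hp : p ∈ Q)
    (hb : p ≠ b) (hc : p ≠ c) : 0 < orient b c p := h.2.2.2 p hp hb hc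

theorem IsHullEdge.nonneg {Q : Finset Plane} {b c p : Plane} (h : IsHullEdge Q b c) (hp : p ∈ Q) :
    0 ≤ orient b c p := by
  by_cases hb : p = b
  · simp [hb]
  by_cases hc : p = c
  · simp [hc]
  exact (h.pos hp hb hc).le

theorem IsHullEdge.left_mem {Q : Finset Plane} {b c : Plane} (h : IsHullEdge Q b c) : b ∈ Q :=
  mem_of_mem_hullVertices h.1

theorem IsHullEdge.right_mem {Q : Finset Plane} {b c : Plane} (h : IsHullEdge Q b c) : c ∈ Q :=
  mem_of_mem_hullVertices h.2.1

theorem IsHullEdge.right_unique {Q : Finset Plane} {b c c' : Plane} (h : IsHullEdge Q b c)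
    (h' : IsHullEdge Q b c') : c = c' := by
  by_contra hne
  have h1 := h.pos h'.right_mem h'.2.2.1.symm (Ne.symm hne)
  have h2 := h'.pos h.right_mem h.2.2.1.symm hne
  rw [orient_swap_right] at h2; linarith

theorem IsHullEdge.left_unique {Q : Finset Plane} {b b' c : Plane} (h : IsHullEdge Q b c)
    (h' : IsHullEdge Q b' c) : b = b' := by
  by_contra hne
  have h1 := h.pos h'.left_mem (Ne.symm hne) h'.2.2.1
  have h2 := h'.pos h.left_mem hne h.2.2.1
  have : orient b' c b = -orient b c b' := by unfold orient; ring
  linarith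

theorem exists_ne_ne {Q : Finset Plane} (h : 3 ≤ Q.card) (a b : Plane) :
    ∃ z ∈ Q, z ≠ a ∧ z ≠ b := by
  classical
  obtain ⟨z, hz⟩ : ((Q.erase a).erase b).Nonempty := by
    rw [← Finset.card_pos]
    have := Finset.pred_card_le_card_erase (s := Q) (a := a)
    have := Finset.pred_card_le_card_erase (s := Q.erase a) (a := b)
    omega
  simp only [Finset.mem_erase] at hz
  exact ⟨z, hz.2.2, hz.2.1, hz.1⟩

/-- Gift wrapping: the next hull vertex is the first point in the angular order about `b`. -/
theorem exists_isHullEdge {Q : Finset Plane} (hQ : OrientGeneral Q) (h3 : 3 ≤ Q.card) {b : Plane}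
    (hb : b ∈ hullVertices Q) : ∃ c, IsHullEdge Q b c := by
  classical
  obtain ⟨w, hw⟩ := exists_halfplane hb
  have hbQ := mem_of_mem_hullVertices hb
  obtain ⟨z, hz, hzb, -⟩ := exists_ne_ne h3 b b
  obtain ⟨c, hc, hmin⟩ := exists_rightmost (o := b) (w := w) (Q.erase b)
    ⟨z, Finset.mem_erase.2 ⟨hzb, hz⟩⟩
    (fun x hx => hw x (Finset.mem_of_mem_erase hx) (Finset.ne_of_mem_erase hx))
    (fun x hx y hy hxy => hQ b hbQ x (Finset.mem_of_mem_erase hx) y (Finset.mem_of_mem_erase hy)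
      (Finset.ne_of_mem_erase hx).symm hxy (Finset.ne_of_mem_erase hy).symm)
  obtain ⟨z', hz', hzb', hzc'⟩ := exists_ne_ne h3 b c
  exact ⟨c, isHullEdge_of_left hbQ (Finset.mem_of_mem_erase hc) hz' hzb' hzc'
    (Finset.ne_of_mem_erase hc).symm
    fun p hp hpb hpc => hmin p (Finset.mem_erase.2 ⟨hpb, hp⟩) hpc⟩

/-- A sequence that turns left about `p` at each step and stays in a half-plane at `p` never closes
up. This is the tool for showing that closed polygons surround a point. -/
theorem orient_chain {p w : Plane} {c : ℤ → Plane} {i j : ℤ} (hij : i < j)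
    (hw : ∀ l, i ≤ l → l ≤ j → 0 < orient p w (c l))
    (hc : ∀ l, i ≤ l → l < j → 0 < orient p (c l) (c (l + 1))) : 0 < orient p (c i) (c j) := by
  induction j, (show i + 1 ≤ j by omega) using Int.leInduction with
  | base => exact hc i le_rfl (by omega)
  | succ j hj ih =>
    exact orient_trans (hw i le_rfl (by omega)) (hw j (by omega) (by omega))
      (hw (j + 1) (by omega) le_rfl)
      (ih (by omega) (fun l h1 h2 => hw l h1 (by omega)) fun l h1 h2 => hc l h1 (by omega))
      (hc j (by omega) (by omega))

/-- The vertices of the convex hull in counterclockwise order, as a periodic sequence. -/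
structure HullEnum (Q : Finset Plane) (c : ℤ → Plane) (k : ℕ) : Prop where
  pos : 0 < k
  eq_iff : ∀ i j, c i = c j ↔ (k : ℤ) ∣ i - j
  edge : ∀ i, IsHullEdge Q (c i) (c (i + 1))
  surj : ∀ p ∈ hullVertices Q, ∃ i, c i = p

/-- The successor along hull edges is injective, hence a permutation of the finite set of hull
vertices, and the sequence is the orbit of one vertex under it. -/
theorem exists_hullEnum {Q : Finset Plane} (hQ : OrientGeneral Q) (h3 : 3 ≤ Q.card) :
    ∃ c k, HullEnum Q c k := by
  classical
  have hne : (hullVertices Q).Nonempty := by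
    have hQne : (Q : Set Plane).Nonempty := by
      obtain ⟨z, hz, -⟩ := exists_ne_ne h3 0 0
      exact ⟨z, hz⟩
    obtain ⟨p, hp⟩ := (Q.finite_toSet.isCompact_convexHull (𝕜 := ℝ)).extremePoints_nonempty
      hQne.convexHull
    exact ⟨p, Finset.mem_filter.2 ⟨extremePoints_convexHull_subset hp, hp⟩⟩
  obtain ⟨b0, hb0⟩ := hne
  choose f hf using fun b : {p // p ∈ hullVertices Q} => exists_isHullEdge hQ h3 b.2
  let g : {p // p ∈ hullVertices Q} → {p // p ∈ hullVertices Q} := fun b => ⟨f b, (hf b).2.1⟩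
  have hg : Function.Injective g := by
    intro a b hab
    have h1 : f a = f b := congrArg Subtype.val hab
    have := hf a
    rw [h1] at this
    exact Subtype.ext (this.left_unique (hf b))
  let σ : Equiv.Perm {p // p ∈ hullVertices Q} :=
    Equiv.ofBijective g (Finite.injective_iff_bijective.1 hg)
  let x0 : {p // p ∈ hullVertices Q} := ⟨b0, hb0⟩
  let c : ℤ → Plane := fun i => ((σ ^ i) x0).1
  let k := Function.minimalPeriod (σ • ·) x0
  have hkpos : 0 < k := by
    apply Function.minimalPeriod_pos_of_mem_periodicPts
    exact Function.Injective.mem_periodicPts hg x0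
  have heq : ∀ i j, c i = c j ↔ (k : ℤ) ∣ i - j := by
    intro i j
    rw [← MulAction.zpow_smul_eq_iff_minimalPeriod_dvd]
    simp only [c, Equiv.Perm.smul_def, sub_eq_neg_add, zpow_add, Equiv.Perm.mul_apply, zpow_neg]
    rw [Equiv.Perm.inv_eq_iff_eq, Subtype.ext_iff]
  have hedge : ∀ i, IsHullEdge Q (c i) (c (i + 1)) := by
    intro i
    have : c (i + 1) = f ((σ ^ i) x0) := by
      simp only [c]
      rw [add_comm, zpow_add, zpow_one, Equiv.Perm.mul_apply]
      rfl
    rw [this]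
    exact hf _
  refine ⟨c, k, hkpos, heq, hedge, ?_⟩
  intro p hp
  by_contra hcon
  push Not at hcon
  obtain ⟨w, hw⟩ := exists_halfplane hp
  have hpQ := mem_of_mem_hullVertices hp
  -- A hull vertex `p` outside the orbit would have the whole closed orbit in a half-plane, turning
  -- left about `p` all the time.
  have := orient_chain (p := p) (w := w) (c := c) (i := 0) (j := k) (by omega)
    (fun l _ _ => hw _ (hedge l).left_mem (hcon l)) (fun l _ _ => by
      rw [← orient_rot]
      exact (hedge l).pos hpQ (hcon l).symm (hcon (l + 1)).symm)
  rw [(heq 0 k).2 (by simp)] at this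
  simp at this

namespace HullEnum

variable {Q : Finset Plane} {c : ℤ → Plane} {k : ℕ}

theorem add_period (H : HullEnum Q c k) (i : ℤ) : c (i + k) = c i :=
  (H.eq_iff _ _).2 (by simp)

theorem mem (H : HullEnum Q c k) (i : ℤ) : c i ∈ Q := (H.edge i).left_mem

theorem mem_hull (H : HullEnum Q c k) (i : ℤ) : c i ∈ hullVertices Q := (H.edge i).1

theorem exists_mem_Ico (H : HullEnum Q c k) {p : Plane} (hp : p ∈ hullVertices Q) (a : ℤ) :
    ∃ i, a ≤ i ∧ i < a + k ∧ c i = p := by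
  obtain ⟨i, rfl⟩ := H.surj p hp
  have hk : (0 : ℤ) < k := by exact_mod_cast H.pos
  refine ⟨a + (i - a) % k, ?_, ?_, ?_⟩
  · have := Int.emod_nonneg (i - a) hk.ne'; omega
  · have := Int.emod_lt_of_pos (i - a) hk; omega
  · rw [H.eq_iff]
    have : a + (i - a) % k - i = -((i - a) - (i - a) % k) := by ring
    rw [this, dvd_neg]
    exact Int.dvd_self_sub_emod

theorem exists_edge (H : HullEnum Q c k) {b d : Plane} (h : IsHullEdge Q b d) (a : ℤ) :
    ∃ i, a ≤ i ∧ i < a + k ∧ c i = b ∧ c (i + 1) = d := by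
  obtain ⟨i, h1, h2, rfl⟩ := H.exists_mem_Ico h.1 a
  exact ⟨i, h1, h2, rfl, (H.edge i).right_unique h⟩

theorem eq_of_Ico (H : HullEnum Q c k) {i j : ℤ} (h : c i = c j) (h1 : i < j + k) (h2 : j < i + k) :
    i = j := by
  obtain ⟨m, hm⟩ := (H.eq_iff i j).1 h
  have hk : (0 : ℤ) < k := by exact_mod_cast H.pos
  have : m < 1 := by by_contra hc; nlinarith
  have : -1 < m := by by_contra hc; nlinarith
  obtain rfl : m = 0 := by omega
  omega

theorem card_eq (H : HullEnum Q c k) : (hullVertices Q).card = k := by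
  classical
  have : hullVertices Q = (Finset.range k).image (fun i : ℕ => c i) := by
    ext p
    simp only [Finset.mem_image, Finset.mem_range]
    constructor
    · intro hp
      obtain ⟨i, h1, h2, rfl⟩ := H.exists_mem_Ico hp 0
      exact ⟨i.toNat, by omega, by rw [Int.toNat_of_nonneg h1]⟩
    · rintro ⟨i, -, rfl⟩
      exact H.mem_hull i
  rw [this, Finset.card_image_of_injOn, Finset.card_range]
  intro i hi j hj hij
  simp only [Finset.coe_range, Set.mem_Iio] at hi hj
  have := H.eq_of_Ico hij (by omega) (by omega)
  omega

theorem ne_succ (H : HullEnum Q c k) (i : ℤ) : c i ≠ c (i + 1) := (H.edge i).2.2.1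

theorem three_le (H : HullEnum Q c k) (h3 : 3 ≤ Q.card) : 3 ≤ k := by
  have hpos := H.pos
  by_contra hk
  have : k = 1 ∨ k = 2 := by omega
  rcases this with rfl | rfl
  · exact H.ne_succ 0 ((H.eq_iff _ _).2 (by simp))
  · obtain ⟨z, hz, h0, h1⟩ := exists_ne_ne h3 (c 0) (c (0 + 1))
    have e0 := (H.edge 0).pos hz h0 h1
    have h2 : c (0 + 1 + 1) = c 0 := (H.eq_iff _ _).2 (by norm_num)
    have e1 := (H.edge (0 + 1)).pos hz h1 (by rwa [h2])
    rw [h2, orient_swap] at e1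
    linarith

theorem orient_pos (H : HullEnum Q c k) {p : Plane} (hp : p ∈ innerPoints Q) (i : ℤ) :
    0 < orient p (c i) (c (i + 1)) := by
  rw [mem_innerPoints] at hp
  rw [← orient_rot]
  refine (H.edge i).pos hp.1 ?_ ?_ <;> rintro rfl <;> exact hp.2 (H.mem_hull _)

/-- The hull polygon closes up around `p`, so by `orient_chain` it does not stay in a half-plane at
`p`. -/
theorem exists_orient_nonpos (H : HullEnum Q c k) {p : Plane} (hp : p ∈ innerPoints Q) (w : Plane) :
    ∃ i, orient p w (c i) ≤ 0 := by
  by_contra hcon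
  push Not at hcon
  have hk := H.pos
  have := orient_chain (p := p) (w := w) (c := c) (i := 0) (j := k) (by omega)
    (fun l _ _ => hcon l) (fun l _ _ => H.orient_pos hp l)
  rw [(H.eq_iff 0 k).2 (by simp)] at this
  simp at this

theorem exists_orient_nonneg (H : HullEnum Q c k) {p : Plane} (hp : p ∈ innerPoints Q) (w : Plane) :
    ∃ i, 0 ≤ orient p w (c i) := by
  obtain ⟨i, hi⟩ := H.exists_orient_nonpos hp ((2 : ℝ) • p - w)
  have : orient p ((2 : ℝ) • p - w) (c i) = -orient p w (c i) := by
    simp [orient]; ring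
  exact ⟨i, by linarith⟩

end HullEnum

/-- A discrete intermediate value principle. The first switch is taken, so that `p` is known on the
whole initial segment. -/
theorem exists_switch {p : ℤ → Prop} {i j : ℤ} (hij : i ≤ j) (hi : p i) (hj : ¬ p j) :
    ∃ l, i ≤ l ∧ l < j ∧ (∀ m, i ≤ m → m ≤ l → p m) ∧ ¬ p (l + 1) := by
  by_contra hcon
  push Not at hcon
  have : ∀ l, i ≤ l → l ≤ j → ∀ m, i ≤ m → m ≤ l → p m := by
    intro l hl
    induction l, hl using Int.leInduction with
    | base => intro _ m h1 h2; obtain rfl : m = i := by omega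
              exact hi
    | succ l hl ih =>
      intro hlj m h1 h2
      rcases h2.lt_or_eq with h2 | rfl
      · exact ih (by omega) m h1 (by omega)
      · exact hcon l hl (by omega) (ih (by omega))
  exact hj (this j hij le_rfl j hij le_rfl)

namespace HullEnum

variable {Q : Finset Plane} {c : ℤ → Plane} {k : ℕ}

theorem crossing_unique (H : HullEnum Q c k) {a b : Plane} {i j : ℤ}
    (hi : orient a b (c i) < 0) (hi' : 0 ≤ orient a b (c (i + 1)))
    (hj : orient a b (c j) < 0) (hj' : 0 ≤ orient a b (c (j + 1))) : (k : ℤ) ∣ i - j := by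
  have e1 := H.edge i
  have e2 := H.edge j
  -- With the given signs all four summands are nonnegative, hence zero. So `c (j + 1)` lies on the
  -- line of the edge `i`, and its side of `a b` shows that it is not `c i`.
  have key : orient a b (c (j + 1)) * orient (c i) (c (i + 1)) (c j)
      - orient a b (c j) * orient (c i) (c (i + 1)) (c (j + 1))
      + orient a b (c (i + 1)) * orient (c j) (c (j + 1)) (c i)
      - orient a b (c i) * orient (c j) (c (j + 1)) (c (i + 1)) = 0 := by
    unfold orient; ring
  have h1 := e1.nonneg e2.left_mem
  have h2 := e1.nonneg e2.right_mem
  have h3 := e2.nonneg e1.left_mem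
  have h4 := e2.nonneg e1.right_mem
  have h0 : orient (c i) (c (i + 1)) (c (j + 1)) = 0 := by
    nlinarith [mul_nonneg hj' h1, mul_nonneg hi' h3, mul_nonneg (neg_pos.2 hi).le h4,
      mul_nonneg (neg_pos.2 hj).le h2]
  have hne : c (j + 1) ≠ c i := by intro h; rw [h] at hj'; linarith
  have heq : c (j + 1) = c (i + 1) := by
    by_contra hc
    exact (e1.pos e2.right_mem hne hc).ne' h0
  rw [heq] at e2
  exact (H.eq_iff _ _).1 (e1.left_unique e2)

theorem exists_crossing (H : HullEnum Q c k) {a b : Plane} {i j : ℤ}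
    (hi : orient a b (c i) < 0) (hj : 0 ≤ orient a b (c j)) :
    ∃ l, orient a b (c l) < 0 ∧ 0 ≤ orient a b (c (l + 1)) := by
  obtain ⟨j', h1, h2, h3⟩ := H.exists_mem_Ico (H.mem_hull j) i
  obtain ⟨l, h3', -, h4, h5⟩ := exists_switch (p := fun l => orient a b (c l) < 0) h1 hi
    (by rw [h3]; exact not_lt.2 hj)
  exact ⟨l, h4 l h3' le_rfl, not_lt.1 h5⟩

end HullEnum


/-! ### Visibility of inner hull edges from the outer corners, and the two tangents. -/

/-- The hull vertices `c` of `P` and the hull vertices `u` of the inner points of `P`. -/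
structure Rings (P : Finset Plane) (c u : ℤ → Plane) (k h : ℕ) : Prop where
  gen : OrientGeneral P
  three : 3 ≤ (innerPoints P).card
  outer : HullEnum P c k
  inner : HullEnum (innerPoints P) u h

/-- The corner `c i` sees the edge from `u (n - 1)` to `u n`. -/
def Sees (c u : ℤ → Plane) (i n : ℤ) : Prop := orient (u (n - 1)) (u n) (c i) < 0

/-- All other inner points are to the right of the ray from `c i` through `u n`. -/
def TangentL (P : Finset Plane) (c u : ℤ → Plane) (i n : ℤ) : Prop :=
  ∀ x ∈ innerPoints P, x ≠ u n → orient (c i) (u n) x < 0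

/-- All other inner points are to the left of the ray from `c i` through `u n`. -/
def TangentR (P : Finset Plane) (c u : ℤ → Plane) (i n : ℤ) : Prop :=
  ∀ x ∈ innerPoints P, x ≠ u n → 0 < orient (c i) (u n) x

theorem innerPoints_subset (P : Finset Plane) : innerPoints P ⊆ P :=
  fun _ h => (mem_innerPoints.1 h).1

namespace Rings

variable {P : Finset Plane} {c u : ℤ → Plane} {k h : ℕ}

theorem genInner (S : Rings P c u k h) : OrientGeneral (innerPoints P) :=
  S.gen.mono (innerPoints_subset P)

theorem three_le_h (S : Rings P c u k h) : 3 ≤ h := S.inner.three_le S.three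

theorem c_mem (S : Rings P c u k h) (i : ℤ) : c i ∈ P := S.outer.mem i

theorem u_mem (S : Rings P c u k h) (n : ℤ) : u n ∈ innerPoints P := S.inner.mem n

theorem mem_P {x : Plane} (hx : x ∈ innerPoints P) : x ∈ P := innerPoints_subset P hx

theorem ne_c (S : Rings P c u k h) (i : ℤ) {x : Plane} (hx : x ∈ innerPoints P) : x ≠ c i := by
  rintro rfl
  exact (mem_innerPoints.1 hx).2 (S.outer.mem_hull i)

theorem u_edge (S : Rings P c u k h) (n : ℤ) : IsHullEdge (innerPoints P) (u (n - 1)) (u n) := by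
  simpa using S.inner.edge (n - 1)

theorem u_ne (S : Rings P c u k h) {m n : ℤ} (h1 : m < n) (h2 : n < m + h) : u m ≠ u n := by
  intro e
  have := S.inner.eq_of_Ico e (by omega) (by omega)
  omega

theorem ne_zero (S : Rings P c u k h) (i : ℤ) {x y : Plane} (hx : x ∈ innerPoints P)
    (hy : y ∈ innerPoints P) (hxy : x ≠ y) : orient (c i) x y ≠ 0 :=
  S.gen _ (S.c_mem i) _ (mem_P hx) _ (mem_P hy) (S.ne_c i hx).symm hxy (S.ne_c i hy).symm

theorem gate_ne_zero (S : Rings P c u k h) (i n : ℤ) : orient (u (n - 1)) (u n) (c i) ≠ 0 := by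
  rw [← orient_rot, ← orient_rot, orient_rot, orient_rot, ← orient_rot, orient_rot, orient_rot]
  exact S.ne_zero i (S.u_mem _) (S.u_mem _) (S.u_edge n).2.2.1

theorem not_sees (S : Rings P c u k h) {i n : ℤ} :
    ¬ Sees c u i n ↔ 0 < orient (u (n - 1)) (u n) (c i) := by
  unfold Sees
  have := S.gate_ne_zero i n
  constructor
  · intro h1; exact lt_of_le_of_ne (not_lt.1 h1) this.symm
  · intro h1; linarith

theorem corner_pos (S : Rings P c u k h) (i : ℤ) {x : Plane} (hx : x ∈ innerPoints P) :
    0 < orient x (c i) (c (i + 1)) := S.outer.orient_pos hx i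

/-- The local picture at the inner hull vertex `u n`. -/
theorem cone (S : Rings P c u k h) (n : ℤ) : 0 < orient (u n) (u (n + 1)) (u (n - 1)) ∧
    (∀ x ∈ innerPoints P, x ≠ u n → x ≠ u (n + 1) → 0 < orient (u n) (u (n + 1)) x) ∧
    ∀ x ∈ innerPoints P, x ≠ u n → x ≠ u (n - 1) → 0 < orient (u n) x (u (n - 1)) := by
  have h3 := S.three_le_h
  have h1 : ∀ x ∈ innerPoints P, x ≠ u n → x ≠ u (n + 1) → 0 < orient (u n) (u (n + 1)) x :=
    fun x hx h1 h2 => (S.inner.edge n).pos hx h1 h2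
  refine ⟨h1 _ (S.u_mem _) (S.u_ne (by omega) (by omega)) (S.u_ne (by omega) (by omega)), h1,
    fun x hx h1 h2 => ?_⟩
  rw [orient_rot]
  exact (S.u_edge n).pos hx h2 h1

theorem sees_iff (c u : ℤ → Plane) (i n : ℤ) : Sees c u i n ↔ orient (u n) (c i) (u (n - 1)) < 0 := by
  rw [orient_rot]; rfl

theorem sees_succ_iff (c u : ℤ → Plane) (i n : ℤ) :
    Sees c u i (n + 1) ↔ orient (u n) (u (n + 1)) (c i) < 0 := by
  unfold Sees; rw [add_sub_cancel_right]

theorem not_sees_iff (S : Rings P c u k h) (i n : ℤ) :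
    ¬ Sees c u i n ↔ 0 < orient (u n) (c i) (u (n - 1)) := by
  rw [orient_rot]; exact S.not_sees

theorem not_sees_succ_iff (S : Rings P c u k h) (i n : ℤ) :
    ¬ Sees c u i (n + 1) ↔ 0 < orient (u n) (u (n + 1)) (c i) := by
  rw [S.not_sees, add_sub_cancel_right]

/-- Tangency is a local condition: all inner points lie in the cone at `u n` spanned by the two
incident gates, so the two neighbours of `u n` decide. -/
theorem tangentL_iff (S : Rings P c u k h) (i n : ℤ) :
    TangentL P c u i n ↔ ¬ Sees c u i n ∧ Sees c u i (n + 1) := by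
  obtain ⟨c0, c1, c2⟩ := S.cone n
  have h3 := S.three_le_h
  rw [S.not_sees_iff, sees_succ_iff]
  constructor
  · intro H
    have e1 := H _ (S.u_mem (n - 1)) (S.u_ne (by omega) (by omega))
    have e2 := H _ (S.u_mem (n + 1)) (S.u_ne (by omega) (by omega)).symm
    rw [orient_swap] at e1
    rw [← orient_rot] at e2
    exact ⟨by linarith, e2⟩
  · rintro ⟨e1, e2⟩ x hx hxn
    rw [orient_swap, neg_lt_zero]
    by_cases hm : x = u (n - 1)
    · rwa [hm]
    by_cases hp : x = u (n + 1)
    · rw [hp, orient_swap_right]; linarith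
    have a1 := c1 x hx hxn hp
    have a2 := c2 x hx hxn hm
    have := orient_pluecker (u n) (c i) (u (n + 1)) x (u (n - 1))
    rw [orient_swap_right (u n) (u (n + 1)) (c i)] at this
    by_contra hcon
    nlinarith [mul_pos (neg_pos.2 e2) a2, mul_pos e1 a1,
      mul_nonneg c0.le (sub_nonneg.2 (not_lt.1 hcon))]

theorem tangentR_iff (S : Rings P c u k h) (i n : ℤ) :
    TangentR P c u i n ↔ Sees c u i n ∧ ¬ Sees c u i (n + 1) := by
  obtain ⟨c0, c1, c2⟩ := S.cone n
  have h3 := S.three_le_h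
  rw [S.not_sees_succ_iff, sees_iff]
  constructor
  · intro H
    have e1 := H _ (S.u_mem (n - 1)) (S.u_ne (by omega) (by omega))
    have e2 := H _ (S.u_mem (n + 1)) (S.u_ne (by omega) (by omega)).symm
    rw [orient_swap] at e1
    rw [← orient_rot] at e2
    exact ⟨by linarith, e2⟩
  · rintro ⟨e1, e2⟩ x hx hxn
    rw [orient_swap, neg_pos]
    by_cases hm : x = u (n - 1)
    · rwa [hm]
    by_cases hp : x = u (n + 1)
    · rw [hp, orient_swap_right]; linarith
    have a1 := c1 x hx hxn hp
    have a2 := c2 x hx hxn hm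
    have := orient_pluecker (u n) (c i) (u (n + 1)) x (u (n - 1))
    rw [orient_swap_right (u n) (u (n + 1)) (c i)] at this
    by_contra hcon
    nlinarith [mul_pos e2 a2, mul_pos (neg_pos.2 e1) a1,
      mul_nonneg c0.le (sub_nonneg.2 (not_lt.1 hcon))]

theorem sees_period (S : Rings P c u k h) (i n : ℤ) : Sees c u i (n + h) ↔ Sees c u i n := by
  unfold Sees
  rw [S.inner.add_period, show n + h - 1 = n - 1 + h by ring, S.inner.add_period]

theorem exists_wide (S : Rings P c u k h) (i : ℤ) :
    ∃ w, ∀ x ∈ innerPoints P, 0 < orient (c i) w x := by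
  obtain ⟨w, hw⟩ := exists_halfplane (S.outer.mem_hull i)
  exact ⟨w, fun x hx => hw x (mem_P hx) (S.ne_c i hx)⟩

/-- The starting point `a` of the index window is free, so successive tangents can be lifted to a
monotone integer sequence. -/
theorem exists_tangentL (S : Rings P c u k h) (i a : ℤ) :
    ∃ n, a ≤ n ∧ n < a + h ∧ TangentL P c u i n := by
  obtain ⟨w, hw⟩ := S.exists_wide i
  obtain ⟨v, hv, hmax⟩ := exists_leftmost (innerPoints P) ⟨_, S.u_mem 0⟩ hw
    (fun x hx y hy hxy => S.ne_zero i hx hy hxy)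
  have : v ∈ hullVertices (innerPoints P) := by
    refine mem_hullVertices_of_halfplane (w := c i) hv fun x hx hxv => ?_
    rw [orient_swap]; linarith [hmax x hx hxv]
  obtain ⟨n, h1, h2, rfl⟩ := S.inner.exists_mem_Ico this a
  exact ⟨n, h1, h2, hmax⟩

theorem tangentL_dvd (S : Rings P c u k h) {i a b : ℤ} (ha : TangentL P c u i a)
    (hb : TangentL P c u i b) : (h : ℤ) ∣ a - b := by
  rw [← S.inner.eq_iff]
  by_contra hne
  have h1 := ha _ (S.u_mem b) (Ne.symm hne)
  have h2 := hb _ (S.u_mem a) hne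
  rw [orient_swap_right] at h2; linarith

theorem tangentL_unique (S : Rings P c u k h) {i a b : ℤ} (ha : TangentL P c u i a)
    (hb : TangentL P c u i b) (h1 : a < b + h) (h2 : b < a + h) : a = b :=
  S.inner.eq_of_Ico ((S.inner.eq_iff _ _).2 (S.tangentL_dvd ha hb)) h1 h2

/-- In a period starting at the left tangent, the visible gates form an initial segment. -/
theorem exists_window (S : Rings P c u k h) {i a : ℤ} (ha : TangentL P c u i a) :
    ∃ r, a < r ∧ r < a + h ∧ TangentR P c u i r ∧
      ∀ n, a < n → n ≤ a + h → (Sees c u i n ↔ n ≤ r) := by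
  have h3 := S.three_le_h
  have ha' := (S.tangentL_iff i a).1 ha
  obtain ⟨r, h1, h2, h4, h5⟩ := exists_switch (p := Sees c u i) (i := a + 1) (j := a + h)
    (by omega) ha'.2 (by rw [S.sees_period]; exact ha'.1)
  refine ⟨r, by omega, by omega, (S.tangentR_iff i r).2 ⟨h4 r h1 le_rfl, h5⟩, fun n hn hn' => ?_⟩
  constructor
  · intro hs
    by_contra hlt
    obtain ⟨m, m1, m2, m3, m4⟩ := exists_switch (p := fun n => ¬ Sees c u i n) (i := r + 1) (j := n)
      (by omega) h5 (not_not.2 hs)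
    have hm : TangentL P c u i m := (S.tangentL_iff i m).2 ⟨m3 m m1 le_rfl, not_not.1 m4⟩
    have := S.tangentL_unique hm ha (by omega) (by omega)
    omega
  · intro hs; exact h4 n (by omega) hs

theorem corner_triple (S : Rings P c u k h) (i n : ℤ) : 0 < orient (u n) (c i) (c (i + 1)) :=
  S.corner_pos i (S.u_mem n)

/-- A corner that sees neither gate at `u n` lies in the cone of the inner hull there. From that
cone a left turn of less than π cannot reach the sector of the corners with left tangent `u n`. The
next two lemmas exclude other transitions about `u n` in the same way. -/
theorem sees_of_tangentL_succ (S : Rings P c u k h) {i n : ℤ} (H : TangentL P c u (i + 1) n)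
    (hn : ¬ Sees c u i n) : Sees c u i (n + 1) := by
  by_contra hcon
  obtain ⟨c0, -, -⟩ := S.cone n
  have h1 := (S.tangentL_iff _ _).1 H
  rw [S.not_sees_iff, sees_succ_iff] at h1
  rw [S.not_sees_iff] at hn
  rw [S.not_sees_succ_iff] at hcon
  have h4 := S.corner_triple i n
  have := orient_pluecker (u n) (c (i + 1)) (u (n + 1)) (c i) (u (n - 1))
  rw [orient_swap_right (u n) (u (n + 1)) (c (i + 1)),
    orient_swap_right (u n) (c i) (c (i + 1))] at this
  nlinarith [mul_pos (neg_pos.2 h1.2) hn, mul_pos h4 c0, mul_pos h1.1 hcon]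

theorem not_sees_of_tangentL (S : Rings P c u k h) {i n : ℤ} (H : TangentL P c u i n)
    (hn : Sees c u (i + 1) n) : ¬ Sees c u (i + 1) (n + 1) := by
  intro hcon
  obtain ⟨c0, -, -⟩ := S.cone n
  have h1 := (S.tangentL_iff _ _).1 H
  rw [S.not_sees_iff, sees_succ_iff] at h1
  rw [sees_iff] at hn
  rw [sees_succ_iff] at hcon
  have h4 := S.corner_triple i n
  have := orient_pluecker (u n) (c i) (u (n + 1)) (c (i + 1)) (u (n - 1))
  rw [orient_swap_right (u n) (u (n + 1)) (c i)] at this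
  nlinarith [mul_pos (neg_pos.2 h1.2) (neg_pos.2 hn), mul_pos h4 c0,
    mul_pos h1.1 (neg_pos.2 hcon)]

theorem not_sees_of_tangentR_succ (S : Rings P c u k h) {i n : ℤ} (H : TangentR P c u (i + 1) n)
    (hn : Sees c u i n) : ¬ Sees c u i (n + 1) := by
  intro hcon
  obtain ⟨c0, -, -⟩ := S.cone n
  have h1 := (S.tangentR_iff _ _).1 H
  rw [S.not_sees_succ_iff, sees_iff] at h1
  rw [sees_iff] at hn
  rw [sees_succ_iff] at hcon
  have h4 := S.corner_triple i n
  have := orient_pluecker (u n) (c i) (u (n + 1)) (c (i + 1)) (u (n - 1))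
  rw [orient_swap_right (u n) (u (n + 1)) (c i)] at this
  nlinarith [mul_pos (neg_pos.2 h1.1) (neg_pos.2 hcon), mul_pos h4 c0,
    mul_pos h1.2 (neg_pos.2 hn)]

/-- Comparison of the visible gates of consecutive corners. -/
theorem window_step (S : Rings P c u k h) {i a b r r' : ℤ} (ha : TangentL P c u i a)
    (hb : TangentL P c u (i + 1) b) (hab : a ≤ b) (hba : b < a + h)
    (hr1 : a < r) (hr2 : r < a + h)
    (hr : ∀ n, a < n → n ≤ a + h → (Sees c u i n ↔ n ≤ r))
    (hr1' : b < r') (hr2' : r' < b + h) (hR : TangentR P c u (i + 1) r')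
    (hr' : ∀ n, b < n → n ≤ b + h → (Sees c u (i + 1) n ↔ n ≤ r')) :
    b ≤ r ∧ r ≤ r' ∧ r' ≤ a + h ∧
      ∀ n, a < n → n ≤ a + h → (Sees c u i n ∧ ¬ Sees c u (i + 1) n ↔ n ≤ b) := by
  have hbr : b ≤ r := by
    by_contra hlt
    have h1 : ¬ Sees c u i b := by rw [hr b (by omega) (by omega)]; exact hlt
    have h2 := S.sees_of_tangentL_succ hb h1
    rw [hr (b + 1) (by omega) (by omega)] at h2
    omega
  have hra : r' ≤ a + h := by
    by_contra hlt
    have h1 : Sees c u (i + 1) (a + h) := by rw [hr' _ (by omega) (by omega)]; omega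
    have h2 : Sees c u (i + 1) (a + 1 + h) := by rw [hr' _ (by omega) (by omega)]; omega
    rw [S.sees_period] at h1 h2
    exact S.not_sees_of_tangentL ha h1 h2
  have hrr : r ≤ r' := by
    by_contra hlt
    have h1 : Sees c u i r' := by rw [hr _ (by omega) (by omega)]; omega
    have h2 : Sees c u i (r' + 1) := by rw [hr _ (by omega) (by omega)]; omega
    exact S.not_sees_of_tangentR_succ hR h1 h2
  refine ⟨hbr, hrr, hra, fun n h1 h2 => ?_⟩
  rw [hr n h1 h2]
  by_cases hnb : n ≤ b
  · have : ¬ Sees c u (i + 1) n := by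
      rw [← S.sees_period, hr' _ (by omega) (by omega)]; omega
    exact ⟨fun _ => hnb, fun _ => ⟨by omega, this⟩⟩
  · rw [hr' n (by omega) (by omega)]; omega

/-- The endpoint `u (n - 1)` is inside the outer polygon, which therefore has vertices on both sides
of the line of the gate and passes from its right to its left. By `crossing_unique` it does so once
per turn. -/
theorem exists_exit (S : Rings P c u k h) (n : ℤ) :
    ∃ i, Sees c u i n ∧ ¬ Sees c u (i + 1) n := by
  obtain ⟨i, hi⟩ := S.outer.exists_orient_nonpos (mem_innerPoints.2
    (mem_innerPoints.1 (S.u_mem (n - 1)))) (u n)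
  obtain ⟨j, hj⟩ := S.outer.exists_orient_nonneg (S.u_mem (n - 1)) (u n)
  obtain ⟨l, h1, h2⟩ := S.outer.exists_crossing (lt_of_le_of_ne hi (S.gate_ne_zero i n)) hj
  exact ⟨l, h1, not_lt.2 h2⟩

theorem exit_unique (S : Rings P c u k h) {i j n : ℤ} (hi : Sees c u i n)
    (hi' : ¬ Sees c u (i + 1) n) (hj : Sees c u j n) (hj' : ¬ Sees c u (j + 1) n) :
    (k : ℤ) ∣ i - j :=
  S.outer.crossing_unique hi (not_lt.1 hi') hj (not_lt.1 hj')

end Rings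

/-- Integer lifts of the two tangents from the corners to the inner hull. -/
structure Lifts (P : Finset Plane) (c u : ℤ → Plane) (k h : ℕ) (L R : ℤ → ℤ) : Prop where
  tangentL : ∀ i, TangentL P c u i (L i)
  tangentR : ∀ i, TangentR P c u i (R i)
  lt : ∀ i, L i < R i
  lt_add : ∀ i, R i < L i + h
  mono_L : ∀ i, L i ≤ L (i + 1)
  le : ∀ i, L (i + 1) ≤ R i
  mono_R : ∀ i, R i ≤ R (i + 1)
  le_add : ∀ i, R (i + 1) ≤ L i + h
  period_L : ∀ i, L (i + k) = L i + h
  period_R : ∀ i, R (i + k) = R i + h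
  sees_iff : ∀ i n, L i < n → n ≤ L i + h → (Sees c u i n ↔ n ≤ R i)

namespace Rings

variable {P : Finset Plane} {c u : ℤ → Plane} {k h : ℕ}

theorem tangentL_add (S : Rings P c u k h) (i n q : ℤ) :
    TangentL P c u i (n + q * h) ↔ TangentL P c u i n := by
  unfold TangentL
  rw [(S.inner.eq_iff (n + q * h) n).2 (by simp)]

theorem tangentL_corner {i j : ℤ} (hc : c i = c j) (n : ℤ) :
    TangentL P c u i n ↔ TangentL P c u j n := by
  unfold TangentL; rw [hc]

theorem sees_corner {i j : ℤ} (hc : c i = c j) (n : ℤ) : Sees c u i n ↔ Sees c u j n := by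
  unfold Sees; rw [hc]

/-- The left tangents wind around the inner hull exactly once. -/
theorem winding (S : Rings P c u k h) {F : ℕ → ℤ} (hF : ∀ n : ℕ, TangentL P c u n (F n))
    (h1 : ∀ n, F n ≤ F (n + 1)) (h2 : ∀ n, F (n + 1) < F n + h) : F k = F 0 + h := by
  have hk := S.outer.pos
  have h3 := S.three_le_h
  -- The gates lost from sight between the corners `i` and `i + 1` are those with `F i < n ≤ F (i +
  -- 1)`. Each gate is lost exactly once per turn, so the total advance, a multiple `q * h`, has
  -- neither `q = 0` nor `q ≥ 2`.
  have hexit : ∀ (i : ℕ) (n : ℤ), F i < n → n ≤ F i + h →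
      (Sees c u i n ∧ ¬ Sees c u (i + 1) n ↔ n ≤ F (i + 1)) := by
    intro i
    obtain ⟨r, a1, a2, -, a4⟩ := S.exists_window (hF i)
    obtain ⟨r', b1, b2, b3, b4⟩ := S.exists_window (hF (i + 1))
    push_cast at b3 b4
    exact (S.window_step (hF i) (by exact_mod_cast hF (i + 1)) (h1 i) (h2 i) a1 a2 a4 b1 b2 b3 b4).2.2.2
  have hmono : Monotone F := monotone_nat_of_le_succ h1
  have hdvd : (h : ℤ) ∣ F k - F 0 := by
    refine S.tangentL_dvd (i := 0) ?_ (hF 0)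
    rw [tangentL_corner (j := (k : ℤ)) ((S.outer.eq_iff _ _).2 (by simp))]
    exact hF k
  obtain ⟨q, hq⟩ := hdvd
  have hge : F 0 ≤ F k := hmono (Nat.zero_le k)
  have hq0 : 0 ≤ q := by by_contra hc; nlinarith
  have hq1 : q ≠ 0 := by
    rintro rfl
    obtain ⟨i, e1, e2⟩ := S.exists_exit (F 0 + 1)
    obtain ⟨j, j1, j2, j3⟩ := S.outer.exists_mem_Ico (S.outer.mem_hull i) 0
    lift j to ℕ using j1
    have j4 : c (j + 1) = c (i + 1) := by
      rw [S.outer.eq_iff] at j3 ⊢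
      simpa using j3
    have m1 : F 0 ≤ F j := hmono (Nat.zero_le j)
    have m2 : F (j + 1) ≤ F k := hmono (by omega)
    have m3 := h1 j
    have := (hexit j (F 0 + 1) (by omega) (by omega)).1
      ⟨(sees_corner j3 _).2 e1, fun hs => e2 ((sees_corner j4 _).1 hs)⟩
    omega
  have hq2 : ¬ 2 ≤ q := by
    intro hc
    have hbig : F 0 + 2 * h ≤ F k := by nlinarith
    have sw : ∀ n, F 0 < n → n ≤ F k → ∃ i : ℕ, i < k ∧ F i < n ∧ n ≤ F (i + 1) := by
      intro n n1 n2
      obtain ⟨l, l1, l2, l3, l4⟩ := exists_switch (p := fun l : ℤ => F l.toNat < n) (i := 0) (j := k)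
        (by omega) (by simpa using n1) (by simpa using n2)
      lift l to ℕ using l1
      have l5 : ((l : ℤ) + 1).toNat = l + 1 := by omega
      rw [l5] at l4
      exact ⟨l, by omega, by simpa using l3 l (by omega) le_rfl, not_lt.1 l4⟩
    obtain ⟨i, i1, i2, i3⟩ := sw (F 0 + 1) (by omega) (by omega)
    obtain ⟨j, j1, j2, j3⟩ := sw (F 0 + 1 + h) (by omega) (by omega)
    have e1 := (hexit i _ i2 (by linarith [h2 i])).2 i3
    have e2 := (hexit j _ j2 (by linarith [h2 j])).2 j3
    rw [S.sees_period, S.sees_period] at e2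
    have hd := S.exit_unique e1.1 e1.2 e2.1 e2.2
    have : (i : ℤ) = j := S.outer.eq_of_Ico ((S.outer.eq_iff _ _).2 hd) (by omega) (by omega)
    obtain rfl : i = j := by omega
    linarith [h2 i]
  obtain rfl : q = 1 := by omega
  linarith

theorem exists_lifts (S : Rings P c u k h) : ∃ L R, Lifts P c u k h L R := by
  have hk := S.outer.pos
  have hk' : (0 : ℤ) < k := by exact_mod_cast hk
  have h3 := S.three_le_h
  obtain ⟨a0, -, -, ha0⟩ := S.exists_tangentL 0 0
  choose nx nx1 nx2 nx3 using fun i a : ℤ => S.exists_tangentL (i + 1) a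
  let F : ℕ → ℤ := fun n => Nat.rec a0 (fun n a => nx n a) n
  have hF : ∀ n : ℕ, TangentL P c u n (F n) := by
    intro n
    cases n with
    | zero => exact ha0
    | succ n => push_cast; exact nx3 _ _
  have hw := S.winding hF (fun n => nx1 n (F n)) (fun n => nx2 n (F n))
  -- The lift built over one turn is continued to all integers with increment `h` per `k` corners;
  -- `winding` makes the seam fit.
  let L : ℤ → ℤ := fun i => F (i % k).toNat + (i / k) * h
  have hmod : ∀ i : ℤ, ((i % k).toNat : ℤ) = i % k :=
    fun i => Int.toNat_of_nonneg (Int.emod_nonneg i hk'.ne')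
  have hL : ∀ i, TangentL P c u i (L i) := by
    intro i
    rw [S.tangentL_add, tangentL_corner (j := ((i % k).toNat : ℤ))]
    · exact hF _
    · rw [hmod, S.outer.eq_iff]; exact Int.dvd_self_sub_emod
  have hstep : ∀ i, L i ≤ L (i + 1) ∧ L (i + 1) < L i + h := by
    intro i
    have hlt := Int.emod_lt_of_pos i hk'
    have hnn := Int.emod_nonneg i hk'.ne'
    have hdm := Int.emod_add_mul_ediv i k
    have hval : L (i + 1) = F ((i % k).toNat + 1) + (i / k) * h := by
      by_cases hc : i % k + 1 < k
      · have e1 : (i + 1) % k = i % k + 1 := by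
          conv_lhs => rw [← hdm]
          rw [show i % ↑k + ↑k * (i / ↑k) + 1 = i % k + 1 + k * (i / k) by ring,
            Int.add_mul_emod_self_left]
          exact Int.emod_eq_of_lt (by omega) hc
        have e2 : (i + 1) / k = i / k := by
          conv_lhs => rw [← hdm]
          rw [show i % ↑k + ↑k * (i / ↑k) + 1 = i % k + 1 + k * (i / k) by ring,
            Int.add_mul_ediv_left _ _ hk'.ne', Int.ediv_eq_zero_of_lt (by omega) hc, zero_add]
        have e3 : (i % k + 1).toNat = (i % k).toNat + 1 := by omega
        simp only [L, e1, e2, e3]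
      · have e0 : i % k = k - 1 := by omega
        have e3 : i + 1 = k * (i / k + 1) := by
          have : i = (k - 1) + k * (i / k) := by rw [← e0]; exact hdm.symm
          linarith
        have e1 : (i + 1) % k = 0 := by rw [e3]; exact Int.mul_emod_right _ _
        have e2 : (i + 1) / k = i / k + 1 := by rw [e3]; exact Int.mul_ediv_cancel_left _ hk'.ne'
        have e4 : (i % k).toNat + 1 = k := by omega
        simp only [L, e1, e2, e4, hw]
        simp only [Int.toNat_zero]
        ring
    rw [hval]
    have := nx1 (i % k).toNat (F (i % k).toNat)
    have := nx2 (i % k).toNat (F (i % k).toNat)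
    exact ⟨by simp only [L]; linarith, by simp only [L]; linarith⟩
  choose R r1 r2 r3 r4 using fun i => S.exists_window (hL i)
  have hpL : ∀ i, L (i + k) = L i + h := by
    intro i
    simp only [L, Int.add_emod_right, Int.add_ediv_of_dvd_right (dvd_refl (k : ℤ)),
      Int.ediv_self hk'.ne']
    ring
  have hws := fun i => S.window_step (hL i) (hL (i + 1)) (hstep i).1 (hstep i).2 (r1 i) (r2 i) (r4 i)
    (r1 _) (r2 _) (r3 _) (r4 _)
  refine ⟨L, R, hL, r3, r1, r2, fun i => (hstep i).1, fun i => (hws i).1, fun i => (hws i).2.1,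
    fun i => (hws i).2.2.1, hpL, ?_, r4⟩
  intro i
  have e1 := r1 i
  have e2 := r2 i
  have e3 := r1 (i + k)
  have e4 := r2 (i + k)
  have hs : ∀ n, Sees c u (i + k) n ↔ Sees c u i n := fun n => sees_corner (S.outer.add_period i) n
  have f1 := r4 i (R i) e1 e2.le
  have f2 := r4 i (R i + 1) (by omega) (by omega)
  rw [hpL] at e3 e4
  -- The index `R (i + k)` is identified as the last visible gate: `c (i + k)` sees gate `R i + h`
  -- but not the next one.
  have f3 := r4 (i + k) (R i + h) (by rw [hpL]; omega) (by rw [hpL]; omega)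
  have f4 := r4 (i + k) (R i + 1 + h) (by rw [hpL]; omega) (by rw [hpL]; omega)
  rw [hs, S.sees_period] at f3 f4
  rw [f1] at f3
  rw [f2] at f4
  omega

end Rings


/-! ### Non-forbidden triangles with an inner hull vertex as apex, and their crossings. -/

/-- Two angular sectors at `o` in complementary position have only `o` in common. -/
theorem eq_of_mem_sectors {o p m B C x : Plane} (h1 : 0 < orient o p m) (h2 : 0 < orient o m B)
    (h3 : 0 < orient o B C) (h4 : 0 < orient o C p) (hx1 : 0 ≤ orient o p x)
    (hx2 : 0 ≤ orient o x m) (hx3 : 0 ≤ orient o B x) (hx4 : 0 ≤ orient o x C) : x = o := by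
  set X := orient o x m with hX
  set Y := orient o p x with hY
  have hBm : orient o B m = -orient o m B := orient_swap_right _ _ _
  have hpC : orient o p C = -orient o C p := orient_swap_right _ _ _
  have hpB : orient o p B = -orient o B p := orient_swap_right _ _ _
  have e1 : orient o B x * orient o p m = X * orient o B p + Y * orient o B m := by
    simp only [hX, hY, orient]; ring
  have e2 : orient o x C * orient o p m = X * orient o p C + Y * orient o m C := by
    simp only [hX, hY, orient]; ring
  have e3 := orient_pluecker o p m B C
  rw [hBm] at e1
  rw [hpC] at e2 e3
  rw [hpB] at e3
  have hXY : X = 0 ∧ Y = 0 := by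
    rcases hx2.eq_or_lt with h | h
    · refine ⟨h.symm, ?_⟩
      have : Y * orient o m B ≤ 0 := by
        have := mul_nonneg hx3 h1.le
        rw [e1, ← h] at this; linarith
      nlinarith
    · exfalso
      have a1 : Y * orient o m B ≤ X * orient o B p := by
        have := mul_nonneg hx3 h1.le
        linarith
      have a2 : X * orient o C p ≤ Y * orient o m C := by
        have := mul_nonneg hx4 h1.le
        linarith
      have hY0 : 0 < Y := by
        rcases hx1.eq_or_lt with h' | h'
        · rw [← h'] at a2; nlinarith [mul_pos h h4]
        · exact h'
      have b1 := mul_le_mul a1 a2 (mul_pos h h4).le (le_trans (mul_pos hY0 h2).le a1)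
      have b2 : X * Y * (orient o m B * orient o C p) ≤ X * Y * (orient o B p * orient o m C) := by
        linarith
      have b3 := le_of_mul_le_mul_left b2 (mul_pos h hY0)
      nlinarith [mul_pos h1 h3]
  have f0 : orient o p m * (x 0 - o 0) = X * (p 0 - o 0) + Y * (m 0 - o 0) := by
    simp only [hX, hY, orient]; ring
  have f1 : orient o p m * (x 1 - o 1) = X * (p 1 - o 1) + Y * (m 1 - o 1) := by
    simp only [hX, hY, orient]; ring
  rw [hXY.1, hXY.2] at f0 f1
  simp only [zero_mul, add_zero, mul_eq_zero, h1.ne', false_or] at f0 f1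
  ext i; fin_cases i <;> simp <;> linarith

theorem mem_openChain {P : Finset Plane} {r t x : Plane} :
    x ∈ openChain P r t ↔ x ∈ hullVertices P ∧ orient r t x < 0 := by
  classical
  rw [openChain, Finset.mem_filter]; rfl

theorem mem_deleteChain {P : Finset Plane} {r t x : Plane} :
    x ∈ deleteChain P r t ↔ x ∈ P ∧ ¬ (x ∈ hullVertices P ∧ orient r t x < 0) := by
  classical rw [deleteChain, Finset.mem_filter, mem_openChain]

theorem innerPoints_subset_deleteChain (P : Finset Plane) (r t : Plane) :
    innerPoints P ⊆ deleteChain P r t := fun x hx => by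
  rw [mem_deleteChain]
  rw [mem_innerPoints] at hx
  exact ⟨hx.1, fun h => hx.2 h.1⟩

/-- A nondegenerate triangle whose apex is not a vertex of the inner hull is not forbidden. -/
theorem not_isForbiddenTriangle_of_notMem {P : Finset Plane} {t : Triangle}
    (ht : t.apex ∉ hullVertices (innerPoints P)) : ¬ IsForbiddenTriangle P t := by
  rintro ⟨h, r, -, s, -, -, -, -, h3⟩
  exact ht (mem_hullVertices_mono (innerPoints_subset_deleteChain P r s) h.2.1 h3)

namespace Rings

variable {P : Finset Plane} {c u : ℤ → Plane} {k h : ℕ}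

theorem mem_deleteChain_edge (S : Rings P c u k h) {i : ℤ} {x : Plane}
    (hx : x ∈ deleteChain P (c (i + 1)) (c i)) :
    x ∈ innerPoints P ∨ x = c i ∨ x = c (i + 1) := by
  rw [mem_deleteChain] at hx
  by_contra hcon
  push Not at hcon
  have h1 : x ∈ hullVertices P := by
    by_contra h1
    exact hcon.1 (mem_innerPoints.2 ⟨hx.1, h1⟩)
  refine hx.2 ⟨h1, ?_⟩
  rw [orient_swap]
  linarith [(S.outer.edge i).pos hx.1 hcon.2.1 hcon.2.2]

theorem c_mem_deleteChain (S : Rings P c u k h) (i : ℤ) {r t : Plane}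
    (hc : c i ∉ openChain P r t) : c i ∈ deleteChain P r t := by
  classical
  exact Finset.mem_filter.2 ⟨S.c_mem i, hc⟩

theorem edge_pos (S : Rings P c u k h) (i : ℤ) {x : Plane} (hx : x ∈ innerPoints P) :
    0 < orient (c i) (c (i + 1)) x := by
  rw [orient_rot]; exact S.corner_pos i hx

/-- Deleting all outer vertices except `c i` and `c (i + 1)` is one of the tests for being
forbidden. Suppose `c i` does not see gate `n`. If `c (i + 1)` does not see it either, the gate is a
hull edge of what is left and the triangle is forbidden; if `c (i + 1)` sees it, then `u (n - 1)` is
inside the triangle. Gate `n + 1` is symmetric. -/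
theorem sees_of_not_forbidden (S : Rings P c u k h) {i n : ℤ}
    (ht : IsInwardTriangle P ⟨c i, c (i + 1), u n⟩)
    (hf : ¬ IsForbiddenTriangle P ⟨c i, c (i + 1), u n⟩) : Sees c u i n ∧ Sees c u (i + 1) (n + 1) := by
  have h3 := S.three_le_h
  obtain ⟨c0, c1, c2⟩ := S.cone n
  have hnc : ∀ j, u n ≠ c j := fun j => S.ne_c j (S.u_mem n)
  have hext : u n ∉ hullVertices (deleteChain P (c (i + 1)) (c i)) := by
    intro hu
    refine hf ⟨ht, c (i + 1), S.outer.mem_hull _, c i, S.outer.mem_hull _, (S.outer.ne_succ i).symm,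
      ?_, ?_, hu⟩ <;> rw [mem_openChain] <;> simp
  have hsub := innerPoints_subset_deleteChain P (c (i + 1)) (c i)
  have hedge : 0 < orient (c i) (c (i + 1)) (u n) := S.edge_pos i (S.u_mem n)
  have hempty : ∀ x ∈ innerPoints P, 0 < orient (u n) (c i) x → 0 < orient (c (i + 1)) (u n) x →
      False := by
    intro x hx e1 e2
    refine ht.2.2 x (mem_P hx) ((mem_interior_triangle_iff hedge).2 ⟨S.edge_pos i hx, e2, e1⟩)
  constructor
  · by_contra hs
    have hs' := (S.not_sees_iff i n).1 hs
    by_cases hR : 0 < orient (u (n - 1)) (u n) (c (i + 1))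
    · refine hext (isHullEdge_of_left (b := u (n - 1)) (c := u n) (z := u (n + 1))
        (hsub (S.u_mem _)) (hsub (S.u_mem _)) (hsub (S.u_mem _)) (S.u_ne (by omega) (by omega)).symm
        (S.u_ne (by omega) (by omega)).symm (S.u_ne (by omega) (by omega)) ?_).2.1
      intro x hx hx1 hx2
      rcases S.mem_deleteChain_edge hx with hx | rfl | rfl
      · rw [← orient_rot]; exact c2 x hx hx2 hx1
      · exact S.not_sees.1 hs
      · exact hR
    · have hR' := lt_of_le_of_ne (not_lt.1 hR) (S.gate_ne_zero (i + 1) n)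
      refine hempty (u (n - 1)) (S.u_mem _) hs' ?_
      have e : orient (c (i + 1)) (u n) (u (n - 1)) = -orient (u (n - 1)) (u n) (c (i + 1)) := by
        unfold orient; ring
      linarith
  · by_contra hs
    have hs' := (S.not_sees_succ_iff (i + 1) n).1 hs
    have hgate : orient (u n) (u (n + 1)) (c i) ≠ 0 := by
      simpa using S.gate_ne_zero i (n + 1)
    by_cases hR : 0 < orient (u n) (u (n + 1)) (c i)
    · refine hext (isHullEdge_of_left (b := u n) (c := u (n + 1)) (z := u (n - 1))
        (hsub (S.u_mem _)) (hsub (S.u_mem _)) (hsub (S.u_mem _)) (S.u_ne (by omega) (by omega))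
        (S.u_ne (by omega) (by omega)) (S.u_ne (by omega) (by omega)) ?_).1
      intro x hx hx1 hx2
      rcases S.mem_deleteChain_edge hx with hx | rfl | rfl
      · exact c1 x hx hx1 hx2
      · exact hR
      · exact hs'
    · have hR' := lt_of_le_of_ne (not_lt.1 hR) hgate
      refine hempty (u (n + 1)) (S.u_mem _) ?_ ?_
      · rw [orient_swap_right]; linarith
      · rw [← orient_rot]; exact hs'

section TypeOne

variable {i n : ℤ}

theorem typeOne_signs (S : Rings P c u k h) (h1 : Sees c u i n) (h2 : Sees c u (i + 1) (n + 1)) :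
    0 < orient (u n) (u (n - 1)) (c i) ∧ 0 < orient (u n) (c i) (c (i + 1)) ∧
      0 < orient (u n) (c (i + 1)) (u (n + 1)) := by
  rw [sees_iff] at h1
  rw [sees_succ_iff] at h2
  exact ⟨by rw [orient_swap_right]; linarith, S.corner_triple i n,
    by rw [orient_swap_right]; linarith⟩

theorem hull_cone (S : Rings P c u k h) (n : ℤ) {x : Plane}
    (hx : x ∈ convexHull ℝ (innerPoints P : Set Plane)) :
    0 ≤ orient (u n) (u (n + 1)) x ∧ 0 ≤ orient (u n) x (u (n - 1)) := by
  constructor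
  · exact orient_nonneg_of_mem_convexHull (fun p hp => (S.inner.edge n).nonneg hp) hx
  · rw [orient_rot]
    exact orient_nonneg_of_mem_convexHull (fun p hp => (S.u_edge n).nonneg hp) hx

/-- A non-forbidden triangle at an inner hull vertex meets the inner hull only there. -/
theorem typeOne_region (S : Rings P c u k h) (h1 : Sees c u i n) (h2 : Sees c u (i + 1) (n + 1))
    {x : Plane} (hx : x ∈ convexHull ℝ (innerPoints P : Set Plane))
    (hx' : x ∈ convexHull ℝ {c i, c (i + 1), u n}) : x = u n := by
  obtain ⟨s1, s2, s3⟩ := S.typeOne_signs h1 h2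
  obtain ⟨c0, -, -⟩ := S.cone n
  obtain ⟨e1, e2⟩ := S.hull_cone n hx
  obtain ⟨-, r2, r3⟩ := (mem_triangle_iff (S.edge_pos i (S.u_mem n))).1 hx'
  refine eq_of_mem_sectors c0 s1 s2 s3 e1 e2 r3 ?_
  rw [← orient_rot] at r2; exact r2

theorem isInwardTriangle_of_forall (S : Rings P c u k h) {a : Plane} (ha : a ∈ innerPoints P)
    (hr : ∀ x ∈ innerPoints P, x ∈ convexHull ℝ {c i, c (i + 1), a} → x = a) :
    IsInwardTriangle P ⟨c i, c (i + 1), a⟩ := by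
  refine ⟨S.outer.edge i, ha, fun x hx hx' => ?_⟩
  have hpos := S.edge_pos i ha
  have hxr : x ∈ convexHull ℝ {c i, c (i + 1), a} := interior_subset hx'
  by_cases hv : x ∈ hullVertices P
  · refine notMem_interior_of_mem_hullVertices hv (interior_mono (convexHull_mono ?_) hx')
    intro y hy
    simp only [Set.mem_insert_iff, Set.mem_singleton_iff] at hy
    rcases hy with rfl | rfl | rfl
    · exact S.c_mem _
    · exact S.c_mem _
    · exact mem_P ha
  · have := hr x (mem_innerPoints.2 ⟨hx, hv⟩) hxr
    subst this
    have := (mem_interior_triangle_iff hpos).1 hx'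
    simp at this

theorem typeOne_isInward (S : Rings P c u k h) (h1 : Sees c u i n) (h2 : Sees c u (i + 1) (n + 1)) :
    IsInwardTriangle P ⟨c i, c (i + 1), u n⟩ :=
  S.isInwardTriangle_of_forall (S.u_mem n) fun _ hx hx' =>
    S.typeOne_region h1 h2 (subset_convexHull ℝ _ hx) hx'

/-- As seen from `u n`, the points `u (n + 1)`, `u (n - 1)`, `c i`, `c (i + 1)` go all the way
around in turns of less than π. They survive every deletion that keeps the edge, so `u n` never gets
a supporting half-plane. -/
theorem typeOne_not_forbidden (S : Rings P c u k h) (h1 : Sees c u i n)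
    (h2 : Sees c u (i + 1) (n + 1)) : ¬ IsForbiddenTriangle P ⟨c i, c (i + 1), u n⟩ := by
  rintro ⟨-, r, -, s, -, -, hl, hr, ha⟩
  have h3 := S.three_le_h
  obtain ⟨s1, s2, s3⟩ := S.typeOne_signs h1 h2
  obtain ⟨c0, -, -⟩ := S.cone n
  obtain ⟨w, hw⟩ := exists_halfplane ha
  have hsub := innerPoints_subset_deleteChain P r s
  have w1 := hw _ (hsub (S.u_mem (n + 1))) (S.u_ne (by omega) (by omega)).symm
  have w2 := hw _ (hsub (S.u_mem (n - 1))) (S.u_ne (by omega) (by omega))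
  have w3 := hw _ (S.c_mem_deleteChain i hl) (S.ne_c i (S.u_mem n)).symm
  have w4 := hw _ (S.c_mem_deleteChain (i + 1) hr) (S.ne_c (i + 1) (S.u_mem n)).symm
  have t1 := orient_trans w1 w2 w3 c0 s1
  have t2 := orient_trans w1 w3 w4 t1 s2
  rw [orient_swap_right] at t2
  linarith

/-- A segment to a visible inner hull vertex is not forbidden. -/
theorem not_isForbiddenSegment (S : Rings P c u k h) (h1 : Sees c u i n) :
    ¬ IsForbiddenSegment P ⟨c i, c i, u n⟩ := by
  rintro ⟨-, -, x, hx, hx'⟩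
  have hne : u (n - 1) ≠ u n := (S.u_edge n).2.2.1
  have e1 := orient_pos_of_mem_interior hne (fun p hp => orient_nonneg_of_mem_convexHull
    (fun q hq => (S.u_edge n).nonneg hq) hp) hx'
  obtain ⟨s, t, hs, ht, hst, rfl⟩ := hx
  rw [orient_add_smul _ _ _ _ hst, orient_self_right] at e1
  have h1 : orient (u (n - 1)) (u n) (c i) < 0 := h1
  nlinarith

/-- A segment to a visible inner hull vertex meets the inner hull only there. -/
theorem segment_region (S : Rings P c u k h) (h1 : Sees c u i n)
    {x : Plane} (hx : x ∈ convexHull ℝ (innerPoints P : Set Plane))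
    (hx' : x ∈ segment ℝ (c i) (u n)) : x = u n := by
  have e1 : 0 ≤ orient (u (n - 1)) (u n) x := orient_nonneg_of_mem_convexHull
    (fun q hq => (S.u_edge n).nonneg hq) hx
  obtain ⟨s, t, hs, ht, hst, rfl⟩ := hx'
  rw [orient_add_smul _ _ _ _ hst, orient_self_right] at e1
  have h1 : orient (u (n - 1)) (u n) (c i) < 0 := h1
  have : s = 0 := by nlinarith
  subst this
  obtain rfl : t = 1 := by linarith
  simp

end TypeOne

end Rings

theorem exists_mem_openSegments {p q p' q' : Plane} (h : orient p q p' * orient p q q' < 0)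
    (h' : orient p' q' p * orient p' q' q < 0) :
    ∃ X, X ∈ openSegment ℝ p q ∧ X ∈ openSegment ℝ p' q' := by
  have wt : ∀ {a b : ℝ}, a * b < 0 → 0 < b / (b - a) ∧ 0 < -a / (b - a) ∧
      b / (b - a) + -a / (b - a) = 1 := by
    intro a b hab
    have hne : b - a ≠ 0 := by
      intro h0
      obtain rfl : b = a := by linarith
      nlinarith [mul_self_nonneg b]
    refine ⟨?_, ?_, by field_simp; ring⟩
    · have : b / (b - a) = b * (b - a) / (b - a) ^ 2 := by field_simp
      rw [this]
      exact div_pos (by nlinarith [mul_self_nonneg b]) (by positivity)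
    · have : -a / (b - a) = -a * (b - a) / (b - a) ^ 2 := by field_simp
      rw [this]
      exact div_pos (by nlinarith [mul_self_nonneg a]) (by positivity)
  obtain ⟨w1, w2, w3⟩ := wt h
  obtain ⟨v1, v2, v3⟩ := wt h'
  refine ⟨_, ⟨_, _, v1, v2, v3, rfl⟩, ⟨_, _, w1, w2, w3, ?_⟩⟩
  set D := orient p q q' - orient p q p' with hD
  have hDD : orient p' q' q - orient p' q' p = -D := by rw [hD]; unfold orient; ring
  have hne : D ≠ 0 := by intro h0; rw [h0] at w1; simp at w1
  rw [hDD]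
  ext i
  simp only [PiLp.add_apply, PiLp.smul_apply, smul_eq_mul]
  field_simp
  fin_cases i <;> simp [orient] <;> ring

/-- Triangles with properly crossing sides have a common interior point. -/
theorem exists_mem_of_cross {p q s p' q' s' X : Plane} (hs : 0 < orient p q s)
    (hs' : 0 < orient p' q' s') (hX : X ∈ openSegment ℝ p q) (hX' : X ∈ openSegment ℝ p' q')
    (hne : orient p q p' ≠ 0) (hne' : orient p' q' p ≠ 0) :
    ∃ Y, (0 < orient p q Y ∧ 0 < orient q s Y ∧ 0 < orient s p Y) ∧
      (0 < orient p' q' Y ∧ 0 < orient q' s' Y ∧ 0 < orient s' p' Y) := by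
  have aux : ∀ {p q s X : Plane}, 0 < orient p q s → X ∈ openSegment ℝ p q →
      orient p q X = 0 ∧ 0 < orient q s X ∧ 0 < orient s p X := by
    rintro p q s X hs ⟨a, b, ha, hb, hab, rfl⟩
    simp only [orient_add_smul _ _ _ _ hab, orient_self_mid, orient_self_right]
    rw [orient_rot, ← orient_rot s p q]
    refine ⟨by ring, ?_, ?_⟩ <;> nlinarith [mul_pos ha hs, mul_pos hb hs]
  have dir : ∀ {p q p' q' X : Plane}, orient p q X = 0 → X ∈ openSegment ℝ p' q' →
      orient p q p' ≠ 0 → ∃ e, 0 < orient p q e ∧ orient p' q' e = 0 := by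
    rintro p q p' q' X h0 ⟨a, b, ha, hb, hab, rfl⟩ hne
    rw [orient_add_smul _ _ _ _ hab] at h0
    rcases lt_or_gt_of_ne hne with h | h
    · refine ⟨q', ?_, by simp⟩
      by_contra hc
      nlinarith [mul_pos ha (neg_pos.2 h)]
    · exact ⟨p', h, by simp⟩
  obtain ⟨a0, a1, a2⟩ := aux hs hX
  obtain ⟨b0, b1, b2⟩ := aux hs' hX'
  -- The point `e` is on the line `p' q'` and strictly left of `p q`; `f` is on `p q` and strictly
  -- left of `p' q'`. A small step from `X` in the direction of both enters both triangles.
  obtain ⟨e, e1, e2⟩ := dir a0 hX' hne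
  obtain ⟨f, f1, f2⟩ := dir b0 hX hne'
  have key : ∀ (y z : Plane) (ε : ℝ), orient y z (X + ε • ((e - X) + (f - X))) =
      orient y z X + ε * (orient y z e + orient y z f - 2 * orient y z X) := by
    intro y z ε
    simp only [orient, PiLp.add_apply, PiLp.sub_apply, PiLp.smul_apply, smul_eq_mul]; ring
  have ev : ∀ y z : Plane, 0 < orient y z X → ∀ᶠ ε in nhdsWithin (0 : ℝ) (Set.Ioi 0),
      0 < orient y z (X + ε • ((e - X) + (f - X))) := by
    intro y z hpos
    have hc : ContinuousAt (fun ε : ℝ => orient y z (X + ε • ((e - X) + (f - X)))) 0 := by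
      simp only [key]; fun_prop
    exact nhdsWithin_le_nhds (hc.eventually (lt_mem_nhds (by simpa using hpos)))
  obtain ⟨ε, ⟨⟨⟨h1, h2⟩, h3⟩, h4⟩, hε⟩ := ((((ev _ _ a1).and (ev _ _ a2)).and (ev _ _ b1)).and
    (ev _ _ b2)).and self_mem_nhdsWithin |>.exists
  have hε : 0 < ε := hε
  refine ⟨_, ⟨?_, h1, h2⟩, ?_, h3, h4⟩
  · rw [key, a0, f2]; nlinarith [mul_pos hε e1]
  · rw [key, b0, e2]; nlinarith [mul_pos hε f1]

namespace Lifts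

variable {P : Finset Plane} {c u : ℤ → Plane} {k h : ℕ} {L R : ℤ → ℤ}

theorem monotone_L (Λ : Lifts P c u k h L R) : Monotone L := monotone_int_of_le_succ Λ.mono_L

theorem monotone_R (Λ : Lifts P c u k h L R) : Monotone R := monotone_int_of_le_succ Λ.mono_R

theorem sees (Λ : Lifts P c u k h L R) {i n : ℤ} (h1 : L i < n) (h2 : n ≤ R i) : Sees c u i n :=
  (Λ.sees_iff i n h1 (by linarith [Λ.lt_add i])).2 h2

/-- The corners that see a common gate are ordered around the vertices of that gate. -/
theorem corners_pos (Λ : Lifts P c u k h L R) (S : Rings P c u k h) {i j n : ℤ} (hij : i < j)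
    (h1 : L j < n) (h2 : n ≤ R i) : 0 < orient (u n) (c i) (c j) := by
  refine orient_chain (w := u (n - 1)) hij (fun l l1 l2 => ?_) fun l _ _ => S.corner_triple l n
  have : Sees c u l n := Λ.sees (by linarith [Λ.monotone_L l2]) (by linarith [Λ.monotone_R l1])
  unfold Sees at this
  rw [orient_swap]; linarith

/-- Visible inner hull vertices appear in order around a corner. -/
theorem visible_pos (Λ : Lifts P c u k h L R) (S : Rings P c u k h) {i m n : ℤ} (hmn : m < n)
    (h1 : L i ≤ m) (h2 : n ≤ R i) : 0 < orient (c i) (u n) (u m) := by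
  obtain ⟨w, hw⟩ := S.exists_wide i
  have := orient_chain (p := c i) (w := w) (c := fun l => u (-l)) (i := -n) (j := -m) (by omega)
    (fun l _ _ => hw _ (S.u_mem _)) (fun l l1 l2 => by
      have : Sees c u i (-l) := Λ.sees (by omega) (by omega)
      unfold Sees at this
      rw [← orient_rot] at this
      rw [show -(l + 1) = -l - 1 by ring, orient_swap_right, orient_rot]
      linarith)
  simpa using this

/-- If the apexes are in the opposite order to the corners, the sides from `u n` to `c i` and from
`u m` to `c j` cross. This is what makes the choice of apexes in a compatible set monotone. -/
theorem exists_cross (Λ : Lifts P c u k h L R) (S : Rings P c u k h) {i j m n : ℤ} (hij : i < j)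
    (h1 : L j < m) (h2 : m < n) (h3 : n ≤ R i) :
    ∃ Y, Y ∈ interior (convexHull ℝ {c i, c (i + 1), u n}) ∧
      Y ∈ interior (convexHull ℝ {c j, c (j + 1), u m}) := by
  have a1 := Λ.corners_pos S hij (by linarith) h3
  have a2 := Λ.corners_pos S hij h1 (by linarith)
  have a3 := Λ.visible_pos S h2 (by linarith [Λ.monotone_L hij.le]) h3
  have a4 := Λ.visible_pos S (i := j) h2 (by linarith) (by linarith [Λ.monotone_R hij.le])
  have b1 : orient (u n) (c i) (u m) < 0 := by rw [orient_swap]; linarith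
  have b2 : orient (u m) (c j) (c i) < 0 := by rw [orient_swap_right]; linarith
  rw [orient_rot] at a4
  obtain ⟨X, X1, X2⟩ := exists_mem_openSegments (mul_neg_of_neg_of_pos b1 a1)
    (mul_neg_of_pos_of_neg a4 b2)
  obtain ⟨Y, ⟨y1, y2, y3⟩, z1, z2, z3⟩ := exists_mem_of_cross (S.corner_triple i n)
    (S.corner_triple j m) X1 X2 b1.ne a4.ne'
  exact ⟨Y, (mem_interior_triangle_iff (S.edge_pos i (S.u_mem n))).2 ⟨y2, y3, y1⟩,
    (mem_interior_triangle_iff (S.edge_pos j (S.u_mem m))).2 ⟨z2, z3, z1⟩⟩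

end Lifts


/-! ### Distributing the inner hull vertices among corners and edges. -/

theorem forall_of_periodic {p : ℤ → Prop} {k : ℕ} (hk : 0 < k) (hp : ∀ i, p (i + k) ↔ p i) (j : ℤ)
    (h : ∀ i, j ≤ i → i < j + k → p i) (i : ℤ) : p i := by
  have hper : Function.Periodic p (k : ℤ) := fun i => propext (hp i)
  obtain ⟨y, hy, e⟩ := hper.exists_mem_Ico (by exact_mod_cast hk) i j
  rw [e]
  exact h y hy.1 hy.2

/-- `1` on the residue class of `j`, and `0` elsewhere. -/
def residueIndicator (k : ℕ) (j i : ℤ) : ℤ := if (k : ℤ) ∣ i - j then 1 else 0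

theorem residueIndicator_add (k : ℕ) (j i : ℤ) :
    residueIndicator k j (i + k) = residueIndicator k j i := by
  unfold residueIndicator
  simp only [show i + k - j = (i - j) + k by ring, dvd_add_self_right]

theorem residueIndicator_succ (k : ℕ) (j i : ℤ) :
    residueIndicator k (j + 1) (i + 1) = residueIndicator k j i := by
  unfold residueIndicator
  rw [show i + 1 - (j + 1) = i - j by ring]

theorem residueIndicator_of_lt {k : ℕ} {j i : ℤ} (h1 : i - j < k) (h2 : j - i < k) :
    residueIndicator k j i = if i = j then 1 else 0 := by
  unfold residueIndicator
  congr 1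
  refine propext ⟨fun hd => ?_, by rintro rfl; simp⟩
  have := Int.eq_zero_of_abs_lt_dvd hd (abs_lt.2 ⟨by omega, by omega⟩)
  omega

theorem sum_residueIndicator {k : ℕ} (hk : 0 < k) (j : ℤ) :
    ∑ i ∈ Finset.range k, residueIndicator k j (i : ℤ) = 1 := by
  have hk' : (0 : ℤ) < k := by exact_mod_cast hk
  have h0 := Int.emod_nonneg j hk'.ne'
  have h1 := Int.emod_lt_of_pos j hk'
  rw [Finset.sum_eq_single_of_mem (j % k).toNat (Finset.mem_range.2 (by omega))]
  · unfold residueIndicator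
    rw [if_pos]
    rw [Int.toNat_of_nonneg h0, ← dvd_neg, neg_sub]
    exact Int.dvd_self_sub_emod
  · intro i hi hne
    unfold residueIndicator
    rw [if_neg]
    intro hd
    apply hne
    have hi := Finset.mem_range.1 hi
    have e : (i : ℤ) % k = j % k := Int.emod_eq_emod_iff_emod_sub_eq_zero.2 (Int.emod_eq_zero_of_dvd hd)
    rw [Int.emod_eq_of_lt (by omega) (by omega)] at e
    omega

/-- A distribution of the inner hull vertices: `u n` for `a i < n ≤ b i` is joined to the corner
`c i`, and `u (b i + 1)` is the apex of a triangle on the edge from `c i` to `c (i + 1)` if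
`a (i + 1) = b i + 1`. -/
structure Allocation (L R : ℤ → ℤ) (k h : ℕ) (a b : ℤ → ℤ) : Prop where
  le_a : ∀ i, L i ≤ a i
  a_le_b : ∀ i, a i ≤ b i
  b_le_a : ∀ i, b i ≤ a (i + 1)
  a_le : ∀ i, a (i + 1) ≤ b i + 1
  visible : ∀ i, a i < b i → b i ≤ R i
  apex : ∀ i, a (i + 1) = b i + 1 → b i + 1 ≤ R i ∧ b i + 2 ≤ R (i + 1)
  period_a : ∀ i, a (i + k) = a i + h
  period_b : ∀ i, b (i + k) = b i + h

/-- The number of edges of the outer hull with a triangle at an inner hull vertex. -/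
def Allocation.count (k : ℕ) (a b : ℤ → ℤ) : ℤ := ∑ i ∈ Finset.range k, (a (i + 1) - b i)

namespace Allocation

variable {L R : ℤ → ℤ} {k h : ℕ} {a b : ℤ → ℤ}

/-- By telescoping over a period the count depends on the two sums only, so the effect of a local
change can be read off from them. -/
theorem count_eq (A : Allocation L R k h a b) :
    count k a b = h + ∑ i ∈ Finset.range k, a i - ∑ i ∈ Finset.range k, b i := by
  have h1 := Finset.sum_range_succ' (fun i : ℕ => a (i : ℤ)) k
  have h2 := Finset.sum_range_succ (fun i : ℕ => a (i : ℤ)) k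
  have h3 := A.period_a 0
  rw [zero_add] at h3
  unfold count
  rw [Finset.sum_sub_distrib]
  push_cast at h1 h2
  linarith

/-- Modify an allocation near the edge `j`. -/
theorem decrement (A : Allocation L R k h a b) (hk : 3 ≤ k)
    (hL : ∀ i, L (i + k) = L i + h) (hR : ∀ i, R (i + k) = R i + h) (j : ℤ) {p q r : ℤ}
    (c1 : L (j + 1) ≤ a (j + 1) - p) (c2 : a j ≤ b j - q) (c3 : a (j + 1) - p ≤ b (j + 1) - r)
    (c4 : b j - q ≤ a (j + 1) - p) (c5 : a (j + 1) - p ≤ b j - q + 1)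
    (c6 : b (j + 1) - r ≤ a (j + 2)) (c7 : a (j + 2) ≤ b (j + 1) - r + 1)
    (c8 : a j < b j - q → b j - q ≤ R j)
    (c9 : a (j + 1) - p < b (j + 1) - r → b (j + 1) - r ≤ R (j + 1))
    (c10 : a (j + 1) - p = b j - q + 1 → b j - q + 1 ≤ R j ∧ b j - q + 2 ≤ R (j + 1))
    (c11 : a (j + 2) = b (j + 1) - r + 1 →
      b (j + 1) - r + 1 ≤ R (j + 1) ∧ b (j + 1) - r + 2 ≤ R (j + 2)) :
    ∃ a' b', Allocation L R k h a' b' ∧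
      ∑ i ∈ Finset.range k, a' i = ∑ i ∈ Finset.range k, a i - p ∧
      ∑ i ∈ Finset.range k, b' i = ∑ i ∈ Finset.range k, b i - q - r := by
  -- Only `a (j + 1)`, `b j` and `b (j + 1)` change, by `p`, `q` and `r`, together with their
  -- translates by the period. Only the conditions at `j` and `j + 1` are affected.
  let a' : ℤ → ℤ := fun i => a i - p * residueIndicator k (j + 1) i
  let b' : ℤ → ℤ := fun i => b i - q * residueIndicator k j i - r * residueIndicator k (j + 1) i
  have pa : ∀ i, a' (i + k) = a' i + h := fun i => by
    simp only [a', residueIndicator_add, A.period_a]; ring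
  have pb : ∀ i, b' (i + k) = b' i + h := fun i => by
    simp only [b', residueIndicator_add, A.period_b]; ring
  have hloc : ∀ i, L i ≤ a' i ∧ a' i ≤ b' i ∧ b' i ≤ a' (i + 1) ∧ a' (i + 1) ≤ b' i + 1 ∧
      (a' i < b' i → b' i ≤ R i) ∧
      (a' (i + 1) = b' i + 1 → b' i + 1 ≤ R i ∧ b' i + 2 ≤ R (i + 1)) := by
    refine forall_of_periodic (by omega : 0 < k) (fun i => ?_) j fun i h1 h2 => ?_
    · rw [show i + k + 1 = i + 1 + k by ring, pa, pa, pb, hL, hR, hR]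
      constructor
      · rintro ⟨e1, e2, e3, e4, e5, e6⟩
        refine ⟨?_, ?_, ?_, ?_, ?_, ?_⟩ <;> omega
      · rintro ⟨e1, e2, e3, e4, e5, e6⟩
        refine ⟨?_, ?_, ?_, ?_, ?_, ?_⟩ <;> omega
    · have e1 := A.le_a i
      have e2 := A.a_le_b i
      have e3 := A.b_le_a i
      have e4 := A.a_le i
      have e5 := A.visible i
      have e6 := A.apex i
      simp only [a', b', residueIndicator_succ]
      rw [residueIndicator_of_lt (j := j) (i := i) (by omega) (by omega),
        residueIndicator_of_lt (j := j + 1) (i := i) (by omega) (by omega)]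
      by_cases i1 : i = j
      · subst i1
        have : i ≠ i + 1 := by omega
        simp only [if_pos, if_neg this, mul_zero, mul_one, sub_zero]
        exact ⟨e1, c2, c4, c5, c8, c10⟩
      · by_cases i2 : i = j + 1
        · subst i2
          rw [show j + 1 + 1 = j + 2 by ring] at *
          simp only [if_pos, if_neg i1, mul_zero, mul_one, sub_zero]
          exact ⟨c1, c3, c6, c7, c9, c11⟩
        · simp only [if_neg i1, if_neg i2, mul_zero, sub_zero]
          exact ⟨e1, e2, e3, e4, e5, e6⟩
  refine ⟨a', b', ⟨fun i => (hloc i).1, fun i => (hloc i).2.1, fun i => (hloc i).2.2.1,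
    fun i => (hloc i).2.2.2.1, fun i => (hloc i).2.2.2.2.1, fun i => (hloc i).2.2.2.2.2, pa, pb⟩,
    ?_, ?_⟩
  · simp only [a', Finset.sum_sub_distrib, ← Finset.mul_sum,
      sum_residueIndicator (show 0 < k by omega), mul_one]
  · simp only [b', Finset.sum_sub_distrib, ← Finset.mul_sum,
      sum_residueIndicator (show 0 < k by omega), mul_one]

end Allocation

/-- An allocation that cannot be lowered. -/
structure TightAllocation (L R : ℤ → ℤ) (k h : ℕ) (M : ℤ) (a b : ℤ → ℤ) : Prop
    extends Allocation L R k h a b where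
  le_count : M ≤ Allocation.count k a b
  apex_of_lt : ∀ i, a i < b i → a (i + 1) = b i + 1
  flat : ∀ i, a (i + 1) = b i → b i = a i ∧ L i = a i ∧ L (i + 1) = a i
  spare : M < Allocation.count k a b → ∀ i, a (i + 1) = b i + 1 → L (i + 1) = a (i + 1)
  exists_apex : ∃ i, a (i + 1) = b i + 1

namespace Allocation

variable {L R : ℤ → ℤ} {k h : ℕ} {a b : ℤ → ℤ}

/-- Among the allocations with count at least `M`, one with the least sum of all `a i` and `b i`
over a period is tight: each defect would allow a local change that lowers this sum. -/
theorem exists_tight {a₀ b₀ : ℤ → ℤ} (A₀ : Allocation L R k h a₀ b₀) (hk : 3 ≤ k) (hh : 0 < h)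
    (hL : ∀ i, L (i + k) = L i + h) (hR : ∀ i, R (i + k) = R i + h)
    (mL : ∀ i, L i ≤ L (i + 1)) (mR : ∀ i, R i ≤ R (i + 1)) (hLR : ∀ i, L i < R i) {M : ℤ}
    (hM₀ : M ≤ count k a₀ b₀) :
    ∃ a b, TightAllocation L R k h M a b := by
  -- Both `a` and `b` are bounded below by `L`, so subtracting twice the sum of `L` loses nothing in
  -- the passage to ℕ.
  let f : (ℤ → ℤ) × (ℤ → ℤ) → ℕ := fun p =>
    (∑ i ∈ Finset.range k, p.1 i + ∑ i ∈ Finset.range k, p.2 i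
      - 2 * ∑ i ∈ Finset.range k, L i).toNat
  obtain ⟨⟨a, b⟩, ⟨A, hM⟩, hmin⟩ := WellFounded.has_min (measure f).wf
    {p | Allocation L R k h p.1 p.2 ∧ M ≤ count k p.1 p.2} ⟨(a₀, b₀), A₀, hM₀⟩
  simp only at A hM
  have hlow : ∀ {a b}, Allocation L R k h a b →
      2 * ∑ i ∈ Finset.range k, L i ≤ ∑ i ∈ Finset.range k, a i + ∑ i ∈ Finset.range k, b i := by
    intro a b A
    have h1 : ∑ i ∈ Finset.range k, L i ≤ ∑ i ∈ Finset.range k, a i :=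
      Finset.sum_le_sum fun i _ => A.le_a i
    have h2 : ∑ i ∈ Finset.range k, a i ≤ ∑ i ∈ Finset.range k, b i :=
      Finset.sum_le_sum fun i _ => A.a_le_b i
    linarith
  have hno : ∀ {p q r : ℤ}, 0 < p + q + r → M ≤ count k a b - p + q + r → ¬ ∃ a' b',
      Allocation L R k h a' b' ∧
      ∑ i ∈ Finset.range k, a' i = ∑ i ∈ Finset.range k, a i - p ∧
      ∑ i ∈ Finset.range k, b' i = ∑ i ∈ Finset.range k, b i - q - r := by
    rintro p q r h1 h2 ⟨a', b', A', s1, s2⟩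
    refine hmin (a', b') ⟨A', ?_⟩ ?_
    · simp only
      rw [A.count_eq] at h2
      rw [A'.count_eq]
      linarith
    · have := hlow A
      have := hlow A'
      show f (a', b') < f (a, b)
      simp only [f]
      omega
  -- Otherwise the last vertex `u (b j)` of a nonempty run precedes an edge that is not served. It
  -- can become the apex of this edge if `c (j + 1)` sees far enough, and else be handed over to the
  -- corner `c (j + 1)`.
  have F1 : ∀ j, a j < b j → a (j + 1) = b j + 1 := by
    intro j hj
    by_contra hne
    have e1 := A.b_le_a j
    have e2 := A.a_le j
    have e3 := A.visible j hj
    have e4 := mR j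
    have e5 := A.le_a (j + 1)
    have e6 := A.a_le_b (j + 1)
    have e7 := A.b_le_a (j + 1)
    have e8 := A.a_le (j + 1)
    have e9 := A.visible (j + 1)
    have e10 := A.apex (j + 1)
    have e11 := hLR (j + 1)
    rw [show j + 1 + 1 = j + 2 by ring] at *
    by_cases hc : b j + 1 ≤ R (j + 1)
    · refine hno (p := 0) (q := 1) (r := 0) (by omega) (by omega)
        (A.decrement hk hL hR j ?_ ?_ ?_ ?_ ?_ ?_ ?_ ?_ ?_ ?_ ?_) <;> omega
    · refine hno (p := 1) (q := 1) (r := 0) (by omega) (by omega)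
        (A.decrement hk hL hR j ?_ ?_ ?_ ?_ ?_ ?_ ?_ ?_ ?_ ?_ ?_) <;> omega
  -- Otherwise the apex of the edge `j` can be moved to the edge `j + 1`, with the same count.
  have F2 : ∀ j, a (j + 1) = b j + 1 → a (j + 1) = b (j + 1) → a (j + 2) = b (j + 1) →
      L (j + 1) = a (j + 1) := by
    intro j h1 h2 h3
    by_contra hne
    have e1 := A.le_a (j + 1)
    have e2 := A.apex j h1
    have e3 := mR (j + 1)
    have e4 := A.a_le_b j
    have e5 := A.visible j
    rw [show j + 1 + 1 = j + 2 by ring] at *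
    refine hno (p := 1) (q := 0) (r := 1) (by omega) (by omega)
        (A.decrement hk hL hR j ?_ ?_ ?_ ?_ ?_ ?_ ?_ ?_ ?_ ?_ ?_) <;> omega
  -- Otherwise, with count to spare, the apex of the edge `j` can be given to the corner `c (j + 1)`
  -- as a degenerate triangle.
  have F3 : M < count k a b → ∀ j, a (j + 1) = b j + 1 → L (j + 1) = a (j + 1) := by
    intro hlt j h1
    by_contra hne
    have e1 := A.le_a (j + 1)
    have e2 := A.apex j h1
    have e3 := mR (j + 1)
    have e4 := A.a_le_b j
    have e5 := A.visible j
    have e6 := A.a_le_b (j + 1)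
    have e7 := A.b_le_a (j + 1)
    have e8 := A.a_le (j + 1)
    have e9 := A.visible (j + 1)
    have e10 := A.apex (j + 1)
    rw [show j + 1 + 1 = j + 2 by ring] at *
    refine hno (p := 1) (q := 0) (r := 0) (by omega) (by omega)
        (A.decrement hk hL hR j ?_ ?_ ?_ ?_ ?_ ?_ ?_ ?_ ?_ ?_ ?_) <;> omega
  have hb : ∀ j, a (j + 1) = b j → b j = a j := by
    intro j hj
    by_contra hne
    have := F1 j (lt_of_le_of_ne (A.a_le_b j) (Ne.symm hne))
    omega
  have hT : ∃ i, a (i + 1) = b i + 1 := by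
    by_contra hcon
    push Not at hcon
    have hc : ∀ i, a (i + 1) = a i := by
      intro i
      have h1 : a (i + 1) = b i := by
        have := A.b_le_a i
        have := A.a_le i
        have := hcon i
        omega
      rw [h1, hb i h1]
    have : ∀ n : ℕ, a (0 + n) = a 0 := by
      intro n
      induction n with
      | zero => simp
      | succ n ih => push_cast; rw [← add_assoc, hc, ih]
    have h1 := A.period_a 0
    rw [this k] at h1
    omega
  refine ⟨a, b, A, hM, F1, ?_, F3, hT⟩
  obtain ⟨i0, hi0⟩ := hT
  -- Induction along the edges after a served one. The first unserved edge is covered by `F2`; each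
  -- further one inherits the claim because `a` stays constant while `L` increases and `L ≤ a`.
  have key : ∀ j, i0 ≤ j → a (j + 2) = b (j + 1) → L (j + 1) = a (j + 1) := by
    intro j hj
    induction j, hj using Int.leInduction with
    | base =>
      intro h1
      exact F2 i0 hi0 (hb (i0 + 1) (by rw [← h1]; congr 1; ring)).symm h1
    | succ j hj ih =>
      intro h1
      have h1' := (hb (j + 1 + 1) (by rw [← h1]; congr 1; ring))
      by_cases hc : a (j + 1 + 1) = b (j + 1) + 1
      · exact F2 (j + 1) hc h1'.symm h1
      · have h2 : a (j + 1 + 1) = b (j + 1) := by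
          have := A.b_le_a (j + 1)
          have := A.a_le (j + 1)
          omega
        have h3 := ih (by rw [← h2]; congr 1; ring)
        have h4 := hb (j + 1) h2
        have := mL (j + 1)
        have := A.le_a (j + 1 + 1)
        omega
  have hper : ∀ j, (a (j + 1) = b j → L j = a j) := by
    refine forall_of_periodic (by omega : 0 < k) (fun i => ?_) (i0 + 1) fun j h1 _ h2 => ?_
    · rw [show i + k + 1 = i + 1 + k by ring, A.period_a, A.period_a, A.period_b, hL]
      omega
    · have := key (j - 1) (by omega)
      rw [show j - 1 + 2 = j + 1 by ring, show j - 1 + 1 = j by ring] at this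
      exact this h2
  intro j hj
  have h1 := hb j hj
  have h2 := hper j hj
  have := mL j
  have := A.le_a (j + 1)
  exact ⟨h1, h2, by omega⟩

/-- Any monotone choice of triangles extends to an allocation. -/
theorem exists_of_selection (hk : 0 < k) (hL : ∀ i, L (i + k) = L i + h)
    (mL : ∀ i, L i ≤ L (i + 1)) (hLR : ∀ i, L (i + 1) ≤ R i)
    {I : ℤ → Prop} {n : ℤ → ℤ} (hI : ∀ i, I (i + k) ↔ I i)
    (hn : ∀ i, I i → n (i + k) = n i + h)
    (hv : ∀ i, I i → L i < n i ∧ n i ≤ R i ∧ L (i + 1) < n i + 1 ∧ n i + 1 ≤ R (i + 1))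
    (hlt : ∀ i j, I i → I j → i < j → j < i + k → n i < n j) (hh : 0 < h) [DecidablePred I] :
    ∃ a b, Allocation L R k h a b ∧
      (((Finset.range k).filter fun i : ℕ => I i).card : ℤ) ≤ count k a b := by
  -- The lower bound that the edge `j` imposes on `a (j + 1)`.
  let m : ℤ → ℤ := fun j => if I j then n j else L (j + 1)
  have mI : ∀ {j}, I j → m j = n j := fun h => if_pos h
  have mN : ∀ {j}, ¬ I j → m j = L (j + 1) := fun h => if_neg h
  have pm : ∀ j, m (j + k) = m j + h := by
    intro j
    by_cases hj : I j
    · rw [mI hj, mI ((hI j).2 hj), hn j hj]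
    · rw [mN hj, mN (fun h => hj ((hI j).1 h)), show j + k + 1 = j + 1 + k by ring, hL]
  have hmL : ∀ j, L (j + 1) ≤ m j := by
    intro j
    by_cases hj : I j
    · rw [mI hj]; have := hv j hj; omega
    · rw [mN hj]
  have monoL : Monotone L := monotone_int_of_le_succ mL
  -- The function `a` will be the running maximum `H` of these bounds. One period back is enough,
  -- since earlier bounds are smaller by multiples of `h`.
  have hex : ∀ i : ℤ, ∃ H, (∀ j, i - k ≤ j → j < i → m j ≤ H) ∧
      ∃ j, i - k ≤ j ∧ j < i ∧ H = m j := by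
    intro i
    obtain ⟨j, hj, hmax⟩ := Finset.exists_max_image (Finset.Ico (i - k) i) m
      ⟨i - 1, by simp; omega⟩
    rw [Finset.mem_Ico] at hj
    exact ⟨m j, fun l h1 h2 => hmax l (Finset.mem_Ico.2 ⟨h1, h2⟩), j, hj.1, hj.2, rfl⟩
  choose H H1 H2 using hex
  have pH : ∀ i, H (i + k) = H i + h := by
    intro i
    apply le_antisymm
    · obtain ⟨j, j1, j2, e⟩ := H2 (i + k)
      rw [e]
      have := H1 i (j - k) (by omega) (by omega)
      have := pm (j - k)
      rw [sub_add_cancel] at this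
      omega
    · obtain ⟨j, j1, j2, e⟩ := H2 i
      rw [e, ← pm]
      exact H1 _ _ (by omega) (by omega)
  have hbound : ∀ i, I i → ∀ j, i - k ≤ j → j < i → m j < n i := by
    intro i hi j h1 h2
    by_cases hj : I j
    · rw [mI hj]
      rcases h1.eq_or_lt with h1 | h1
      · have := hn j hj
        rw [← h1, sub_add_cancel] at this
        rw [← h1]; omega
      · exact hlt j i hj hi h2 (by omega)
    · rw [mN hj]
      have := monoL (show j + 1 ≤ i by omega)
      have := hv i hi
      omega
  have hHI : ∀ i, I i → H i < n i ∧ H (i + 1) = n i := by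
    intro i hi
    constructor
    · obtain ⟨j, j1, j2, e⟩ := H2 i
      rw [e]; exact hbound i hi j j1 j2
    · apply le_antisymm
      · obtain ⟨j, j1, j2, e⟩ := H2 (i + 1)
        rw [e]
        rcases (show j ≤ i by omega).eq_or_lt with rfl | h'
        · rw [mI hi]
        · exact (hbound i hi j (by omega) h').le
      · rw [← mI hi]; exact H1 _ _ (by omega) (by omega)
  have hHN : ∀ i, ¬ I i → H i ≤ H (i + 1) ∧ (H i < H (i + 1) → H (i + 1) = L (i + 1)) := by
    intro i hi
    constructor
    · obtain ⟨j, j1, j2, e⟩ := H2 i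
      rw [e]
      rcases j1.eq_or_lt with h' | h'
      · have := pm j
        rw [← h', sub_add_cancel] at this
        have := H1 (i + 1) i (by omega) (by omega)
        rw [← h']; omega
      · exact H1 _ _ (by omega) (by omega)
    · intro hlt'
      obtain ⟨j, j1, j2, e⟩ := H2 (i + 1)
      rcases (show j ≤ i by omega).eq_or_lt with rfl | h'
      · rw [e, mN hi]
      · have := H1 i j (by omega) h'
        omega
  let b : ℤ → ℤ := fun i => if I i then n i - 1 else H (i + 1)
  have bI : ∀ {j}, I j → b j = n j - 1 := fun h => if_pos h
  have bN : ∀ {j}, ¬ I j → b j = H (j + 1) := fun h => if_neg h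
  refine ⟨H, b, ⟨?_, ?_, ?_, ?_, ?_, ?_, pH, ?_⟩, ?_⟩
  · intro i
    have h1 := H1 i (i - 1) (by omega) (by omega)
    have h2 := hmL (i - 1)
    rw [sub_add_cancel] at h2
    omega
  · intro i
    by_cases hi : I i
    · rw [bI hi]; have := hHI i hi; omega
    · rw [bN hi]; exact (hHN i hi).1
  · intro i
    by_cases hi : I i
    · rw [bI hi]; have := hHI i hi; omega
    · rw [bN hi]
  · intro i
    by_cases hi : I i
    · rw [bI hi]; have := hHI i hi; omega
    · rw [bN hi]; omega
  · intro i
    by_cases hi : I i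
    · rw [bI hi]; have := hv i hi; omega
    · rw [bN hi]; intro h1; rw [(hHN i hi).2 h1]; exact hLR i
  · intro i
    by_cases hi : I i
    · rw [bI hi]; have := hv i hi; omega
    · rw [bN hi]; omega
  · intro i
    by_cases hi : I i
    · rw [bI hi, bI ((hI i).2 hi), hn i hi]; ring
    · rw [bN hi, bN (fun h => hi ((hI i).1 h)), show i + k + 1 = i + 1 + k by ring, pH]
  · rw [Finset.card_filter, count]
    push_cast
    refine Finset.sum_le_sum fun i _ => ?_
    by_cases hi : I i
    · rw [if_pos hi, bI hi, (hHI i hi).2]; omega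
    · rw [if_neg hi, bN hi]; omega

end Allocation

namespace Lifts

variable {P : Finset Plane} {c u : ℤ → Plane} {k h : ℕ} {L R : ℤ → ℤ}

/-- A visible gate in the window of its corner. -/
theorem lift_of_sees (Λ : Lifts P c u k h L R) (S : Rings P c u k h) {i n : ℤ} (h1 : L i < n)
    (h2 : n ≤ L i + h) (hs : Sees c u i n) (hs' : Sees c u (i + 1) (n + 1)) :
    L i < n ∧ n ≤ R i ∧ L (i + 1) < n + 1 ∧ n + 1 ≤ R (i + 1) := by
  have e1 := (Λ.sees_iff i n h1 h2).1 hs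
  have e2 := Λ.le_add i
  have e3 := Λ.mono_R i
  have e4 := Λ.lt (i + 1)
  have e5 := Λ.lt_add (i + 1)
  have e6 := Λ.le i
  have e7 := Λ.mono_L i
  have e8 : L (i + 1) < n + 1 := by
    by_contra hc
    rw [← S.sees_period, Λ.sees_iff _ _ (by omega) (by omega)] at hs'
    omega
  rw [Λ.sees_iff _ _ e8 (by omega)] at hs'
  exact ⟨h1, e1, e8, hs'⟩

/-- Members of `T` share no edge, so a triangle is determined by the index `i` of its edge and has
one lift of its apex in the window after `L i`. If `i < j` within a period had `n j ≤ n i`, the two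
triangles would share the apex or cross by `exists_cross`. -/
theorem exists_selection (Λ : Lifts P c u k h L R) (S : Rings P c u k h) {T : Finset Triangle}
    (hT : IsCompatible P T) :
    ∃ (I : ℤ → Prop) (n : ℤ → ℤ), (∀ i, I (i + k) ↔ I i) ∧ (∀ i, I i → n (i + k) = n i + h) ∧
      (∀ i, I i → L i < n i ∧ n i ≤ R i ∧ L (i + 1) < n i + 1 ∧ n i + 1 ≤ R (i + 1)) ∧
      (∀ i j, I i → I j → i < j → j < i + k → n i < n j) ∧
      ∀ [DecidablePred I], (hullPart P T).card ≤ ((Finset.range k).filter fun i : ℕ => I i).card := by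
  classical
  let K : ℤ → ℤ → Prop := fun i n => L i < n ∧ n ≤ L i + h ∧ (⟨c i, c (i + 1), u n⟩ : Triangle) ∈ T
  have pK : ∀ i n, K (i + k) (n + h) ↔ K i n := by
    intro i n
    simp only [K]
    rw [Λ.period_L, show i + k + 1 = i + 1 + k by ring, S.outer.add_period, S.outer.add_period,
      S.inner.add_period]
    constructor <;> rintro ⟨h1, h2, h3⟩ <;> exact ⟨by omega, by omega, h3⟩
  have hedge : ∀ t ∈ T, ∀ t' ∈ T, t.left = t'.left → t.right = t'.right → t = t' := by
    intro t ht t' ht' h1 h2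
    by_contra hne
    have := (hT.2 t ht t' ht' hne).1
    refine Set.disjoint_left.1 this
      (show s(t.left, t.right) ∈ t.edges by simp [Triangle.edges]) ?_
    rw [h1, h2]; simp [Triangle.edges]
  have uK : ∀ i n n', K i n → K i n' → n = n' := by
    rintro i n n' ⟨h1, h2, h3⟩ ⟨h1', h2', h3'⟩
    have := hedge _ h3 _ h3' rfl rfl
    simp only [Triangle.mk.injEq, true_and] at this
    exact S.inner.eq_of_Ico this (by omega) (by omega)
  have hex : ∀ i, ∃ n, (∃ m, K i m) → K i n := by
    intro i
    by_cases h : ∃ m, K i m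
    · obtain ⟨m, hm⟩ := h; exact ⟨m, fun _ => hm⟩
    · exact ⟨0, fun h' => absurd h' h⟩
  choose n hn using hex
  have hv : ∀ i, (∃ m, K i m) →
      L i < n i ∧ n i ≤ R i ∧ L (i + 1) < n i + 1 ∧ n i + 1 ≤ R (i + 1) := by
    intro i hi
    obtain ⟨h1, h2, h3⟩ := hn i hi
    have := hT.1 _ h3
    have := S.sees_of_not_forbidden this.1 this.2
    exact Λ.lift_of_sees S h1 h2 this.1 this.2
  have pI : ∀ i, (∃ m, K (i + k) m) ↔ ∃ m, K i m := by
    intro i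
    constructor
    · rintro ⟨m, hm⟩
      exact ⟨m - h, (pK _ _).1 (by rwa [sub_add_cancel])⟩
    · rintro ⟨m, hm⟩
      exact ⟨m + h, (pK _ _).2 hm⟩
  refine ⟨fun i => ∃ m, K i m, n, pI, ?_, hv, ?_, ?_⟩
  · intro i hi
    exact uK _ _ _ (hn _ ((pI i).2 hi)) ((pK _ _).2 (hn i hi))
  · intro i j hi hj hij hjk
    have vi := hv i hi
    have vj := hv j hj
    have ti := (hn i hi).2.2
    have tj := (hn j hj).2.2
    have hne : (⟨c i, c (i + 1), u (n i)⟩ : Triangle) ≠ ⟨c j, c (j + 1), u (n j)⟩ := by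
      intro e
      simp only [Triangle.mk.injEq] at e
      have := S.outer.eq_of_Ico e.1 (by omega) (by omega)
      omega
    have hd := hT.2 _ ti _ tj hne
    by_contra hlt
    rcases (not_lt.1 hlt).lt_or_eq with hlt | heq
    · obtain ⟨Y, y1, y2⟩ := Λ.exists_cross S hij vj.1 hlt vi.2.1
      have z1 : Y ∈ (⟨c i, c (i + 1), u (n i)⟩ : Triangle).inside := by
        rw [Triangle.inside, if_neg (S.outer.ne_succ i)]; exact y1
      have z2 : Y ∈ (⟨c j, c (j + 1), u (n j)⟩ : Triangle).inside := by
        rw [Triangle.inside, if_neg (S.outer.ne_succ j)]; exact y2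
      exact Set.disjoint_left.1 hd.2.2 z1 z2
    · exact hd.2.1 (by simp only [heq])
  · intro _
    have hidx : ∀ t ∈ hullPart P T, ∃ i : ℕ, i < k ∧ c i = t.left ∧ c (i + 1) = t.right ∧
        ∃ m, K i m := by
      intro t ht
      rw [hullPart, Finset.mem_filter] at ht
      obtain ⟨i, i1, i2, i3, i4⟩ := S.outer.exists_edge (hT.1 t ht.1).1.1 0
      obtain ⟨m, m1, m2, m3⟩ := S.inner.exists_mem_Ico ht.2 (L i + 1)
      lift i to ℕ using i1
      refine ⟨i, by omega, i3, i4, m, by omega, by omega, ?_⟩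
      rw [i3, i4, m3]; exact ht.1
    choose! g g1 g2 g3 g4 using hidx
    refine Finset.card_le_card_of_injOn g (fun t ht => ?_) ?_
    · simp only [Finset.coe_filter, Finset.mem_range]
      exact ⟨g1 t ht, g4 t ht⟩
    · intro t ht t' ht' e
      have h1 := Finset.mem_coe.1 ht
      have h2 := Finset.mem_coe.1 ht'
      refine hedge t ?_ t' ?_ ?_ ?_
      · rw [hullPart, Finset.mem_filter] at h1; exact h1.1
      · rw [hullPart, Finset.mem_filter] at h2; exact h2.1
      · rw [← g2 t h1, ← g2 t' h2, e]
      · rw [← g3 t h1, ← g3 t' h2, e]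

end Lifts


/-! ### Deep points and the inward vertices for the edges that are not served. -/

/-- `a` is the inward vertex that precedes `y` at the corner `c`: either `y` itself, if all other
deep points are to the right of the ray from `c` through `y`, or the last deep point around `y`. -/
def RuleStep (P : Finset Plane) (c y a : Plane) : Prop :=
  (a = y ∧ ∀ x ∈ innerPoints (innerPoints P), x ≠ y → orient c y x < 0) ∨
  (a ∈ innerPoints (innerPoints P) ∧ a ≠ y ∧ 0 < orient c y a ∧
    ∀ x ∈ innerPoints (innerPoints P), x ≠ y → x ≠ a → orient y a x < 0)

/-- The deep points are to the right of the line from `z` to `a`, and the start of the inner hull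
edge `v w` is to its left. -/
structure ChainPoint (P : Finset Plane) (v w z a : Plane) : Prop where
  mem : a ∈ innerPoints (innerPoints P)
  mem_base : z ∈ innerPoints P
  ne : z ≠ a
  left : 0 < orient z a v
  base : w = z ∨ orient z a w < 0
  right : ∀ x ∈ innerPoints (innerPoints P), x ≠ a → x ≠ z → orient z a x < 0

/-- `y` is `w`, or a deep point that the corners in `K` see along a chain starting at `w`. -/
def Target (P : Finset Plane) (v w y : Plane) (K : Set Plane) : Prop :=
  y = w ∨ ∃ z, ChainPoint P v w z y ∧ ∀ l ∈ K, 0 < orient z y l ∧ 0 < orient w y l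

/-- The ray from `c` through `v` has all other inner points on its right. -/
def SeesFirst (P : Finset Plane) (c v : Plane) : Prop :=
  ∀ x ∈ innerPoints P, x ≠ v → orient c v x < 0

theorem Target.mono {P : Finset Plane} {v w y : Plane} {K K' : Set Plane} (hK : K' ⊆ K)
    (T : Target P v w y K) : Target P v w y K' := by
  rcases T with h | ⟨z, h1, h2⟩
  · exact Or.inl h
  · exact Or.inr ⟨z, h1, fun l hl => h2 l (hK hl)⟩

theorem deep_subset {P : Finset Plane} {x : Plane} (h : x ∈ innerPoints (innerPoints P)) :
    x ∈ innerPoints P := innerPoints_subset _ h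

theorem ne_of_deep {P : Finset Plane} {x y : Plane} (h : x ∈ innerPoints (innerPoints P))
    (hy : y ∈ hullVertices (innerPoints P)) : x ≠ y := by
  rintro rfl
  exact (mem_innerPoints.1 h).2 hy

theorem ne_of_inner {P : Finset Plane} {x y : Plane} (h : x ∈ innerPoints P)
    (hy : y ∈ hullVertices P) : x ≠ y := by
  rintro rfl
  exact (mem_innerPoints.1 h).2 hy

section Step

variable {P : Finset Plane} {v w y a c : Plane} {K : Set Plane}

theorem Target.mem_inner (hvw : IsHullEdge (innerPoints P) v w) (T : Target P v w y K) :
    y ∈ innerPoints P ∧ y ≠ v := by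
  rcases T with rfl | ⟨z, h, -⟩
  · exact ⟨hvw.right_mem, hvw.2.2.1.symm⟩
  · exact ⟨deep_subset h.mem, ne_of_deep h.mem hvw.1⟩

/-- The candidate is the last deep point in the angular order about `y`. The half-plane needed for
such an order comes from `w` being an inner hull vertex, or else from the line `z y` that bounds the
deep points. If the candidate is not to the left of the ray from `c` through `y`, no other deep
point is, and `y` is kept. -/
theorem exists_ruleStep (gen : OrientGeneral P) (hvw : IsHullEdge (innerPoints P) v w)
    (hcP : c ∈ hullVertices P) (hc : SeesFirst P c v) (hcK : c ∈ K) (T : Target P v w y K) :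
    ∃ a, RuleStep P c y a := by
  classical
  obtain ⟨hy, hyv⟩ := T.mem_inner hvw
  have hcmem := mem_of_mem_hullVertices hcP
  have hnz : ∀ x ∈ innerPoints P, x ≠ y → orient c y x ≠ 0 := fun x hx hxy =>
    gen _ hcmem _ (innerPoints_subset _ hy) _ (innerPoints_subset _ hx) (ne_of_inner hy hcP).symm
      hxy.symm (ne_of_inner hx hcP).symm
  have hnz' : ∀ x ∈ innerPoints P, ∀ x' ∈ innerPoints P, x ≠ y → x' ≠ y → x ≠ x' →
      orient y x x' ≠ 0 := fun x hx x' hx' h1 h2 h3 =>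
    gen _ (innerPoints_subset _ hy) _ (innerPoints_subset _ hx) _ (innerPoints_subset _ hx')
      h1.symm h3 h2.symm
  have hcv := hc y hy hyv
  rw [orient_rot] at hcv
  rcases T with rfl | ⟨z, hz, hs⟩
  · set X := innerPoints (innerPoints P) with hX
    have hXy : ∀ x ∈ X, x ≠ y := fun x hx => ne_of_deep hx hvw.2.1
    by_cases hne : X.Nonempty
    · obtain ⟨q, hq⟩ := exists_halfplane hvw.2.1
      obtain ⟨a, ha, hmax⟩ := exists_leftmost X hne
        (fun x hx => hq x (deep_subset hx) (hXy x hx))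
        (fun x hx x' hx' hxx => hnz' x (deep_subset hx) x' (deep_subset hx') (hXy x hx) (hXy x' hx')
          hxx)
      have hv : ∀ x ∈ X, 0 < orient y x v := fun x hx => by
        rw [orient_rot]; exact hvw.pos (deep_subset hx) (ne_of_deep hx hvw.1) (hXy x hx)
      rcases lt_or_gt_of_ne (hnz a (deep_subset ha) (hXy a ha)) with h | h
      · refine ⟨y, Or.inl ⟨rfl, fun x hx hxy => ?_⟩⟩
        by_cases hxa : x = a
        · rwa [hxa]
        have h1 := hmax x hx hxa
        rw [orient_swap] at h ⊢
        rw [orient_swap_right] at h1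
        have := orient_pluecker y c x a v
        by_contra hcon
        nlinarith [mul_pos (show 0 < orient y c a by linarith) (hv x hx),
          mul_pos (neg_pos.2 hcv) (show 0 < orient y x a by linarith),
          mul_nonneg (show 0 ≤ -orient y c x by linarith) (hv a ha).le]
      · exact ⟨a, Or.inr ⟨ha, hXy a ha, h, fun x hx _ hxa => hmax x hx hxa⟩⟩
    · rw [Finset.not_nonempty_iff_eq_empty] at hne
      exact ⟨y, Or.inl ⟨rfl, fun x hx => by
        rw [← hX, hne] at hx; simp at hx⟩⟩
  · have hzc := (hs c hcK).1
    have hzc' : orient c y z < 0 := by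
      have : orient c y z = -orient z y c := by unfold orient; ring
      linarith
    set X := (innerPoints (innerPoints P)).filter (fun x => x ≠ y ∧ x ≠ z) with hX
    have mX : ∀ {x}, x ∈ X ↔ x ∈ innerPoints (innerPoints P) ∧ x ≠ y ∧ x ≠ z := by simp [hX]
    by_cases hne : X.Nonempty
    · have hq : ∀ x ∈ X, 0 < orient y z x := fun x hx => by
        have := mX.1 hx
        rw [orient_swap]; linarith [hz.right x this.1 this.2.1 this.2.2]
      obtain ⟨a, ha, hmax⟩ := exists_leftmost X hne hq
        (fun x hx x' hx' hxx => hnz' x (deep_subset (mX.1 hx).1) x' (deep_subset (mX.1 hx').1)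
          (mX.1 hx).2.1 (mX.1 hx').2.1 hxx)
      obtain ⟨ha1, ha2, ha3⟩ := mX.1 ha
      rcases lt_or_gt_of_ne (hnz a (deep_subset ha1) ha2) with h | h
      · refine ⟨y, Or.inl ⟨rfl, fun x hx hxy => ?_⟩⟩
        by_cases hxz : x = z
        · rwa [hxz]
        by_cases hxa : x = a
        · rwa [hxa]
        have hxX := mX.2 ⟨hx, hxy, hxz⟩
        have h1 := hmax x hxX hxa
        have q1 := hq x hxX
        have q2 := hq a ha
        rw [orient_swap] at h ⊢
        rw [orient_swap_right] at h1
        have hcz : 0 < orient y c z := by rw [orient_rot]; exact hzc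
        have := orient_pluecker y c x a z
        rw [orient_swap_right y z a, orient_swap_right y z x] at this
        by_contra hcon
        nlinarith [mul_pos (show 0 < orient y c a by linarith) q1,
          mul_pos hcz (show 0 < orient y x a by linarith),
          mul_nonneg (show 0 ≤ -orient y c x by linarith) q2.le]
      · refine ⟨a, Or.inr ⟨ha1, ha2, h, fun x hx hxy hxa => ?_⟩⟩
        by_cases hxz : x = z
        · rw [hxz, orient_rot]; exact hz.right a ha1 ha2 ha3
        · exact hmax x (mX.2 ⟨hx, hxy, hxz⟩) hxa
    · rw [Finset.not_nonempty_iff_eq_empty] at hne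
      refine ⟨y, Or.inl ⟨rfl, fun x hx hxy => ?_⟩⟩
      by_cases hxz : x = z
      · rwa [hxz]
      · have := mX.2 ⟨hx, hxy, hxz⟩
        rw [hne] at this; simp at this

/-- The invariant of the backward construction: after a step to a new point, the deep points are
again on one side of a line, and `v` and all corners of `K` on the other. A corner `l` of `K` other
than `c` precedes `c` in the turn about each inner point, so visibility from `c` carries over to
`l`. -/
theorem RuleStep.eq_or_chainPoint (hvw : IsHullEdge (innerPoints P) v w) (hc : SeesFirst P c v)
    (hcK : c ∈ K)
    (hK : ∀ l ∈ K, l = c ∨ (SeesFirst P l v ∧ ∀ x ∈ innerPoints P, x ≠ v → 0 < orient x l c))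
    (T : Target P v w y K) (hr : RuleStep P c y a) :
    a = y ∨ (ChainPoint P v w y a ∧ ∀ l ∈ K, 0 < orient y a l ∧ 0 < orient w a l) := by
  rcases hr with ⟨rfl, -⟩ | ⟨ha, hay, hpos, hright⟩
  · exact Or.inl rfl
  obtain ⟨hy, hyv⟩ := T.mem_inner hvw
  have hav : a ≠ v := ne_of_deep ha hvw.1
  have haw : a ≠ w := ne_of_deep ha hvw.2.1
  have hcv := hc y hy hyv
  rw [orient_rot] at hcv
  have hac : 0 < orient y a c := by rw [orient_rot]; exact hpos
  have hwv : ∀ x ∈ innerPoints P, x ≠ v → x ≠ w → 0 < orient v w x := fun x hx h1 h2 =>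
    hvw.pos hx h1 h2
  -- `v` and `w` lie on the two sides of the new line
  have key : 0 < orient y a v ∧ (w = y ∨ orient y a w < 0) := by
    rcases T with rfl | ⟨z, hz, hs⟩
    · refine ⟨?_, Or.inl rfl⟩
      rw [orient_rot]
      exact hwv a (deep_subset ha) hav haw
    · have hzc := (hs c hcK).1
      have haz : a ≠ z := by
        rintro rfl
        have : orient a y c = -orient c y a := by unfold orient; ring
        linarith
      have h1 : orient y a z < 0 := by rw [orient_rot]; exact hz.right a ha hay haz
      have h2 : 0 < orient y v z := by rw [orient_rot]; exact hz.left
      have h3 : 0 < orient y c z := by rw [orient_rot]; exact hzc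
      have h4 : 0 < orient y a v := by
        have := orient_pluecker y a c v z
        by_contra hcon
        nlinarith [mul_pos hac h2, mul_pos (neg_pos.2 h1) (neg_pos.2 hcv),
          mul_nonneg (show 0 ≤ -orient y a v by linarith) h3.le]
      refine ⟨h4, ?_⟩
      rcases hz.base with rfl | hw
      · exact Or.inr h1
      · right
        rw [← orient_rot] at hw
        have hyw : y ≠ w := ne_of_deep hz.mem hvw.2.1
        have h5 : 0 < orient y v w := by rw [← orient_rot]; exact hwv y hy hyv hyw
        have := orient_pluecker y a v w z
        by_contra hcon
        nlinarith [mul_pos h4 (neg_pos.2 hw), mul_pos (neg_pos.2 h1) h5,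
          mul_nonneg (show 0 ≤ orient y a w by linarith) h2.le]
  have hsee : ∀ l ∈ K, 0 < orient y a l := by
    intro l hl
    rcases hK l hl with rfl | ⟨h1, h2⟩
    · exact hac
    have h3 := h1 y hy hyv
    rw [orient_rot] at h3
    have h4 := h2 y hy hyv
    have := orient_pluecker y a l c v
    by_contra hcon
    nlinarith [mul_pos hac (neg_pos.2 h3), mul_pos key.1 h4,
      mul_nonneg (show 0 ≤ -orient y a l by linarith) (neg_pos.2 hcv).le]
  refine Or.inr ⟨⟨ha, hy, hay.symm, key.1, key.2, fun x hx h1 h2 => hright x hx h2 h1⟩,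
    fun l hl => ⟨hsee l hl, ?_⟩⟩
  rcases T with rfl | ⟨z, hz, hs⟩
  · exact hsee l hl
  · have h1 := (hs l hl).2
    have h2 := hsee l hl
    have h3 : orient y a w < 0 := by
      rcases key.2 with rfl | h
      · exact absurd rfl (ne_of_deep hz.mem hvw.2.1)
      · exact h
    have := orient_sum w y a l
    have e1 : orient a w l = -orient w a l := orient_swap _ _ _
    have e2 : orient w y a = orient y a w := (orient_rot _ _ _).symm
    linarith

theorem RuleStep.target (hvw : IsHullEdge (innerPoints P) v w) (hc : SeesFirst P c v) (hcK : c ∈ K)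
    (hK : ∀ l ∈ K, l = c ∨ (SeesFirst P l v ∧ ∀ x ∈ innerPoints P, x ≠ v → 0 < orient x l c))
    (T : Target P v w y K) (hr : RuleStep P c y a) : Target P v w a K := by
  rcases hr.eq_or_chainPoint hvw hc hcK hK T with rfl | h
  · exact T
  · exact Or.inr ⟨y, h⟩

end Step

theorem orient_affine (p q a b c x : Plane) : orient a b c * orient p q x =
    orient b c x * orient p q a + orient c a x * orient p q b + orient a b x * orient p q c := by
  unfold orient; ring

theorem orient_pos_of_mem_triangle {p q a b c x : Plane} (h : 0 < orient a b c)
    (hx : x ∈ convexHull ℝ {a, b, c}) (hne : x ≠ c) (ha : 0 < orient p q a) (hb : 0 < orient p q b)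
    (hc : 0 ≤ orient p q c) : 0 < orient p q x := by
  obtain ⟨x1, x2, x3⟩ := (mem_triangle_iff h).1 hx
  have e := orient_affine p q a b c x
  by_contra hcon
  have n1 := mul_nonneg x2 ha.le
  have n2 := mul_nonneg x3 hb.le
  have n3 := mul_nonneg x1 hc
  have n4 := mul_nonneg h.le (show 0 ≤ -orient p q x by linarith)
  have z1 : orient b c x * orient p q a = 0 := by linarith
  have z2 : orient c a x * orient p q b = 0 := by linarith
  rw [mul_eq_zero, or_iff_left ha.ne'] at z1
  rw [mul_eq_zero, or_iff_left hb.ne'] at z2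
  apply hne
  have hb := orient_barycentric a b c x
  have hs := orient_sum a b c x
  rw [z1, z2] at hs hb
  simp only [zero_smul, zero_add, add_zero] at hs hb
  rw [hs] at hb
  exact smul_right_injective _ h.ne' hb

section TypeTwo

variable {P : Finset Plane} {v w z a l r : Plane}

theorem ChainPoint.hull_nonpos (H : ChainPoint P v w z a) {x : Plane}
    (hx : x ∈ convexHull ℝ (innerPoints (innerPoints P) : Set Plane)) : orient z a x ≤ 0 := by
  refine orient_nonpos_of_mem_convexHull (fun p hp => ?_) hx
  by_cases h1 : p = a
  · simp [h1]
  by_cases h2 : p = z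
  · simp [h2]
  exact (H.right p hp h1 h2).le

/-- A triangle at a deep point meets the hull of the deep points only there. -/
theorem ChainPoint.region_hull (H : ChainPoint P v w z a) (hpos : 0 < orient l r a)
    (hl : 0 < orient z a l) (hr : 0 < orient z a r) {x : Plane}
    (hx : x ∈ convexHull ℝ (innerPoints (innerPoints P) : Set Plane))
    (hx' : x ∈ convexHull ℝ {l, r, a}) : x = a := by
  by_contra hne
  have := orient_pos_of_mem_triangle hpos hx' hne hl hr (by simp)
  linarith [H.hull_nonpos hx]

/-- A point behind the gate from `v` to `w` is not an inner hull vertex. -/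
theorem notMem_of_gate (hvw : IsHullEdge (innerPoints P) v w)
    (ha : a ∈ innerPoints (innerPoints P)) {x : Plane} (hx : x ∈ innerPoints P)
    (h1 : 0 < orient w a x) (h2 : 0 < orient a v x) : x ∈ innerPoints (innerPoints P) := by
  refine mem_innerPoints.2 ⟨hx, fun hu => ?_⟩
  have hxv : x ≠ v := by rintro rfl; simp at h2
  have hxw : x ≠ w := by rintro rfl; simp at h1
  have h3 := hvw.pos hx hxv hxw
  have h4 := hvw.pos (deep_subset ha) (ne_of_deep ha hvw.1) (ne_of_deep ha hvw.2.1)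
  refine notMem_interior_of_mem_hullVertices hu (interior_mono (convexHull_mono ?_)
    ((mem_interior_triangle_iff h4).2 ⟨h3, h1, h2⟩))
  intro y hy
  simp only [Set.mem_insert_iff, Set.mem_singleton_iff] at hy
  rcases hy with rfl | rfl | rfl
  · exact hvw.left_mem
  · exact hvw.right_mem
  · exact deep_subset ha

/-- Apart from `a`, the triangle lies left of the lines `w a` and `a v`. An inner point in it would
thus be behind the gate from `v` to `w` and hence deep, but the deep points are on the other side of
`z a`. -/
theorem ChainPoint.region_inner (H : ChainPoint P v w z a) (hvw : IsHullEdge (innerPoints P) v w)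
    (hpos : 0 < orient l r a) (hl : 0 < orient z a l) (hr : 0 < orient z a r)
    (hl' : 0 < orient w a l) (hr' : 0 < orient w a r) (hlv : SeesFirst P l v)
    (hrv : SeesFirst P r v) {x : Plane} (hx : x ∈ innerPoints P)
    (hx' : x ∈ convexHull ℝ {l, r, a}) : x = a := by
  by_contra hne
  have hav := ne_of_deep H.mem hvw.1
  have e : ∀ y, orient a v y = -orient y v a := fun y => by unfold orient; ring
  have h1 := orient_pos_of_mem_triangle hpos hx' hne hl' hr' (by simp)
  have h2 := orient_pos_of_mem_triangle (p := a) (q := v) hpos hx' hne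
    (by rw [e]; linarith [hlv a (deep_subset H.mem) hav])
    (by rw [e]; linarith [hrv a (deep_subset H.mem) hav]) (by simp)
  exact hne (H.region_hull hpos hl hr
    (subset_convexHull ℝ _ (notMem_of_gate hvw H.mem hx h1 h2)) hx')

end TypeTwo

open scoped Classical in
/-- A chosen solution of `RuleStep`. -/
noncomputable def rule (P : Finset Plane) (c y : Plane) : Plane :=
  if h : ∃ a, RuleStep P c y a then h.choose else y

theorem rule_spec {P : Finset Plane} {c y : Plane} (h : ∃ a, RuleStep P c y a) :
    RuleStep P c y (rule P c y) := by
  rw [rule, dif_pos h]; exact h.choose_spec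

/-- The corners up to `c i` with the same left tangent as `c i`. -/
def runCorners (c : ℤ → Plane) (L : ℤ → ℤ) (i : ℤ) : Set Plane :=
  {l | ∃ j, j ≤ i ∧ L j = L i ∧ l = c j}

/-- The inward vertices `Y i` following `u (a i)` at `c i`, and their predecessors `g i`. -/
structure Beams (P : Finset Plane) (c u : ℤ → Plane) (k : ℕ) (L a b : ℤ → ℤ) (Y g : ℤ → Plane) :
    Prop where
  target : ∀ i, L i = a i → Target P (u (a i)) (u (a i + 1)) (Y i) (runCorners c L i)
  step : ∀ i, L i = a i → RuleStep P (c i) (Y i) (g i)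
  target_step : ∀ i, L i = a i → Target P (u (a i)) (u (a i + 1)) (g i) (runCorners c L i)
  of_apex : ∀ i, a (i + 1) = b i + 1 → Y i = u (a i + 1)
  of_flat : ∀ i, a (i + 1) = b i → Y i = g (i + 1)
  period_Y : ∀ i, Y (i + k) = Y i
  period_g : ∀ i, g (i + k) = g i

/-- Iterated beams: `n` steps before the next edge with a triangle at an inner hull vertex. -/
noncomputable def beam (P : Finset Plane) (c u : ℤ → Plane) (a : ℤ → ℤ) : ℕ → ℤ → Plane
  | 0, i => u (a i + 1)
  | n + 1, i => rule P (c (i + 1)) (beam P c u a n (i + 1))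

theorem Lifts.seesFirst {P : Finset Plane} {c u : ℤ → Plane} {k h : ℕ} {L R : ℤ → ℤ}
    (Λ : Lifts P c u k h L R) {i n : ℤ} (hi : L i = n) : SeesFirst P (c i) (u n) := by
  subst hi; exact Λ.tangentL i

theorem Lifts.run_pos {P : Finset Plane} {c u : ℤ → Plane} {k h : ℕ} {L R : ℤ → ℤ}
    (Λ : Lifts P c u k h L R) (S : Rings P c u k h) {i j : ℤ} (hij : i < j) (hL : L i = L j)
    {x : Plane} (hx : x ∈ innerPoints P) (hxv : x ≠ u (L j)) : 0 < orient x (c i) (c j) := by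
  refine orient_chain (w := u (L j)) hij (fun l l1 l2 => ?_) fun l _ _ => S.corner_pos l hx
  have h1 : L l = L j := le_antisymm (Λ.monotone_L l2) (hL ▸ Λ.monotone_L l1)
  have := Λ.seesFirst h1 x hx hxv
  have e : orient x (u (L j)) (c l) = -orient (c l) (u (L j)) x := by unfold orient; ring
  linarith

/-- A served edge starts with the next inner hull vertex, and `rule` is iterated backwards over the
unserved edges before it. Tightness guarantees that all corners involved see the same vertex `u (a
i)` first. -/
theorem exists_beams {P : Finset Plane} {c u : ℤ → Plane} {k h : ℕ} {L R a b : ℤ → ℤ} {M : ℤ}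
    (S : Rings P c u k h) (Λ : Lifts P c u k h L R) (A : TightAllocation L R k h M a b) :
    ∃ Y g, Beams P c u k L a b Y g := by
  classical
  have hk := S.outer.pos
  obtain ⟨i0, hi0⟩ := A.exists_apex
  have hper : ∀ q : ℕ, a (i0 + k * q + 1) = b (i0 + k * q) + 1 := by
    intro q
    induction q with
    | zero => simpa using hi0
    | succ q ih =>
      have e1 := A.period_a (i0 + k * q + 1)
      have e2 := A.period_b (i0 + k * q)
      push_cast
      rw [show i0 + (k : ℤ) * (q + 1) + 1 = i0 + k * q + 1 + k by ring,
        show i0 + (k : ℤ) * (q + 1) = i0 + k * q + k by ring]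
      omega
  have hex : ∀ i, ∃ n : ℕ, a (i + n + 1) = b (i + n) + 1 := by
    intro i
    have hq : i ≤ i0 + k * ((i - i0).toNat : ℕ) := by
      have h1 : i - i0 ≤ ((i - i0).toNat : ℤ) := Int.self_le_toNat _
      have : (1 : ℤ) * ((i - i0).toNat : ℤ) ≤ k * ((i - i0).toNat : ℤ) :=
        mul_le_mul_of_nonneg_right (by omega) (by positivity)
      linarith
    refine ⟨(i0 + k * ((i - i0).toNat : ℕ) - i).toNat, ?_⟩
    rw [Int.toNat_of_nonneg (by omega), show i + (i0 + k * ((i - i0).toNat : ℕ) - i)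
      = i0 + k * ((i - i0).toNat : ℕ) by ring]
    exact hper _
  -- The number of unserved edges from `i` up to the next served one.
  let N : ℤ → ℕ := fun i => Nat.find (hex i)
  have N0 : ∀ i, a (i + 1) = b i + 1 → N i = 0 := fun i hi =>
    (Nat.find_eq_zero _).2 (by simpa using hi)
  have N1 : ∀ i, a (i + 1) = b i → N i = N (i + 1) + 1 := by
    intro i hi
    have h0 : ¬ a (i + (0 : ℕ) + 1) = b (i + (0 : ℕ)) + 1 := by simp; omega
    have h1 : ∃ n : ℕ, a (i + (n + 1 : ℕ) + 1) = b (i + (n + 1 : ℕ)) + 1 := by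
      obtain ⟨n, hn⟩ := hex (i + 1)
      refine ⟨n, ?_⟩
      push_cast
      rw [show i + ((n : ℤ) + 1) = i + 1 + n by ring]; exact hn
    show Nat.find (hex i) = _
    rw [Nat.find_comp_succ (hex i) h1 h0]
    congr 1
    refine Nat.find_congr' fun {n} => ?_
    push_cast
    rw [show i + ((n : ℤ) + 1) = i + 1 + n by ring]
  have NP : ∀ i, N (i + k) = N i := by
    intro i
    refine Nat.find_congr' fun {n} => ?_
    rw [show i + (k : ℤ) + n + 1 = i + n + 1 + k by ring, show i + (k : ℤ) + n = i + n + k by ring,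
      A.period_a, A.period_b]
    omega
  have BP : ∀ n i, beam P c u a n (i + k) = beam P c u a n i := by
    intro n
    induction n with
    | zero =>
      intro i
      simp only [beam]
      rw [A.period_a, show a i + h + 1 = a i + 1 + h by ring, S.inner.add_period]
    | succ n ih =>
      intro i
      simp only [beam]
      rw [show i + (k : ℤ) + 1 = i + 1 + k by ring, ih, S.outer.add_period]
  let Y : ℤ → Plane := fun i => beam P c u a (N i) i
  let g : ℤ → Plane := fun i => rule P (c i) (Y i)
  have Y0 : ∀ i, a (i + 1) = b i + 1 → Y i = u (a i + 1) := fun i hi => by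
    simp only [Y, N0 i hi, beam]
  have Y1 : ∀ i, a (i + 1) = b i → Y i = g (i + 1) := fun i hi => by
    simp only [Y, g, N1 i hi, beam]
  have hself : ∀ i, c i ∈ runCorners c L i := fun i => ⟨i, le_rfl, rfl, rfl⟩
  have hstep : ∀ i, L i = a i → Target P (u (a i)) (u (a i + 1)) (Y i) (runCorners c L i) →
      RuleStep P (c i) (Y i) (g i) ∧
        Target P (u (a i)) (u (a i + 1)) (g i) (runCorners c L i) := by
    intro i hi T
    have hr := rule_spec (exists_ruleStep S.gen (S.inner.edge (a i)) (S.outer.mem_hull i)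
      (Λ.seesFirst hi) (hself i) T)
    refine ⟨hr, hr.target (S.inner.edge (a i)) (Λ.seesFirst hi) (hself i) ?_ T⟩
    rintro l ⟨j, j1, j2, rfl⟩
    rcases j1.lt_or_eq with j1 | rfl
    · exact Or.inr ⟨Λ.seesFirst (j2.trans hi), fun x hx hxv => Λ.run_pos S j1 j2 hx (by rwa [hi])⟩
    · exact Or.inl rfl
  have htarget : ∀ n i, N i = n → L i = a i →
      Target P (u (a i)) (u (a i + 1)) (Y i) (runCorners c L i) := by
    intro n
    induction n with
    | zero =>
      intro i hn hi
      left
      simp only [Y, hn, beam]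
    | succ n ih =>
      intro i hn hi
      have hflat : a (i + 1) = b i := by
        have h1 := A.b_le_a i
        have h2 := A.a_le i
        by_contra hne
        have := N0 i (by omega)
        omega
      obtain ⟨f1, f2, f3⟩ := A.flat i hflat
      have f4 : a (i + 1) = a i := by omega
      have f5 := N1 i hflat
      have := (hstep (i + 1) (by omega) (ih (i + 1) (by omega) (by omega))).2
      rw [f4, ← Y1 i hflat] at this
      -- The corners `c i` and `c (i + 1)` have the same left tangent, so the run ending at `c i` is
      -- part of the run ending at `c (i + 1)`. For this reason targets are stated for whole runs.
      refine this.mono ?_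
      rintro l ⟨j, j1, j2, rfl⟩
      exact ⟨j, by omega, by omega, rfl⟩
  refine ⟨Y, g, fun i hi => htarget _ i rfl hi, fun i hi => (hstep i hi (htarget _ i rfl hi)).1,
    fun i hi => (hstep i hi (htarget _ i rfl hi)).2, Y0, Y1, ?_, ?_⟩
  · intro i; simp only [Y, NP, BP]
  · intro i; simp only [g, Y, NP, BP, S.outer.add_period]


/-! ### Layouts: the inward vertices around each corner, and the number of triangles. -/

/-- Consecutive inward vertices `x`, `y` around the corner `c i`. -/
inductive Link (P : Finset Plane) (c u : ℤ → Plane) (i : ℤ) : Plane → Plane → Prop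
  | gate (n : ℤ) (h : Sees c u i (n + 1)) : Link P c u i (u n) (u (n + 1))
  | entry (v w y : Plane) (hvw : IsHullEdge (innerPoints P) v w) (hv : SeesFirst P (c i) v)
    (hy : y ∈ innerPoints (innerPoints P)) (T : Target P v w y {c i}) : Link P c u i v y
  | step (v w x y : Plane) (hvw : IsHullEdge (innerPoints P) v w) (hv : SeesFirst P (c i) v)
    (T : Target P v w y {c i}) (hr : RuleStep P (c i) y x) : Link P c u i x y

/-- `a` is an admissible inward vertex for the edge from `c i` to `c (i + 1)`. -/
inductive EdgeApex (P : Finset Plane) (c u : ℤ → Plane) (i : ℤ) : Plane → Prop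
  | hull (n : ℤ) (h : Sees c u i n) (h' : Sees c u (i + 1) (n + 1)) : EdgeApex P c u i (u n)
  | deep (v w z a : Plane) (hvw : IsHullEdge (innerPoints P) v w) (H : ChainPoint P v w z a)
    (hl : 0 < orient z a (c i)) (hr : 0 < orient z a (c (i + 1)))
    (hl' : 0 < orient w a (c i)) (hr' : 0 < orient w a (c (i + 1)))
    (hlv : SeesFirst P (c i) v) (hrv : SeesFirst P (c (i + 1)) v) : EdgeApex P c u i a

/-- `f i` is the inward vertex on the edge from `c i` to `c (i + 1)`, and `mid i` lists the inward
vertices of the degenerate triangles at `c i`. -/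
structure Layout (P : Finset Plane) (c u : ℤ → Plane) (k : ℕ) (f : ℤ → Plane)
    (mid : ℤ → List Plane) : Prop where
  period_f : ∀ i, f (i + k) = f i
  period_mid : ∀ i, mid (i + k) = mid i
  edgeApex : ∀ i, EdgeApex P c u i (f i)
  corner : ∀ i, ∀ x ∈ mid i, (∃ n, x = u n ∧ Sees c u i n) ∨ x ∈ innerPoints (innerPoints P)
  sorted : ∀ i, (mid i).Pairwise fun x y => orient (c i) x y < 0
  chain : ∀ i, (f (i - 1) :: (mid i ++ [f i])).IsChain (Link P c u i)
  covers : ∀ n, (∃ i, f i = u n) ∨ ∃ i, u n ∈ mid i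

/-- The list `u n, …, u (n + m - 1)`. -/
def consecutive (u : ℤ → Plane) : ℕ → ℤ → List Plane
  | 0, _ => []
  | m + 1, n => u n :: consecutive u m (n + 1)

theorem mem_consecutive {u : ℤ → Plane} {x : Plane} {m : ℕ} : ∀ {n : ℤ},
    x ∈ consecutive u m n ↔ ∃ j, n ≤ j ∧ j < n + m ∧ x = u j := by
  induction m with
  | zero => intro n; simp [consecutive]; intro j h1 h2; omega
  | succ m ih =>
    intro n
    simp only [consecutive, List.mem_cons, ih]
    constructor
    · rintro (rfl | ⟨j, h1, h2, rfl⟩)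
      · exact ⟨n, le_rfl, by omega, rfl⟩
      · exact ⟨j, by omega, by omega, rfl⟩
    · rintro ⟨j, h1, h2, rfl⟩
      rcases h1.lt_or_eq with h | rfl
      · exact Or.inr ⟨j, by omega, by push_cast at h2; omega, rfl⟩
      · exact Or.inl rfl

theorem length_consecutive (u : ℤ → Plane) (m : ℕ) : ∀ n, (consecutive u m n).length = m := by
  induction m with
  | zero => intro n; rfl
  | succ m ih => intro n; simp [consecutive, ih]

theorem consecutive_succ (u : ℤ → Plane) (m : ℕ) : ∀ n,
    consecutive u (m + 1) n = consecutive u m n ++ [u (n + m)] := by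
  induction m with
  | zero => intro n; simp [consecutive]
  | succ m ih =>
    intro n
    rw [consecutive, ih, consecutive]
    simp only [List.cons_append, Nat.cast_add, Nat.cast_one]
    rw [show n + 1 + (m : ℤ) = n + (m + 1) by ring]

theorem isChain_consecutive {u : ℤ → Plane} {Q : Plane → Plane → Prop} {m : ℕ} : ∀ {n : ℤ},
    (∀ j, n ≤ j → j + 1 < n + m → Q (u j) (u (j + 1))) → (consecutive u m n).IsChain Q := by
  induction m with
  | zero => intro n _; exact List.isChain_nil
  | succ m ih =>
    intro n hQ
    have h1 : (consecutive u m (n + 1)).IsChain Q :=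
      ih fun j j1 j2 => hQ j (by omega) (by push_cast; omega)
    cases m with
    | zero => exact List.isChain_singleton _
    | succ m => exact List.isChain_cons_cons.2 ⟨hQ n le_rfl (by push_cast; omega), h1⟩

theorem pairwise_consecutive {u : ℤ → Plane} {Q : Plane → Plane → Prop} {m : ℕ} : ∀ {n : ℤ},
    (∀ j l, n ≤ j → j < l → l < n + m → Q (u j) (u l)) → (consecutive u m n).Pairwise Q := by
  induction m with
  | zero => intro n _; exact List.Pairwise.nil
  | succ m ih =>
    intro n hQ
    refine List.Pairwise.cons ?_ (ih fun j l j1 j2 j3 => hQ j l (by omega) j2 (by push_cast; omega))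
    intro x hx
    obtain ⟨j, j1, j2, rfl⟩ := mem_consecutive.1 hx
    exact hQ n j le_rfl (by omega) (by push_cast; omega)

theorem card_hull_add_card_inner (Q : Finset Plane) :
    (hullVertices Q).card + (innerPoints Q).card = Q.card := by
  classical
  have : innerPoints Q = Q \ hullVertices Q := by
    ext x; rw [mem_innerPoints, Finset.mem_sdiff]
  rw [this, Finset.card_sdiff_of_subset fun x hx => mem_of_mem_hullVertices hx]
  have := Finset.card_le_card (show hullVertices Q ⊆ Q from fun x hx => mem_of_mem_hullVertices hx)
  omega

section Build

variable {P : Finset Plane} {c u : ℤ → Plane} {k h : ℕ} {L R a b : ℤ → ℤ} {M : ℤ} {Y g : ℤ → Plane}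

/-- An unserved edge keeps the count below `k`; with `M = k - d` this shows that deep points exist.
-/
theorem TightAllocation.count_lt (A : TightAllocation L R k h M a b) (hk : 0 < k) {i : ℤ}
    (hi : a (i + 1) = b i) : Allocation.count k a b < k := by
  by_contra hcon
  have hall : ∀ j ∈ Finset.range k, a ((j : ℤ) + 1) - b j = 1 := by
    have hle : ∀ j ∈ Finset.range k, a ((j : ℤ) + 1) - b j ≤ 1 := fun j _ => by
      have := A.a_le j; omega
    refine (Finset.sum_eq_sum_iff_of_le hle).1 (le_antisymm (Finset.sum_le_sum hle) ?_)
    simpa [Allocation.count] using hcon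
  have := forall_of_periodic (p := fun i => a (i + 1) = b i + 1) hk (fun i => by
    rw [show i + k + 1 = i + 1 + k by ring, A.period_a, A.period_b]; omega) 0 (fun j j1 j2 => by
      lift j to ℕ using j1
      have := hall j (Finset.mem_range.2 (by omega))
      omega) i
  omega

theorem link_of_target (Λ : Lifts P c u k h L R) (S : Rings P c u k h) {i : ℤ} {y : Plane}
    (T : Target P (u (L i)) (u (L i + 1)) y (runCorners c L i)) : Link P c u i (u (L i)) y := by
  rcases T with rfl | ⟨z, H, hs⟩
  · exact Link.gate (L i) (Λ.sees (by omega) (by have := Λ.lt i; omega))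
  · exact Link.entry _ _ _ (S.inner.edge _) (Λ.seesFirst rfl) H.mem
      (Or.inr ⟨z, H, fun l hl => hs l (by rw [hl]; exact ⟨i, le_rfl, rfl, rfl⟩)⟩)

theorem exists_layout (S : Rings P c u k h) (Λ : Lifts P c u k h L R)
    (A : TightAllocation L R k h (k - (innerPoints (innerPoints P)).card) a b)
    (B : Beams P c u k L a b Y g) :
    ∃ (f : ℤ → Plane) (mid : ℤ → List Plane) (T : Multiset Triangle), Layout P c u k f mid ∧
      (∀ t, t ∈ T ↔ (∃ i, t = ⟨c i, c (i + 1), f i⟩) ∨ ∃ i, ∃ x ∈ mid i, t = ⟨c i, c i, x⟩) ∧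
      Multiset.card T = (innerPoints P).card ∧
      ∀ t T', t.left ≠ t.right → T = t ::ₘ T' → t ∉ T' := by
  classical
  have hk := S.outer.pos
  obtain ⟨i0, hi0⟩ := A.exists_apex
  set M : ℤ := k - (innerPoints (innerPoints P)).card with hM
  have hTB : ∀ i, a (i + 1) = b i + 1 ∨ a (i + 1) = b i := fun i => by
    have := A.b_le_a i
    have := A.a_le i
    omega
  let f : ℤ → Plane := fun i => if a (i + 1) = b i + 1 then u (b i + 1) else Y i
  have fT : ∀ {i}, a (i + 1) = b i + 1 → f i = u (b i + 1) := fun h => if_pos h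
  have fB : ∀ {i}, a (i + 1) = b i → f i = Y i := fun h => if_neg (by omega)
  let D : ℤ → List Plane := fun i => consecutive u (b i - a i).toNat (a i + 1)
  have mD : ∀ {i x}, x ∈ D i ↔ ∃ j, a i < j ∧ j ≤ b i ∧ x = u j := by
    intro i x
    have := A.a_le_b i
    rw [mem_consecutive]
    constructor <;> rintro ⟨j, h1, h2, rfl⟩ <;> exact ⟨j, by omega, by omega, rfl⟩
  -- The spare copies, if there are any, all go to the corner after one fixed served edge; `spare`
  -- says that this corner has its left tangent at `u (a i)`, as the rule requires.
  let φ : ℤ → Prop := fun i => M < Allocation.count k a b ∧ (k : ℤ) ∣ i - (i0 + 1)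
  -- The vertex `g i` is inserted unless it is already the head of the list `D i`.
  let ψ : ℤ → Prop := fun i => φ i ∧ ¬ (g i = u (a i + 1) ∧ a i < b i)
  let mid : ℤ → List Plane := fun i => if ψ i then g i :: D i else D i
  have midP : ∀ {i}, ψ i → mid i = g i :: D i := fun h => if_pos h
  have midN : ∀ {i}, ¬ ψ i → mid i = D i := fun h => if_neg h
  have hDmid : ∀ {i x}, x ∈ D i → x ∈ mid i := by
    intro i x hx
    by_cases h : ψ i
    · rw [midP h]; exact List.mem_cons_of_mem _ hx
    · rwa [midN h]
  have hmid : ∀ {i x}, x ∈ mid i → x ∈ D i ∨ (x = g i ∧ ψ i) := by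
    intro i x hx
    by_cases h : ψ i
    · rw [midP h, List.mem_cons] at hx; tauto
    · rw [midN h] at hx; exact Or.inl hx
  have hDu : ∀ n i, a i < n → n ≤ b i → Sees c u i n := fun n i h1 h2 =>
    Λ.sees (by have := A.le_a i; omega) (by have := A.visible i (by omega); omega)
  have hφ : ∀ {i}, φ i → a i = b (i - 1) + 1 ∧ L i = a i := by
    rintro i ⟨h1, q, hq⟩
    have hT : a (i - 1 + 1) = b (i - 1) + 1 := by
      have hper : Function.Periodic (fun i => a (i + 1) = b i + 1) (k : ℤ) := fun i => by
        refine propext ?_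
        show a (i + k + 1) = b (i + k) + 1 ↔ a (i + 1) = b i + 1
        rw [show i + k + 1 = i + 1 + k by ring, A.period_a, A.period_b]; omega
      have := hper.int_mul q i0
      simp only [eq_iff_iff, Int.cast_id] at this
      rw [show i - 1 = i0 + q * k by linarith]
      exact this.2 hi0
    have := A.spare h1 (i - 1) hT
    rw [sub_add_cancel] at this hT
    exact ⟨hT, this⟩
  have pf : ∀ i, f (i + k) = f i := by
    intro i
    rcases hTB i with h1 | h1
    · rw [fT h1, fT (by rw [show i + k + 1 = i + 1 + k by ring, A.period_a, A.period_b]; omega),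
        A.period_b, show b i + h + 1 = b i + 1 + h by ring, S.inner.add_period]
    · rw [fB h1, fB (by rw [show i + k + 1 = i + 1 + k by ring, A.period_a, A.period_b]; omega),
        B.period_Y]
  have pc : ∀ m n, consecutive u m (n + h) = consecutive u m n := by
    intro m
    induction m with
    | zero => intro n; rfl
    | succ m ih =>
      intro n
      simp only [consecutive]
      rw [S.inner.add_period, show n + h + 1 = n + 1 + h by ring, ih]
  have pD : ∀ i, D (i + k) = D i := by
    intro i
    simp only [D]
    rw [A.period_a, A.period_b, show a i + h + 1 = a i + 1 + h by ring, pc]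
    congr 2; ring
  have pψ : ∀ i, ψ (i + k) ↔ ψ i := by
    intro i
    simp only [ψ, φ]
    rw [B.period_g, A.period_a, A.period_b, show a i + h + 1 = a i + 1 + h by ring,
      S.inner.add_period, show i + k - (i0 + 1) = i - (i0 + 1) + k by ring, dvd_add_self_right,
      add_lt_add_iff_right]
  have pmid : ∀ i, mid (i + k) = mid i := by
    intro i
    by_cases h : ψ i
    · rw [midP h, midP ((pψ i).2 h), pD, B.period_g]
    · rw [midN h, midN (fun h' => h ((pψ i).1 h')), pD]
  -- the list after the first edge at a corner
  have hhead : ∀ i, ∃ l, D i ++ [f i] = Y i :: l ∧ (Y i :: l).IsChain (Link P c u i) := by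
    intro i
    rcases hTB i with h1 | h1
    · have e0 := A.a_le_b i
      have e : D i ++ [f i] = consecutive u ((b i - a i).toNat + 1) (a i + 1) := by
        rw [consecutive_succ, fT h1]
        congr 3; omega
      refine ⟨consecutive u (b i - a i).toNat (a i + 1 + 1), ?_, ?_⟩
      · rw [e, B.of_apex i h1]; rfl
      · rw [B.of_apex i h1]
        refine isChain_consecutive (m := (b i - a i).toNat + 1) fun j j1 j2 => Link.gate j ?_
        refine Λ.sees ?_ ?_
        · have := A.le_a i; omega
        · have := A.apex i h1; push_cast at j2; omega
    · have h2 := A.flat i h1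
      refine ⟨[], ?_, List.isChain_singleton _⟩
      have : D i = [] := by
        simp only [D]; rw [h2.1, sub_self]; rfl
      rw [this, fB h1]; rfl
  have hstepL : ∀ {i}, L i = a i → Link P c u i (g i) (Y i) := by
    intro i hi
    refine Link.step (u (a i)) (u (a i + 1)) _ _ (S.inner.edge _) (Λ.seesFirst hi) ?_ (B.step i hi)
    refine (B.target i hi).mono ?_
    rintro l rfl
    exact ⟨i, le_rfl, rfl, rfl⟩
  have hentry : ∀ {i y}, L i = a i → Target P (u (a i)) (u (a i + 1)) y (runCorners c L i) →
      Link P c u i (u (a i)) y := by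
    intro i y hi T
    rw [← hi] at T ⊢
    exact link_of_target Λ S T
  have hfirst : ∀ i, Link P c u i (f (i - 1)) (Y i) := by
    intro i
    rcases hTB (i - 1) with h1 | h1
    · rw [fT h1, ← h1, sub_add_cancel]
      rcases hTB i with h2 | h2
      · rw [B.of_apex i h2]
        refine Link.gate (a i) (Λ.sees ?_ ?_)
        · have := A.le_a i; omega
        · have := A.apex i h2; have := A.a_le_b i; omega
      · have h3 := (A.flat i h2).2.1
        exact hentry h3 (B.target i h3)
    · rw [fB h1, B.of_flat _ h1, sub_add_cancel]
      have h2 := A.flat (i - 1) h1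
      rw [sub_add_cancel] at h1 h2
      exact hstepL (by omega)
  have hchain : ∀ i, (f (i - 1) :: (mid i ++ [f i])).IsChain (Link P c u i) := by
    intro i
    obtain ⟨l, e1, e2⟩ := hhead i
    by_cases h : ψ i
    · rw [midP h, List.cons_append, e1]
      obtain ⟨h1, h2⟩ := hφ h.1
      refine List.isChain_cons_cons.2 ⟨?_, List.isChain_cons_cons.2 ⟨hstepL h2, e2⟩⟩
      rw [fT (by rw [sub_add_cancel]; exact h1), ← h1]
      exact hentry h2 (B.target_step i h2)
    · rw [midN h, e1]
      exact List.isChain_cons_cons.2 ⟨hfirst i, e2⟩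
  have hsorted : ∀ i, (mid i).Pairwise fun x y => orient (c i) x y < 0 := by
    intro i
    have hD : (D i).Pairwise fun x y => orient (c i) x y < 0 := by
      refine pairwise_consecutive fun j l h1 h2 h3 => ?_
      have e1 := A.le_a i
      have e2 := A.visible i (by omega)
      have e3 := A.a_le_b i
      rw [orient_swap_right]
      linarith [Λ.visible_pos S (i := i) h2 (by omega) (by omega)]
    by_cases h : ψ i
    · rw [midP h]
      refine List.Pairwise.cons (fun x hx => ?_) hD
      obtain ⟨j, j1, j2, rfl⟩ := mD.1 hx
      have h1 := A.apex_of_lt i (by omega)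
      obtain ⟨-, h2⟩ := hφ h.1
      have h3 := B.step i h2
      rw [B.of_apex i h1] at h3
      rcases h3 with ⟨h3, -⟩ | ⟨h3, h4, h5, -⟩
      · exact absurd ⟨h3, by omega⟩ h.2
      · rcases (show a i + 1 ≤ j by omega).eq_or_lt with e | e
        · rw [← e, orient_swap_right]; linarith
        · have h6 := Λ.visible_pos S (i := i) e (by omega) (by have := A.visible i (by omega); omega)
          obtain ⟨w, hw⟩ := S.exists_wide i
          have := orient_trans (hw _ (S.u_mem j)) (hw _ (S.u_mem (a i + 1))) (hw _ (deep_subset h3))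
            h6 h5
          rw [orient_swap_right]; linarith
    · rwa [midN h]
  have hcorner : ∀ i, ∀ x ∈ mid i, (∃ n, x = u n ∧ Sees c u i n) ∨
      x ∈ innerPoints (innerPoints P) := by
    intro i x hx
    rcases hmid hx with hx | ⟨rfl, h⟩
    · obtain ⟨j, j1, j2, rfl⟩ := mD.1 hx
      exact Or.inl ⟨j, rfl, hDu j i j1 j2⟩
    · have h2 := (hφ h.1).2
      rcases B.target_step i h2 with h3 | ⟨z, h3, -⟩
      · refine Or.inl ⟨_, h3, ?_⟩
        rw [← h2]
        exact Λ.sees (by omega) (by have := Λ.lt i; omega)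
      · exact Or.inr h3.mem
  have hedge : ∀ i, EdgeApex P c u i (f i) := by
    intro i
    rcases hTB i with h1 | h1
    · rw [fT h1]
      have e1 := A.apex i h1
      have e2 := A.le_a i
      have e3 := A.a_le_b i
      have e4 := A.le_a (i + 1)
      exact EdgeApex.hull _ (Λ.sees (by omega) (by omega)) (Λ.sees (by omega) (by omega))
    · obtain ⟨e1, e2, e3⟩ := A.flat i h1
      have e4 : L (i + 1) = a (i + 1) := by omega
      have e5 : a (i + 1) = a i := by omega
      rw [fB h1, B.of_flat i h1]
      rcases B.target_step (i + 1) e4 with h2 | ⟨z, H, hs⟩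
      · rw [h2]
        have l1 := Λ.lt i
        have l2 := Λ.lt (i + 1)
        refine EdgeApex.hull _ (Λ.sees (by omega) (by omega)) ?_
        -- Otherwise `u (a (i + 1) + 1)` is the right tangent, with all deep points to its left,
        -- while keeping this vertex in the rule requires all of them to its right. A deep point
        -- exists because the edge is not served.
        by_contra hns
        have htan : TangentR P c u (i + 1) (a (i + 1) + 1) :=
          (S.tangentR_iff _ _).2 ⟨Λ.sees (by omega) (by omega), hns⟩
        have hcard : 0 < (innerPoints (innerPoints P)).card := by
          have := A.count_lt hk h1
          have := A.le_count
          omega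
        obtain ⟨x, hx⟩ := Finset.card_pos.1 hcard
        have hxu : x ≠ u (a (i + 1) + 1) := ne_of_deep hx (S.inner.mem_hull _)
        have h3 := htan x (deep_subset hx) hxu
        rcases B.step (i + 1) e4 with ⟨h4, h5⟩ | ⟨h4, -⟩
        · rw [← h4, h2] at h5
          linarith [h5 x hx hxu]
        · rw [h2] at h4
          exact ne_of_deep h4 (S.inner.mem_hull _) rfl
      · have s1 := hs (c i) ⟨i, by omega, by omega, rfl⟩
        have s2 := hs (c (i + 1)) ⟨i + 1, le_rfl, rfl, rfl⟩
        exact EdgeApex.deep _ _ z _ (S.inner.edge _) H s1.1 s2.1 s1.2 s2.2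
          (Λ.seesFirst (by omega)) (Λ.seesFirst e4)
  have hcovers : ∀ n, (∃ i, f i = u n) ∨ ∃ i, u n ∈ mid i := by
    intro n
    have hex : ∀ n', a 0 < n' → n' ≤ a 0 + h → (∃ i, f i = u n') ∨ ∃ i, u n' ∈ mid i := by
      intro n' h1 h2
      obtain ⟨i, i1, i2, i3, i4⟩ := exists_switch (p := fun i => a i < n') (i := 0) (j := k)
        (by omega) h1 (by have := A.period_a 0; rw [zero_add] at this; omega)
      have h3 := i3 i i1 le_rfl
      have h4 := A.a_le i
      by_cases h5 : n' ≤ b i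
      · exact Or.inr ⟨i, hDmid (mD.2 ⟨n', h3, h5, rfl⟩)⟩
      · refine Or.inl ⟨i, ?_⟩
        rw [fT (by omega)]; congr 1; omega
    obtain ⟨n', h1, h2, h3⟩ := S.inner.exists_mem_Ico (S.inner.mem_hull n) (a 0 + 1)
    rw [← h3]
    exact hex n' (by omega) (by omega)
  let T0 : Multiset Triangle := (Multiset.range k).map fun i : ℕ => ⟨c i, c (i + 1), f i⟩
  let T1 : Multiset Triangle := ∑ i ∈ Finset.range k,
    ((D i).map fun x => (⟨c i, c i, x⟩ : Triangle) : List Triangle)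
  -- The total is `k` edge triangles, `h - count` degenerate ones and `count - (k - d)` copies,
  -- which makes `h + d`.
  let T2 : Multiset Triangle := Multiset.replicate (Allocation.count k a b - M).toNat
    ⟨c (i0 + 1), c (i0 + 1), g (i0 + 1)⟩
  have hT1 : ∀ {t}, t ∈ T1 ↔ ∃ i : ℕ, i < k ∧ ∃ x ∈ D i, t = ⟨c i, c i, x⟩ := by
    intro t
    simp only [T1, Multiset.mem_sum, Finset.mem_range, Multiset.mem_coe, List.mem_map]
    constructor <;> rintro ⟨i, hi, x, hx, rfl⟩ <;> exact ⟨i, hi, x, hx, rfl⟩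
  have hT2 : ∀ {t}, t ∈ T2 ↔ M < Allocation.count k a b ∧
      t = ⟨c (i0 + 1), c (i0 + 1), g (i0 + 1)⟩ := by
    intro t
    simp only [T2, Multiset.mem_replicate]
    have : (Allocation.count k a b - M).toNat ≠ 0 ↔ M < Allocation.count k a b := by omega
    rw [this]
  have hφ0 : M < Allocation.count k a b → φ (i0 + 1) := fun h => ⟨h, by simp⟩
  refine ⟨f, mid, T0 + T1 + T2, ⟨pf, pmid, hedge, hcorner, hsorted, hchain, hcovers⟩, ?_, ?_, ?_⟩
  · intro t
    rw [Multiset.mem_add, Multiset.mem_add, hT1, hT2]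
    constructor
    · rintro ((h1 | ⟨i, hi, x, hx, rfl⟩) | ⟨h1, rfl⟩)
      · simp only [T0, Multiset.mem_map, Multiset.mem_range] at h1
        obtain ⟨i, hi, rfl⟩ := h1
        exact Or.inl ⟨i, rfl⟩
      · exact Or.inr ⟨i, x, hDmid hx, rfl⟩
      · refine Or.inr ⟨i0 + 1, g (i0 + 1), ?_, rfl⟩
        by_cases h2 : ψ (i0 + 1)
        · rw [midP h2]; exact List.mem_cons_self
        · refine hDmid ?_
          have h3 : g (i0 + 1) = u (a (i0 + 1) + 1) ∧ a (i0 + 1) < b (i0 + 1) := by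
            by_contra h3; exact h2 ⟨hφ0 h1, h3⟩
          exact mD.2 ⟨_, by omega, by omega, h3.1⟩
    · rintro (⟨i, rfl⟩ | ⟨i, x, hx, rfl⟩)
      · left; left
        refine forall_of_periodic (p := fun i => (⟨c i, c (i + 1), f i⟩ : Triangle) ∈ T0) hk
          (fun i => ?_) 0 (fun i h1 h2 => ?_) i
        · rw [show i + k + 1 = i + 1 + k by ring, S.outer.add_period, S.outer.add_period, pf]
        · lift i to ℕ using h1
          exact Multiset.mem_map.2 ⟨i, Multiset.mem_range.2 (by omega), rfl⟩
      · rcases hmid hx with hx | ⟨rfl, h⟩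
        · left; right
          refine forall_of_periodic (p := fun i => ∀ x ∈ D i, ∃ j : ℕ, j < k ∧ ∃ y ∈ D j,
            (⟨c i, c i, x⟩ : Triangle) = ⟨c j, c j, y⟩) hk (fun i => ?_) 0 (fun i h1 h2 => ?_) i x hx
          · rw [pD, S.outer.add_period]
          · lift i to ℕ using h1
            exact fun x hx => ⟨i, by omega, x, hx, rfl⟩
        · right
          refine ⟨h.1.1, ?_⟩
          obtain ⟨q, hq⟩ := h.1.2
          have hgp : Function.Periodic g (k : ℤ) := B.period_g
          have hg : g i = g (i0 + 1) := by
            have := hgp.int_mul q (i0 + 1)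
            rwa [Int.cast_id, show i0 + 1 + q * k = i by linarith] at this
          rw [hg, (S.outer.eq_iff i (i0 + 1)).2 h.1.2]
  · have e1 : Multiset.card T1 = ∑ i ∈ Finset.range k, (b i - a i).toNat := by
      simp [T1, D, Multiset.card_sum, length_consecutive]
    have e2 : ((∑ i ∈ Finset.range k, (b i - a i).toNat : ℕ) : ℤ) =
        ∑ i ∈ Finset.range k, b i - ∑ i ∈ Finset.range k, a i := by
      rw [← Finset.sum_sub_distrib]
      push_cast
      refine Finset.sum_congr rfl fun i _ => ?_
      have := A.a_le_b i
      omega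
    have e3 := A.le_count
    have e4 := A.toAllocation.count_eq
    have e5 := card_hull_add_card_inner (innerPoints P)
    rw [S.inner.card_eq] at e5
    rw [Multiset.card_add, Multiset.card_add, e1]
    simp only [T0, T2, Multiset.card_map, Multiset.card_range, Multiset.card_replicate]
    generalize ∑ i ∈ Finset.range k, (b i - a i).toNat = s at e2 ⊢
    omega
  · intro t T' ht e hmem
    have hn0 : T0.Nodup := by
      refine Multiset.Nodup.map_on (fun i hi j hj hij => ?_) (Multiset.nodup_range k)
      rw [Multiset.mem_range] at hi hj
      have := S.outer.eq_of_Ico (congrArg Triangle.left hij) (by omega) (by omega)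
      omega
    have c1 : T1.count t = 0 := by
      rw [Multiset.count_eq_zero, hT1]
      rintro ⟨i, -, x, -, rfl⟩
      exact ht rfl
    have c2 : T2.count t = 0 := by
      rw [Multiset.count_eq_zero, hT2]
      rintro ⟨-, rfl⟩
      exact ht rfl
    have c3 := Multiset.nodup_iff_count_le_one.1 hn0 t
    have c4 : (T0 + T1 + T2).count t = T'.count t + 1 := by rw [e, Multiset.count_cons_self]
    have c5 := Multiset.count_pos.2 hmem
    rw [Multiset.count_add, Multiset.count_add] at c4
    omega

end Build


/-! ### Winding numbers, and disjointness of the cells of a layout. -/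

theorem exists_orient_pos {a b : Plane} (h : a ≠ b) : ∃ x, 0 < orient a b x := by
  refine ⟨!₂[a 0 - (b 1 - a 1), a 1 + (b 0 - a 0)], ?_⟩
  simp only [orient, Matrix.cons_val_zero, Matrix.cons_val_one]
  by_contra hcon
  have h0 : b 0 - a 0 = 0 := by nlinarith [sq_nonneg (b 0 - a 0), sq_nonneg (b 1 - a 1)]
  have h1 : b 1 - a 1 = 0 := by nlinarith [sq_nonneg (b 0 - a 0), sq_nonneg (b 1 - a 1)]
  apply h
  ext i; fin_cases i <;> simp <;> linarith

/-- The signed crossing of an edge, with end heights `s` and `t`, and with a ray at height zero whose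
origin lies on side `A` of the edge. -/
noncomputable def crossing (s t A : ℝ) : ℤ :=
  if s < 0 ∧ 0 ≤ t ∧ 0 < A then 1 else if t < 0 ∧ 0 ≤ s ∧ A < 0 then -1 else 0

theorem crossing_swap (s t A : ℝ) : crossing t s (-A) = -crossing s t A := by
  unfold crossing
  simp only [neg_pos, Left.neg_neg_iff]
  by_cases h1 : s < 0 ∧ 0 ≤ t ∧ 0 < A
  · have h2 : ¬ (t < 0 ∧ 0 ≤ s ∧ A < 0) := fun h => by linarith [h1.1, h.2.1]
    rw [if_neg h2, if_pos h1, if_pos h1]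
  · by_cases h2 : t < 0 ∧ 0 ≤ s ∧ A < 0
    · rw [if_pos h2, if_neg h1, if_pos h2, neg_neg]
    · simp [h1, h2]

theorem crossing_self (s A : ℝ) : crossing s s A = 0 := by
  unfold crossing
  rw [if_neg (fun h => by linarith [h.1, h.2.1]), if_neg (fun h => by linarith [h.1, h.2.1])]

theorem crossing_of_up {s t A : ℝ} (hs : s < 0) (ht : 0 ≤ t) :
    crossing s t A = if 0 < A then 1 else 0 := by
  unfold crossing
  simp [hs, ht, not_lt.2 ht]

theorem crossing_of_down {s t A : ℝ} (hs : 0 ≤ s) (ht : t < 0) :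
    crossing s t A = if A < 0 then -1 else 0 := by
  unfold crossing
  simp [hs, ht, not_lt.2 hs]

theorem crossing_of_nonneg {s t A : ℝ} (hs : 0 ≤ s) (ht : 0 ≤ t) : crossing s t A = 0 := by
  unfold crossing
  simp [not_lt.2 hs, not_lt.2 ht]

theorem crossing_of_neg {s t A : ℝ} (hs : s < 0) (ht : t < 0) : crossing s t A = 0 := by
  unfold crossing
  simp [not_le.2 hs, not_le.2 ht]

/-- The winding number of a positively oriented triangle is nonnegative. -/
theorem crossing_sum_nonneg {A B C p q r : ℝ} (hs : 0 < A + B + C)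
    (rel : A * r + B * p + C * q = 0) :
    0 ≤ crossing p q A + crossing q r B + crossing r p C := by
  have ite1 : ∀ {x y : ℝ}, (x < 0 → 0 < y) →
      (0 : ℤ) ≤ (if x < 0 then -1 else 0) + (if 0 < y then 1 else 0) := by
    intro x y h
    by_cases hx : x < 0
    · simp [hx, h hx]
    · simp only [hx, if_false, zero_add]; split_ifs <;> norm_num
  -- two consecutive heights of one sign
  have two : ∀ {A B C p q r : ℝ}, 0 < A + B + C → A * r + B * p + C * q = 0 → 0 ≤ p → q < 0 →
      0 ≤ crossing p q A + crossing q r B + crossing r p C := by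
    intro A B C p q r hs rel hp hq
    rw [crossing_of_down hp hq]
    rcases lt_or_ge r 0 with hr | hr
    · rw [crossing_of_neg hq hr, crossing_of_up hr hp, add_zero]
      refine ite1 fun hA => ?_
      by_contra hC
      have h1 := mul_pos_of_neg_of_neg hA hr
      have h2 := mul_nonneg_of_nonpos_of_nonpos (not_lt.1 hC) hq.le
      have h3 : B * p < 0 := by linarith
      have h4 : B < 0 := by
        by_contra h; nlinarith [mul_nonneg (not_lt.1 h) hp]
      linarith [not_lt.1 hC]
    · rw [crossing_of_up hq hr, crossing_of_nonneg hr hp, add_zero]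
      refine ite1 fun hA => ?_
      by_contra hB
      have h1 := mul_nonpos_of_nonpos_of_nonneg hA.le hr
      have h2 := mul_nonpos_of_nonpos_of_nonneg (not_lt.1 hB) hp
      have h3 : 0 ≤ C * q := by linarith
      have h4 : C ≤ 0 := by
        by_contra h; nlinarith [mul_neg_of_pos_of_neg (not_le.1 h) hq]
      linarith [not_lt.1 hB]
  rcases lt_or_ge p 0 with hp | hp
  · rcases lt_or_ge q 0 with hq | hq
    · rcases lt_or_ge r 0 with hr | hr
      · rw [crossing_of_neg hp hq, crossing_of_neg hq hr, crossing_of_neg hr hp]; norm_num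
      · have := two (A := C) (B := A) (C := B) (p := r) (q := p) (r := q) (by linarith)
          (by linarith) hr hp
        linarith
    · rcases lt_or_ge r 0 with hr | hr
      · have := two (A := B) (B := C) (C := A) (p := q) (q := r) (r := p) (by linarith)
          (by linarith) hq hr
        linarith
      · have := two (A := C) (B := A) (C := B) (p := r) (q := p) (r := q) (by linarith)
          (by linarith) hr hp
        linarith
  · rcases lt_or_ge q 0 with hq | hq
    · exact two hs rel hp hq
    · rcases lt_or_ge r 0 with hr | hr
      · have := two (A := B) (B := C) (C := A) (p := q) (q := r) (r := p) (by linarith)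
          (by linarith) hq hr
        linarith
      · rw [crossing_of_nonneg hp hq, crossing_of_nonneg hq hr, crossing_of_nonneg hr hp]; norm_num

theorem crossing_nonneg_of_pos {s t A : ℝ} (hA : 0 < A) : 0 ≤ crossing s t A := by
  unfold crossing
  rw [if_neg (c := t < 0 ∧ 0 ≤ s ∧ A < 0) (fun h => by linarith [h.2.2])]
  split_ifs <;> norm_num

/-- The winding number about an interior point is positive. -/
theorem crossing_sum_pos {A B C p q r : ℝ} (hA : 0 < A) (hB : 0 < B) (hC : 0 < C)
    (rel : A * r + B * p + C * q = 0) (hne : ¬ (p = 0 ∧ q = 0 ∧ r = 0)) :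
    1 ≤ crossing p q A + crossing q r B + crossing r p C := by
  have n1 := crossing_nonneg_of_pos (s := p) (t := q) hA
  have n2 := crossing_nonneg_of_pos (s := q) (t := r) hB
  have n3 := crossing_nonneg_of_pos (s := r) (t := p) hC
  rcases lt_or_ge p 0 with hp | hp
  · rcases lt_or_ge q 0 with hq | hq
    · rcases lt_or_ge r 0 with hr | hr
      · have := mul_neg_of_pos_of_neg hA hr
        have := mul_neg_of_pos_of_neg hB hp
        have := mul_neg_of_pos_of_neg hC hq
        linarith
      · have : crossing q r B = 1 := by rw [crossing_of_up hq hr, if_pos hB]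
        linarith
    · have : crossing p q A = 1 := by rw [crossing_of_up hp hq, if_pos hA]
      linarith
  · rcases lt_or_ge r 0 with hr | hr
    · have : crossing r p C = 1 := by rw [crossing_of_up hr hp, if_pos hC]
      linarith
    · rcases lt_or_ge q 0 with hq | hq
      · have : crossing q r B = 1 := by rw [crossing_of_up hq hr, if_pos hB]
        linarith
      · exfalso
        have h1 := mul_nonneg hA.le hr
        have h2 := mul_nonneg hB.le hp
        have h3 := mul_nonneg hC.le hq
        refine hne ⟨?_, ?_, ?_⟩
        · exact (mul_eq_zero.1 (by linarith : B * p = 0)).resolve_left hB.ne'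
        · exact (mul_eq_zero.1 (by linarith : C * q = 0)).resolve_left hC.ne'
        · exact (mul_eq_zero.1 (by linarith : A * r = 0)).resolve_left hA.ne'

/-- The signed crossing of the segment `p q` with the ray from `y` away from `o`. -/
noncomputable def rayCrossing (o y p q : Plane) : ℤ :=
  crossing (orient o y p) (orient o y q) (orient p q y)

theorem rayCrossing_swap (o y p q : Plane) : rayCrossing o y q p = -rayCrossing o y p q := by
  unfold rayCrossing
  rw [orient_swap p q y, crossing_swap]

/-- The open positively oriented triangle. -/
def openTriangle (a b c : Plane) : Set Plane :=
  {x | 0 < orient a b x ∧ 0 < orient b c x ∧ 0 < orient c a x}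

theorem isOpen_openTriangle (a b c : Plane) : IsOpen (openTriangle a b c) :=
  (isOpen_lt continuous_const (continuous_orient _ _)).inter
    ((isOpen_lt continuous_const (continuous_orient _ _)).inter
      (isOpen_lt continuous_const (continuous_orient _ _)))

theorem orient_pos_of_mem_openTriangle {a b c x : Plane} (h : x ∈ openTriangle a b c) :
    0 < orient a b c := by
  have := orient_sum a b c x
  linarith [h.1, h.2.1, h.2.2]

theorem openTriangle_eq {a b c : Plane} (h : 0 < orient a b c) :
    openTriangle a b c = interior (convexHull ℝ {a, b, c}) := by
  ext x; rw [mem_interior_triangle_iff h]; rfl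

theorem mem_convexHull_of_openTriangle {a b c x : Plane} (h : x ∈ openTriangle a b c) :
    x ∈ convexHull ℝ {a, b, c} := by
  have := orient_pos_of_mem_openTriangle h
  rw [openTriangle_eq this] at h
  exact interior_subset h

theorem rayCrossing_sum_nonneg {o y p q r : Plane} (h : 0 < orient p q r) :
    0 ≤ rayCrossing o y p q + rayCrossing o y q r + rayCrossing o y r p := by
  refine crossing_sum_nonneg ?_ ?_
  · rw [orient_sum]; exact h
  · unfold orient; ring

theorem rayCrossing_sum_pos {o y p q r : Plane} (hoy : o ≠ y) (h : y ∈ openTriangle p q r) :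
    1 ≤ rayCrossing o y p q + rayCrossing o y q r + rayCrossing o y r p := by
  refine crossing_sum_pos h.1 h.2.1 h.2.2 (by unfold orient; ring) ?_
  rintro ⟨h1, h2, h3⟩
  obtain ⟨x, hx⟩ := exists_orient_pos hoy
  have := orient_affine o y p q r x
  rw [h1, h2, h3] at this
  have h0 := orient_pos_of_mem_openTriangle h
  nlinarith [mul_pos h0 hx]

/-- A line has no interior, so finitely many can be avoided within an open set. Overlapping open
cells therefore have a common point from which the points of `P` have pairwise non-collinear
directions. -/
theorem exists_generic {O : Set Plane} (hO : IsOpen O) (hne : O.Nonempty) (P : Finset Plane) :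
    ∃ y ∈ O, ∀ p ∈ P, ∀ q ∈ P, p ≠ q → orient p q y ≠ 0 := by
  classical
  have key : ∀ F : Finset (Plane × Plane), (∀ e ∈ F, e.1 ≠ e.2) → ∃ O' ⊆ O, IsOpen O' ∧ O'.Nonempty ∧
      ∀ y ∈ O', ∀ e ∈ F, orient e.1 e.2 y ≠ 0 := by
    intro F
    induction F using Finset.induction_on with
    | empty => intro _; exact ⟨O, subset_rfl, hO, hne, by simp⟩
    | insert e F he ih =>
      intro hF
      obtain ⟨O', h1, h2, ⟨x, hx⟩, h4⟩ := ih fun e he => hF e (Finset.mem_insert_of_mem he)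
      have hee := hF e (Finset.mem_insert_self _ _)
      refine ⟨O' ∩ {y | orient e.1 e.2 y ≠ 0}, Set.inter_subset_left.trans h1,
        h2.inter ((continuous_orient _ _).isOpen_preimage _ isOpen_ne), ?_, ?_⟩
      · by_contra hemp
        have hz : ∀ y ∈ O', orient e.1 e.2 y = 0 := by
          intro y hy
          by_contra h
          exact hemp ⟨y, hy, h⟩
        have := orient_pos_of_mem_interior hee (fun p hp => (hz p hp).ge)
          (by rwa [h2.interior_eq] : x ∈ interior O')
        rw [hz x hx] at this
        exact lt_irrefl _ this
      · intro y hy e' he'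
        rcases Finset.mem_insert.1 he' with rfl | he'
        · exact hy.2
        · exact h4 y hy.1 e' he'
  obtain ⟨O', h1, -, ⟨y, hy⟩, h4⟩ := key ((P ×ˢ P).filter fun e => e.1 ≠ e.2)
    fun e he => (Finset.mem_filter.1 he).2
  exact ⟨y, h1 hy, fun p hp q hq hpq =>
    h4 y hy (p, q) (Finset.mem_filter.2 ⟨Finset.mem_product.2 ⟨hp, hq⟩, hpq⟩)⟩

theorem le_head_of_isChain {F : Plane → ℤ} : ∀ {l : List Plane} {x : Plane},
    (x :: l).IsChain (fun p q => F q ≤ F p) → ∀ y ∈ x :: l, F y ≤ F x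
  | [], x, _, y, hy => by rw [List.mem_singleton.1 hy]
  | z :: l, x, h, y, hy => by
    obtain ⟨h1, h2⟩ := List.isChain_cons_cons.1 h
    rcases List.mem_cons.1 hy with rfl | hy
    · exact le_rfl
    · exact (le_head_of_isChain h2 y hy).trans h1

theorem getLast_le_of_isChain {F : Plane → ℤ} {z : Plane} : ∀ {l : List Plane},
    (l ++ [z]).IsChain (fun p q => F q ≤ F p) → ∀ y ∈ l ++ [z], F z ≤ F y
  | [], _, y, hy => by
    have : y = z := by simpa using hy
    rw [this]
  | x :: l, h, y, hy => by
    have h' : (l ++ [z]).IsChain (fun p q => F q ≤ F p) := (List.isChain_cons.1 h).2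
    rcases List.mem_cons.1 hy with rfl | hy
    · exact le_head_of_isChain h z (by simp)
    · exact getLast_le_of_isChain h' y hy

theorem isChain_of_infix {α : Type*} {Q : α → α → Prop} {l : List α} (h : l.IsChain Q) {x y : α}
    (hxy : [x, y] <:+: l) : Q x y := List.isChain_pair.1 (h.infix hxy)

/-- At most one residue class carries a nonzero value. -/
theorem dvd_of_sum_le_one {Z : ℤ → ℤ} {k : ℕ} (hk : 0 < k) (hp : ∀ i, Z (i + k) = Z i)
    (h0 : ∀ i, 0 ≤ Z i) (hs : ∑ n ∈ Finset.range k, Z n ≤ 1) :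
    (∀ i, Z i ≤ 1) ∧ ∀ i j, 1 ≤ Z i → 1 ≤ Z j → (k : ℤ) ∣ i - j := by
  have hk' : (0 : ℤ) < k := by exact_mod_cast hk
  have hmod : ∀ i, ∃ n : ℕ, n < k ∧ Z n = Z i ∧ (k : ℤ) ∣ i - n := by
    intro i
    have e := Int.toNat_of_nonneg (Int.emod_nonneg i hk'.ne')
    have hlt := Int.emod_lt_of_pos i hk'
    refine ⟨(i % k).toNat, by omega, ?_, by rw [e]; exact Int.dvd_self_sub_emod⟩
    have hper : Function.Periodic Z (k : ℤ) := hp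
    have := hper.int_mul (i / k) (i % k)
    rw [e, ← this]
    congr 1
    have := Int.emod_add_mul_ediv i k
    rw [Int.cast_id]; linarith
  constructor
  · intro i
    obtain ⟨n, h1, h2, -⟩ := hmod i
    rw [← h2]
    exact (Finset.single_le_sum (f := fun n : ℕ => Z n) (fun n _ => h0 n)
      (Finset.mem_range.2 h1)).trans hs
  · intro i j hi hj
    obtain ⟨n, n1, n2, n3⟩ := hmod i
    obtain ⟨m, m1, m2, m3⟩ := hmod j
    have hnm : n = m := by
      by_contra hne
      have hsub : ({n, m} : Finset ℕ) ⊆ Finset.range k := by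
        intro x hx
        simp only [Finset.mem_insert, Finset.mem_singleton] at hx
        rcases hx with rfl | rfl <;> simpa
      have := Finset.sum_le_sum_of_subset_of_nonneg (f := fun n : ℕ => Z n) hsub
        (fun n _ _ => h0 n)
      rw [Finset.sum_pair hne] at this
      omega
    subst hnm
    have := dvd_sub n3 m3
    rwa [sub_sub_sub_cancel_right] at this

section Cells

variable {P : Finset Plane} {c u : ℤ → Plane} {k h : ℕ} {f : ℤ → Plane} {mid : ℤ → List Plane}

/-- The inward vertices around the corner `c i`. -/
def around (f : ℤ → Plane) (mid : ℤ → List Plane) (i : ℤ) : List Plane :=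
  f (i - 1) :: (mid i ++ [f i])

/-- `y` lies in an open triangle between consecutive inward vertices at `c i`. -/
def InGap (c f : ℤ → Plane) (mid : ℤ → List Plane) (i : ℤ) (y : Plane) : Prop :=
  ∃ p q, [p, q] <:+: around f mid i ∧ y ∈ openTriangle (c i) q p

theorem RuleStep.hull_nonpos {y a : Plane} (hr : ∀ x ∈ innerPoints (innerPoints P), x ≠ y → x ≠ a →
    orient y a x < 0) {x : Plane}
    (hx : x ∈ convexHull ℝ (innerPoints (innerPoints P) : Set Plane)) : orient y a x ≤ 0 := by
  refine orient_nonpos_of_mem_convexHull (fun p hp => ?_) hx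
  by_cases h1 : p = a
  · simp [h1]
  by_cases h2 : p = y
  · simp [h2]
  exact (hr p hp h2 h1).le

theorem EdgeApex.mem_inner (S : Rings P c u k h) {i : ℤ} {a : Plane} (E : EdgeApex P c u i a) :
    a ∈ innerPoints P := by
  cases E with
  | hull n => exact S.u_mem n
  | deep v w z a hvw H => exact deep_subset H.mem

theorem Link.pos {i : ℤ} {x y : Plane} (l : Link P c u i x y) :
    x = y ∨ 0 < orient (c i) y x := by
  cases l with
  | gate n hn =>
    right
    rw [Rings.sees_succ_iff, orient_rot, ← orient_rot, orient_rot] at hn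
    rw [orient_swap_right, neg_pos]
    exact hn
  | entry v w y hvw hv hy T =>
    right
    rw [orient_swap_right, neg_pos]
    exact hv y (deep_subset hy) (ne_of_deep hy hvw.1)
  | step v w x y hvw hv T hr =>
    rcases hr with ⟨rfl, -⟩ | ⟨-, -, h1, -⟩
    · exact Or.inl rfl
    · exact Or.inr h1

theorem Link.mem (S : Rings P c u k h) {i : ℤ} {x y : Plane} (l : Link P c u i x y) :
    x ∈ innerPoints P ∧ y ∈ innerPoints P := by
  cases l with
  | gate n hn => exact ⟨S.u_mem _, S.u_mem _⟩
  | entry v w y hvw hv hy T => exact ⟨hvw.left_mem, deep_subset hy⟩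
  | step v w x y hvw hv T hr =>
    have hy := (T.mem_inner hvw).1
    rcases hr with ⟨rfl, -⟩ | ⟨h1, -⟩
    · exact ⟨hy, hy⟩
    · exact ⟨deep_subset h1, hy⟩

/-- The point `y` is outside the inner hull, or at least outside the hull of the deep points. -/
def Avoids (P : Finset Plane) (y : Plane) : Prop :=
  y ∉ convexHull ℝ (innerPoints P : Set Plane) ∨ ((innerPoints (innerPoints P)).Nonempty ∧
    y ∉ convexHull ℝ (innerPoints (innerPoints P) : Set Plane))

theorem EdgeApex.avoids (S : Rings P c u k h) {i : ℤ} {a : Plane} (E : EdgeApex P c u i a) {y : Plane}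
    (hy : y ∈ openTriangle (c i) (c (i + 1)) a) : Avoids P y := by
  have hya : y ≠ a := by
    rintro rfl
    have := hy.2.1
    simp at this
  have hyt := mem_convexHull_of_openTriangle hy
  cases E with
  | hull n h1 h2 => exact Or.inl fun hc => hya (S.typeOne_region h1 h2 hc hyt)
  | deep v w z a hvw H hl hr =>
    exact Or.inr ⟨⟨a, H.mem⟩, fun hc => hya
      (H.region_hull (orient_pos_of_mem_openTriangle hy) hl hr hc hyt)⟩

theorem Link.avoids (S : Rings P c u k h) {i : ℤ} {p q : Plane} (l : Link P c u i p q) {y : Plane}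
    (hy : y ∈ openTriangle (c i) q p) : Avoids P y := by
  cases l with
  | gate n hn =>
    left
    intro hc
    have h1 := (S.hull_cone n hc).1
    have h2 := hy.2.1
    rw [orient_swap] at h2
    linarith
  | entry v w q hvw hv hq T =>
    right
    refine ⟨⟨q, hq⟩, fun hc => ?_⟩
    rcases T with rfl | ⟨z, H, hs⟩
    · exact ne_of_deep hq hvw.2.1 rfl
    · have h1 := (hs _ rfl).1
      have h2 := H.left
      have h3 := H.hull_nonpos hc
      have h4 := orient_affine z q (c i) q p y
      rw [orient_self_right] at h4
      have h5 := orient_pos_of_mem_openTriangle hy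
      nlinarith [mul_pos hy.2.1 h1, mul_pos hy.1 h2, mul_nonneg h5.le (neg_nonneg.2 h3)]
  | step v w p q hvw hv T hr =>
    right
    rcases hr with ⟨rfl, -⟩ | ⟨h1, h2, h3, h4⟩
    · have := orient_pos_of_mem_openTriangle hy
      simp at this
    · refine ⟨⟨p, h1⟩, fun hc => ?_⟩
      have := RuleStep.hull_nonpos h4 hc
      linarith [hy.2.1]

/-- The point `o` is the last one of `X` in the angular order about `y`; the line `o y` then
supports `X`. -/
theorem exists_ray (y : Plane) {X : Finset Plane} (hX : X.Nonempty)
    (hy : y ∉ convexHull ℝ (X : Set Plane))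
    (gen : ∀ p ∈ X, ∀ q ∈ X, p ≠ q → orient p q y ≠ 0) :
    ∃ o ∈ X, o ≠ y ∧ ∀ x ∈ X, 0 ≤ orient o y x := by
  obtain ⟨w, hw⟩ := exists_halfplane_of_notMem hy
  obtain ⟨o, ho, hmax⟩ := exists_leftmost X hX hw
    (fun p hp q hq hpq => by rw [← orient_rot]; exact gen p hp q hq hpq)
  refine ⟨o, ho, ?_, fun x hx => ?_⟩
  · rintro rfl
    have := hw _ ho
    simp at this
  · by_cases hxo : x = o
    · simp [hxo]
    · rw [orient_swap]; linarith [hmax x hx hxo]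

/-- Links have nonnegative crossings with a suitable ray. -/
theorem exists_ray_link (S : Rings P c u k h) {y : Plane}
    (gen : ∀ p ∈ P, ∀ q ∈ P, p ≠ q → orient p q y ≠ 0) (hy : Avoids P y) :
    ∃ o, o ≠ y ∧ ∀ i p q, Link P c u i p q → 0 ≤ rayCrossing o y p q := by
  by_cases hin : y ∈ convexHull ℝ (innerPoints P : Set Plane)
  · obtain ⟨hne, hout⟩ := hy.resolve_left (not_not.2 hin)
    obtain ⟨o, ho, hoy, hpos⟩ := exists_ray y hne hout fun p hp q hq =>
      gen p (Rings.mem_P (deep_subset hp)) q (Rings.mem_P (deep_subset hq))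
    -- A segment that ends at nonnegative height can cross the ray only upwards.
    have hup : ∀ {p q}, 0 ≤ orient o y q → 0 ≤ rayCrossing o y p q := by
      intro p q hq
      unfold rayCrossing
      rcases lt_or_ge (orient o y p) 0 with hp | hp
      · rw [crossing_of_up hp hq]; split_ifs <;> norm_num
      · rw [crossing_of_nonneg hp hq]
    refine ⟨o, hoy, fun i p q l => ?_⟩
    cases l with
    | gate n hn =>
      have h1 := (S.hull_cone n hin).1
      unfold rayCrossing crossing
      rw [if_neg (c := _ ∧ _ ∧ orient (u n) (u (n + 1)) y < 0) (fun h => by linarith [h.2.2])]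
      split_ifs <;> norm_num
    | entry v w q hvw hv hq T => exact hup (hpos q hq)
    | step v w p q hvw hv T hr =>
      rcases hr with ⟨rfl, -⟩ | ⟨h1, h2, h3, h4⟩
      · unfold rayCrossing; rw [crossing_self]
      · rcases lt_or_ge (orient o y q) 0 with hq | hq
        · have hp := hpos p h1
          unfold rayCrossing
          rw [crossing_of_down hp hq, if_neg]
          intro hneg
          have h5 : orient q p o ≤ 0 := RuleStep.hull_nonpos h4 (subset_convexHull ℝ _ ho)
          have h6 : orient q p o - orient q p y = orient o y p - orient o y q := by
            unfold orient; ring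
          rw [orient_swap] at hneg
          linarith
        · exact hup hq
  · obtain ⟨o, ho, hoy, hpos⟩ := exists_ray y ⟨_, S.u_mem 0⟩ hin fun p hp q hq =>
      gen p (Rings.mem_P hp) q (Rings.mem_P hq)
    refine ⟨o, hoy, fun i p q l => ?_⟩
    obtain ⟨hp, hq⟩ := l.mem S
    unfold rayCrossing
    rw [crossing_of_nonneg (hpos p hp) (hpos q hq)]

/-- The counting argument: the weights of the triangles and of the corners at a generic point. -/
theorem exists_weights (S : Rings P c u k h) (Y : Layout P c u k f mid) {y : Plane}
    (gen : ∀ p ∈ P, ∀ q ∈ P, p ≠ q → orient p q y ≠ 0) (hy : Avoids P y)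
    (hin : ∀ i, 0 < orient (c i) (c (i + 1)) y) :
    ∃ T W : ℤ → ℤ, (∀ i, 0 ≤ T i) ∧ (∀ i, 0 ≤ W i) ∧ (∀ i, T (i + k) = T i) ∧
      (∀ i, W (i + k) = W i) ∧ ∑ n ∈ Finset.range k, (T n + W (n + 1)) ≤ 1 ∧
      (∀ i, y ∈ openTriangle (c i) (c (i + 1)) (f i) → 1 ≤ T i) ∧
      ∀ i, InGap c f mid i y → 1 ≤ W i := by
  obtain ⟨o, hoy, hl⟩ := exists_ray_link S gen hy
  let χ := rayCrossing o y
  have hsw : ∀ p q, χ q p = -χ p q := rayCrossing_swap o y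
  -- `T i` is the winding number of the edge triangle about `y`. `W i` counts only the two outer
  -- sides of the fan at `c i`; since links cross the ray nonnegatively, leaving them out can only
  -- increase the weight, so `W i` bounds the winding number of each gap.
  let T : ℤ → ℤ := fun i => χ (c i) (c (i + 1)) + χ (c (i + 1)) (f i) + χ (f i) (c i)
  let W : ℤ → ℤ := fun i => χ (f (i - 1)) (c i) + χ (c i) (f i)
  have hgap : ∀ i p q, Link P c u i p q → χ q (c i) ≤ χ p (c i) := by
    intro i p q l
    rcases l.pos with rfl | hpos
    · exact le_rfl
    · have h1 := rayCrossing_sum_nonneg (o := o) (y := y) hpos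
      have h2 := hl i p q l
      have h3 := hsw p q
      have h4 := hsw (c i) q
      simp only [χ] at h3 h4 ⊢
      linarith
  have hchain : ∀ i, (around f mid i).IsChain (fun p q => χ q (c i) ≤ χ p (c i)) :=
    fun i => (Y.chain i).imp fun p q l => hgap i p q l
  have hhead : ∀ i, ∀ p ∈ around f mid i, χ p (c i) ≤ χ (f (i - 1)) (c i) :=
    fun i => le_head_of_isChain (F := fun p => χ p (c i)) (hchain i)
  have hlast : ∀ i, ∀ p ∈ around f mid i, χ (f i) (c i) ≤ χ p (c i) := fun i =>
    getLast_le_of_isChain (F := fun p => χ p (c i)) (l := f (i - 1) :: mid i) (hchain i)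
  have pT : ∀ i, T (i + k) = T i := fun i => by
    simp only [T]
    rw [show i + k + 1 = i + 1 + k by ring, S.outer.add_period, S.outer.add_period, Y.period_f]
  have pW : ∀ i, W (i + k) = W i := fun i => by
    simp only [W]
    rw [show i + k - 1 = i - 1 + k by ring, S.outer.add_period, Y.period_f, Y.period_f]
  refine ⟨T, W, fun i => rayCrossing_sum_nonneg (S.edge_pos i ((Y.edgeApex i).mem_inner S)),
    fun i => ?_, pT, pW, ?_, fun i hi => rayCrossing_sum_pos hoy hi, ?_⟩
  · have h1 := hlast i (f (i - 1)) (by simp [around])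
    have h2 := hsw (f i) (c i)
    simp only [W]; linarith
  -- Sides common to an edge triangle and a fan cancel, and over a period only the crossings of the
  -- outer hull with the ray remain, of which there is at most one.
  · have htel : ∀ n : ℕ, T n + W (n + 1) = χ (c n) (c (n + 1)) +
        (χ (c ((n + 1 : ℕ) : ℤ)) (f ((n + 1 : ℕ) : ℤ)) - χ (c (n : ℤ)) (f (n : ℤ))) := by
      intro n
      have h1 := hsw (c n) (f n)
      have h2 := hsw (c (n + 1)) (f n)
      simp only [T, W]
      push_cast
      rw [show (n : ℤ) + 1 - 1 = n by ring]
      linarith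
    rw [Finset.sum_congr rfl fun n _ => htel n, Finset.sum_add_distrib,
      Finset.sum_range_sub (fun n : ℕ => χ (c (n : ℤ)) (f (n : ℤ)))]
    have e1 : c (k : ℤ) = c ((0 : ℕ) : ℤ) := by simpa using S.outer.add_period 0
    have e2 : f (k : ℤ) = f ((0 : ℕ) : ℤ) := by simpa using Y.period_f 0
    rw [e1, e2, sub_self, add_zero]
    have hval : ∀ n : ℕ, χ (c n) (c (n + 1)) =
        if orient o y (c n) < 0 ∧ 0 ≤ orient o y (c (n + 1)) then 1 else 0 := by
      intro n
      have h1 := hin n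
      simp only [χ, rayCrossing, crossing]
      rw [if_neg (c := _ ∧ _ ∧ orient (c n) (c (n + 1)) y < 0) (fun h => by linarith [h.2.2])]
      simp [h1]
    rw [Finset.sum_congr rfl fun n _ => hval n, Finset.sum_boole]
    have : (Finset.filter (fun n : ℕ => orient o y (c n) < 0 ∧ 0 ≤ orient o y (c (n + 1)))
        (Finset.range k)).card ≤ 1 := by
      refine Finset.card_le_one.2 fun n hn m hm => ?_
      simp only [Finset.mem_filter, Finset.mem_range] at hn hm
      have := S.outer.crossing_unique hn.2.1 hn.2.2 hm.2.1 hm.2.2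
      have := S.outer.eq_of_Ico ((S.outer.eq_iff _ _).2 this) (by omega) (by omega)
      omega
    exact_mod_cast this
  · rintro i ⟨p, q, hpq, hmem⟩
    have l := isChain_of_infix (Y.chain i) hpq
    have h1 := rayCrossing_sum_pos hoy hmem
    have h2 := hl i p q l
    have h3 := hsw p q
    have h4 := hsw (c i) q
    have h5 := hhead i p (hpq.subset (by simp))
    have h6 := hlast i q (hpq.subset (by simp))
    have h7 := hsw (f i) (c i)
    simp only [χ, W] at *
    linarith

theorem inside_of_openTriangle (S : Rings P c u k h) {p q r y : Plane} (hp : p ∈ P) (hq : q ∈ P)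
    (hr : r ∈ P) (hy : y ∈ openTriangle p q r) (i : ℤ) : 0 < orient (c i) (c (i + 1)) y := by
  have h1 := orient_pos_of_mem_openTriangle hy
  rw [openTriangle_eq h1] at hy
  refine orient_pos_of_mem_interior (S.outer.ne_succ i) (fun x hx =>
    orient_nonneg_of_mem_convexHull (fun z hz => ?_) hx) hy
  have : z ∈ P := by
    simp only [Set.mem_insert_iff, Set.mem_singleton_iff] at hz
    rcases hz with rfl | rfl | rfl <;> assumption
  exact (S.outer.edge i).nonneg this

/-- An open triangle of the subdivision: a triangle on the edge `i`, or a gap at the corner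
`i + 1`. -/
inductive Cell (c f : ℤ → Plane) (mid : ℤ → List Plane) : Bool → ℤ → Set Plane → Prop
  | edge (i : ℤ) : Cell c f mid true i (openTriangle (c i) (c (i + 1)) (f i))
  | gap (i : ℤ) (p q : Plane) (h : [p, q] <:+: around f mid i) :
      Cell c f mid false i (openTriangle (c i) q p)

theorem Cell.avoids (S : Rings P c u k h) (Y : Layout P c u k f mid) {t : Bool} {i : ℤ}
    {O : Set Plane} (C : Cell c f mid t i O) {y : Plane} (hy : y ∈ O) :
    Avoids P y ∧ ∀ j, 0 < orient (c j) (c (j + 1)) y := by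
  cases C with
  | edge i => exact ⟨(Y.edgeApex i).avoids S hy, inside_of_openTriangle S (S.c_mem i)
      (S.c_mem (i + 1)) (Rings.mem_P ((Y.edgeApex i).mem_inner S)) hy⟩
  | gap i p q hpq =>
    have l := isChain_of_infix (Y.chain i) hpq
    exact ⟨l.avoids S hy, inside_of_openTriangle S (S.c_mem i) (Rings.mem_P (l.mem S).2)
      (Rings.mem_P (l.mem S).1) hy⟩

theorem Cell.isOpen {t : Bool} {i : ℤ} {O : Set Plane} (C : Cell c f mid t i O) : IsOpen O := by
  cases C <;> exact isOpen_openTriangle _ _ _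

/-- Cells with a common point are of the same kind, at the same place. -/
theorem Cell.eq_of_mem (S : Rings P c u k h) (Y : Layout P c u k f mid) {t t' : Bool} {i j : ℤ}
    {O O' : Set Plane} (C : Cell c f mid t i O) (C' : Cell c f mid t' j O') {x : Plane}
    (hx : x ∈ O) (hx' : x ∈ O') : t = t' ∧ (k : ℤ) ∣ i - j := by
  obtain ⟨y, ⟨hy, hy'⟩, gen⟩ := exists_generic (C.isOpen.inter C'.isOpen) ⟨x, hx, hx'⟩ P
  obtain ⟨hav, hin⟩ := C.avoids S Y hy
  obtain ⟨T, W, T0, W0, pT, pW, hsum, hT, hW⟩ := exists_weights S Y gen hav hin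
  obtain ⟨h1, h2⟩ := dvd_of_sum_le_one (Z := fun i => T i + W (i + 1)) S.outer.pos
    (fun i => by rw [pT, show i + k + 1 = i + 1 + k by ring, pW])
    (fun i => add_nonneg (T0 _) (W0 _)) hsum
  have pT' : ∀ {i j : ℤ}, (k : ℤ) ∣ i - j → T i = T j := by
    rintro i j ⟨q, hq⟩
    have hper : Function.Periodic T (k : ℤ) := pT
    have := hper.int_mul q j
    rwa [Int.cast_id, show j + q * k = i by linarith] at this
  -- The gap at the corner `j` is counted in the summand with index `j - 1`. An edge and a gap would
  -- give two nonzero summands, or one summand of at least 2.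
  have mixed : ∀ {i j}, 1 ≤ T i → 1 ≤ W j → False := by
    intro i j hi hj
    have h3 := h2 i (j - 1) (by have := W0 (i + 1); omega)
      (by have := T0 (j - 1); rw [sub_add_cancel]; omega)
    have h4 := h1 (j - 1)
    simp only [sub_add_cancel] at h4
    rw [← pT' h3] at h4
    omega
  cases C with
  | edge i =>
    cases C' with
    | edge j =>
      refine ⟨rfl, h2 i j ?_ ?_⟩
      · have := hT i hy; have := W0 (i + 1); omega
      · have := hT j hy'; have := W0 (j + 1); omega
    | gap j p q hpq => exact (mixed (hT i hy) (hW j ⟨p, q, hpq, hy'⟩)).elim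
  | gap i p q hpq =>
    cases C' with
    | edge j => exact (mixed (hT j hy') (hW i ⟨p, q, hpq, hy⟩)).elim
    | gap j p' q' hpq' =>
      refine ⟨rfl, ?_⟩
      have := h2 (i - 1) (j - 1)
        (by have := hW i ⟨p, q, hpq, hy⟩; have := T0 (i - 1); rw [sub_add_cancel]; omega)
        (by have := hW j ⟨p', q', hpq', hy'⟩; have := T0 (j - 1); rw [sub_add_cancel]; omega)
      rwa [sub_sub_sub_cancel_right] at this

end Cells


/-! ### The triangles of a layout: disjoint interiors, and their order around the corners. -/

theorem exists_orient_openSegment {p q X : Plane} (hX : X ∈ openSegment ℝ p q) :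
    ∃ s t : ℝ, 0 < s ∧ 0 < t ∧ s + t = 1 ∧
      ∀ a b, orient a b X = s * orient a b p + t * orient a b q := by
  obtain ⟨s, t, hs, ht, hst, rfl⟩ := hX
  exact ⟨s, t, hs, ht, hst, fun a b => orient_add_smul a b p q hst⟩

theorem OrientGeneral.notMem_openSegment {Q : Finset Plane} (gen : OrientGeneral Q) {x y a : Plane}
    (hx : x ∈ Q) (hy : y ∈ Q) (ha : a ∈ Q) (hxy : x ≠ y) : a ∉ openSegment ℝ x y := by
  intro h
  have hax : a ≠ x := by
    rintro rfl; exact hxy (left_mem_openSegment_iff.1 h)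
  have hay : a ≠ y := by
    rintro rfl; exact hxy (right_mem_openSegment_iff.1 h)
  obtain ⟨s, t, -, -, -, e⟩ := exists_orient_openSegment h
  refine gen _ hx _ hy _ ha hxy hay.symm hax.symm ?_
  rw [e]; simp

/-- A triangle with two corners to the left of a line through the third one. -/
theorem eq_or_pos_of_mem_convexHull {l r a X p q : Plane} (hl : 0 < orient p q l)
    (hr : 0 < orient p q r) (ha : orient p q a = 0) (hX : X ∈ convexHull ℝ {l, r, a}) :
    X = a ∨ 0 < orient p q X := by
  refine convexHull_min (t := {X | X = a ∨ 0 < orient p q X}) ?_ ?_ hX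
  · rintro x (rfl | rfl | rfl)
    · exact Or.inr hl
    · exact Or.inr hr
    · exact Or.inl rfl
  · rintro x hx y hy s t hs ht hst
    have e := orient_add_smul p q x y hst
    have hx0 : 0 ≤ orient p q x := by rcases hx with rfl | hx; exacts [ha.ge, le_of_lt hx]
    have hy0 : 0 ≤ orient p q y := by rcases hy with rfl | hy; exacts [ha.ge, le_of_lt hy]
    have n1 := mul_nonneg hs hx0
    have n2 := mul_nonneg ht hy0
    by_cases hpos : 0 < orient p q (s • x + t • y)
    · exact Or.inr hpos
    left
    have z1 : s * orient p q x = 0 := by linarith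
    have z2 : t * orient p q y = 0 := by linarith
    rcases hs.eq_or_lt with rfl | hs
    · rcases hy with rfl | hy
      · simp [show t = 1 by linarith]
      · rw [show t = 1 by linarith, one_mul] at z2; exact absurd z2 (ne_of_gt hy)
    rcases ht.eq_or_lt with rfl | ht
    · rcases hx with rfl | hx
      · simp [show s = 1 by linarith]
      · rw [show s = 1 by linarith, one_mul] at z1; exact absurd z1 (ne_of_gt hx)
    rcases hx with rfl | hx
    · rcases hy with rfl | hy
      · rw [← add_smul, hst, one_smul]
      · exact absurd z2 (mul_pos ht hy).ne'
    · exact absurd z1 (mul_pos hs hx).ne'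

theorem exists_infix_of_mem {a : Plane} : ∀ {l : List Plane} {x : Plane}, a ∈ x :: l →
    a = x ∨ ∃ p, p ≠ a ∧ [p, a] <:+: x :: l
  | [], x, h => Or.inl (by simpa using h)
  | z :: l, x, h => by
    rcases List.mem_cons.1 h with rfl | h
    · exact Or.inl rfl
    rcases exists_infix_of_mem h with rfl | ⟨p, h1, h2⟩
    · by_cases hx : x = a
      · exact Or.inl hx.symm
      · exact Or.inr ⟨x, hx, [], l, rfl⟩
    · exact Or.inr ⟨p, h1, h2.trans (List.suffix_cons _ _).isInfix⟩

/-- The triangles of a layout. -/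
inductive Member (c f : ℤ → Plane) (mid : ℤ → List Plane) : Triangle → Prop
  | edge (i : ℤ) : Member c f mid ⟨c i, c (i + 1), f i⟩
  | corner (i : ℤ) (x : Plane) (hx : x ∈ mid i) : Member c f mid ⟨c i, c i, x⟩

theorem Member.exists_right {c f : ℤ → Plane} {mid : ℤ → List Plane} {t : Triangle}
    (M : Member c f mid t) : ∃ i, t.right = c i ∧ t.apex ∈ f (i - 1) :: mid i := by
  cases M with
  | edge i => exact ⟨i + 1, rfl, by simp⟩
  | corner i x hx => exact ⟨i, rfl, by simp [hx]⟩

section Layout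

variable {P : Finset Plane} {c u : ℤ → Plane} {k h : ℕ} {f : ℤ → Plane} {mid : ℤ → List Plane}

theorem Layout.mem_inner (Y : Layout P c u k f mid) (S : Rings P c u k h) {i : ℤ} {a : Plane}
    (ha : a ∈ f (i - 1) :: mid i) : a ∈ innerPoints P := by
  rcases List.mem_cons.1 ha with rfl | ha
  · exact (Y.edgeApex _).mem_inner S
  · rcases Y.corner i a ha with ⟨n, rfl, -⟩ | h
    · exact S.u_mem n
    · exact deep_subset h

theorem Layout.f_eq_of_dvd (Y : Layout P c u k f mid) {i j : ℤ} (hij : (k : ℤ) ∣ i - j) :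
    f i = f j := by
  obtain ⟨q, hq⟩ := hij
  have hper : Function.Periodic f (k : ℤ) := Y.period_f
  have := hper.int_mul q j
  rwa [Int.cast_id, show j + q * k = i by linarith] at this

theorem Layout.mid_eq_of_dvd (Y : Layout P c u k f mid) {i j : ℤ} (hij : (k : ℤ) ∣ i - j) :
    mid i = mid j := by
  obtain ⟨q, hq⟩ := hij
  have hper : Function.Periodic mid (k : ℤ) := Y.period_mid
  have := hper.int_mul q j
  rwa [Int.cast_id, show j + q * k = i by linarith] at this

/-- A right edge has a cell on its left. -/
theorem Layout.exists_cell (Y : Layout P c u k f mid) (S : Rings P c u k h) {i : ℤ} {a : Plane}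
    (ha : a ∈ f (i - 1) :: mid i) : ∃ s t m, 0 < orient (c i) a s ∧
      Cell c f mid t m (openTriangle (c i) a s) ∧
      ((t = true ∧ m = i - 1 ∧ a = f (i - 1)) ∨ (t = false ∧ m = i)) := by
  have ha' : a ∈ around f mid i := by
    rw [around, ← List.cons_append]; exact List.mem_append_left _ ha
  rcases exists_infix_of_mem ha' with rfl | ⟨p, h1, h2⟩
  · refine ⟨c (i - 1), true, i - 1, ?_, ?_, Or.inl ⟨rfl, rfl, rfl⟩⟩
    · have := S.edge_pos (i - 1) (Y.mem_inner S ha)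
      rw [sub_add_cancel] at this
      rwa [orient_rot]
    · have e : openTriangle (c i) (f (i - 1)) (c (i - 1)) =
          openTriangle (c (i - 1)) (c (i - 1 + 1)) (f (i - 1)) := by
        rw [sub_add_cancel]
        ext x; simp only [openTriangle, Set.mem_ofPred_eq]; tauto
      rw [e]; exact Cell.edge _
  · exact ⟨p, false, i, ((isChain_of_infix (Y.chain i) h2).pos).resolve_left h1,
      Cell.gap i p a h2, Or.inr ⟨rfl, rfl⟩⟩

/-- Right edges at different corners are disjoint. -/
theorem Layout.right_edges_disjoint (Y : Layout P c u k f mid) (S : Rings P c u k h) {i j : ℤ}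
    {a a' X : Plane} (ha : a ∈ f (i - 1) :: mid i) (ha' : a' ∈ f (j - 1) :: mid j)
    (hX : X ∈ openSegment ℝ (c i) a) (hX' : X ∈ openSegment ℝ (c j) a') : (k : ℤ) ∣ i - j := by
  by_contra hij
  have hc : c i ≠ c j := fun h => hij ((S.outer.eq_iff i j).1 h)
  have m := Y.mem_inner S ha
  have m' := Y.mem_inner S ha'
  obtain ⟨s, t, n, h1, h2, h3⟩ := Y.exists_cell S ha
  obtain ⟨s', t', n', h1', h2', h3'⟩ := Y.exists_cell S ha'
  -- Each right edge bounds a cell on its left, so a crossing of two right edges makes two cells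
  -- overlap.
  obtain ⟨Z, hZ, hZ'⟩ := exists_mem_of_cross h1 h1' hX hX'
    (S.gen _ (S.c_mem i) _ (Rings.mem_P m) _ (S.c_mem j) (S.ne_c i m).symm (S.ne_c j m) hc)
    (S.gen _ (S.c_mem j) _ (Rings.mem_P m') _ (S.c_mem i) (S.ne_c j m').symm (S.ne_c i m') hc.symm)
  obtain ⟨e1, e2⟩ := h2.eq_of_mem S Y h2' hZ hZ'
  rcases h3 with ⟨rfl, rfl, -⟩ | ⟨rfl, rfl⟩
  · rcases h3' with ⟨-, rfl, -⟩ | ⟨h, -⟩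
    · rw [sub_sub_sub_cancel_right] at e2; exact hij e2
    · exact absurd (e1.trans h) (by simp)
  · rcases h3' with ⟨h, -⟩ | ⟨-, rfl⟩
    · exact absurd (e1.trans h) (by simp)
    · exact hij e2

/-- Right edges do not enter the triangles on the hull edges. -/
theorem Layout.right_edge_notMem (Y : Layout P c u k f mid) (S : Rings P c u k h) {i j : ℤ}
    {a X : Plane} (ha : a ∈ f (i - 1) :: mid i) (hX : X ∈ openSegment ℝ (c i) a) :
    X ∉ openTriangle (c j) (c (j + 1)) (f j) := by
  intro hXj
  obtain ⟨s, t, n, h1, h2, h3⟩ := Y.exists_cell S ha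
  obtain ⟨σ, τ, hσ, hτ, -, e⟩ := exists_orient_openSegment hX
  -- Points near `X` in the direction of `s` lie in the cell to the left of the right edge, and
  -- still in the open edge triangle.
  have hcl : X ∈ closure (openSegment ℝ X s) := by
    rw [closure_openSegment]; exact left_mem_segment ℝ _ _
  obtain ⟨Z, hZj, hZ⟩ := mem_closure_iff.1 hcl _ (isOpen_openTriangle _ _ _) hXj
  have hZ' : Z ∈ openTriangle (c i) a s := by
    obtain ⟨σ', τ', hσ', hτ', -, e'⟩ := exists_orient_openSegment hZ
    refine ⟨?_, ?_, ?_⟩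
    · rw [e', e, orient_self_mid, orient_self_right, mul_zero, mul_zero, add_zero, mul_zero,
        zero_add]
      exact mul_pos hτ' h1
    · rw [e', e, orient_self_right, orient_self_mid, orient_rot]
      simp only [mul_zero, add_zero]
      exact mul_pos hσ' (mul_pos hσ h1)
    · rw [e', e, orient_self_right, orient_self_mid, ← orient_rot]
      simp only [mul_zero, add_zero, zero_add]
      exact mul_pos hσ' (mul_pos hτ h1)
  obtain ⟨e1, e2⟩ := h2.eq_of_mem S Y (Cell.edge j) hZ' hZj
  rcases h3 with ⟨-, rfl, rfl⟩ | ⟨h, -⟩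
  · have e3 : c i = c (j + 1) := (S.outer.eq_iff _ _).2 (by
      rwa [show i - (j + 1) = i - 1 - j by ring])
    rw [e3, Y.f_eq_of_dvd e2] at e
    have := hXj.2.1
    rw [e] at this
    simp at this
  · exact absurd (e1.symm.trans h) (by simp)

theorem Layout.inside_edge (Y : Layout P c u k f mid) (S : Rings P c u k h) (i : ℤ) :
    (⟨c i, c (i + 1), f i⟩ : Triangle).inside = openTriangle (c i) (c (i + 1)) (f i) := by
  rw [Triangle.inside, if_neg (S.outer.ne_succ i),
    openTriangle_eq (S.edge_pos i ((Y.edgeApex i).mem_inner S))]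
  rfl

theorem inside_degenerate (p x : Plane) : (⟨p, p, x⟩ : Triangle).inside = openSegment ℝ p x := by
  rw [Triangle.inside, if_pos rfl]

theorem region_degenerate (p x : Plane) : (⟨p, p, x⟩ : Triangle).region = segment ℝ p x := by
  rw [Triangle.region, Set.insert_eq_of_mem (Set.mem_insert _ _), convexHull_pair]

theorem Layout.disjoint (Y : Layout P c u k f mid) (S : Rings P c u k h) {t t' : Triangle}
    (M : Member c f mid t) (M' : Member c f mid t') (hne : t ≠ t') :
    Disjoint t.inside t'.inside := by
  rw [Set.disjoint_left]
  intro X hX hX'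
  cases M with
  | edge i =>
    rw [Y.inside_edge S] at hX
    cases M' with
    | edge j =>
      rw [Y.inside_edge S] at hX'
      obtain ⟨-, e⟩ := (Cell.edge (mid := mid) i).eq_of_mem S Y (Cell.edge j) hX hX'
      apply hne
      rw [(S.outer.eq_iff _ _).2 e, Y.f_eq_of_dvd e,
        (S.outer.eq_iff (i + 1) (j + 1)).2 (by rwa [add_sub_add_right_eq_sub])]
    | corner j x hx =>
      rw [inside_degenerate] at hX'
      exact Y.right_edge_notMem S (List.mem_cons_of_mem _ hx) hX' hX
  | corner i x hx =>
    rw [inside_degenerate] at hX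
    cases M' with
    | edge j =>
      rw [Y.inside_edge S] at hX'
      exact Y.right_edge_notMem S (List.mem_cons_of_mem _ hx) hX hX'
    | corner j y hy =>
      rw [inside_degenerate] at hX'
      have hx' := List.mem_cons_of_mem (f (i - 1)) hx
      have hy' := List.mem_cons_of_mem (f (j - 1)) hy
      have e := (S.outer.eq_iff _ _).2 (Y.right_edges_disjoint S hx' hy' hX hX')
      rw [e] at hne hX
      obtain ⟨s, t, hs, ht, -, e1⟩ := exists_orient_openSegment hX
      obtain ⟨s', t', hs', ht', -, e2⟩ := exists_orient_openSegment hX'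
      have h1 := e1 (c j) x
      have h2 := e2 (c j) x
      simp only [orient_self_mid, orient_self_right, mul_zero, add_zero, zero_add] at h1 h2
      rw [h1] at h2
      refine S.ne_zero j (Y.mem_inner S hx') (Y.mem_inner S hy') ?_
        ((mul_eq_zero.1 h2.symm).resolve_left ht'.ne')
      rintro rfl
      exact hne rfl

/-- Consecutive triangles are linked. -/
theorem Layout.link_of_isNext (Y : Layout P c u k f mid) (S : Rings P c u k h)
    {T : Multiset Triangle} (hT : ∀ t, t ∈ T ↔ Member c f mid t) {t t' : Triangle}
    (hn : IsNext T t t') : ∃ i, t.right = c i ∧ t.apex ∈ f (i - 1) :: mid i ∧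
      Link P c u i t.apex t'.apex := by
  obtain ⟨h1, h2, h3, h4⟩ := hn
  rw [hT] at h1 h2
  have chain := Y.chain
  have sorted := Y.sorted
  -- the first triangle belongs to a list at `c i`, which is continued by the second one
  have key : ∀ i, t.right = c i → t'.left = c i → ∀ l r, around f mid i = l ++ t.apex :: r →
      r ≠ [] →
      (∀ x ∈ r.dropLast, x ∈ mid i ∧ Precedes t ⟨c i, c i, x⟩) →
      (t' = ⟨c i, c (i + 1), f i⟩ ∨ t' = ⟨c i, c i, t'.apex⟩ ∧ t'.apex ∈ r.dropLast) →
      (r.dropLast).Pairwise (fun x y => orient (c i) x y < 0) → r.getLast? = some (f i) →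
      Link P c u i t.apex t'.apex := by
    intro i hr hl l r e hrne hmid hcase hs hlast
    obtain ⟨y, r', rfl⟩ := List.exists_cons_of_ne_nil hrne
    suffices h : t'.apex = y by
      rw [h]
      exact isChain_of_infix (Y.chain i) ⟨l, r', by rw [List.append_assoc]; exact e.symm⟩
    rcases eq_or_ne r' [] with rfl | hr'
    · rcases hcase with h | ⟨-, h⟩
      · rw [h]; simpa using hlast.symm
      · simp at h
    · rw [List.dropLast_cons_of_ne_nil hr'] at hmid hcase hs
      obtain ⟨hy, hpy⟩ := hmid y (by simp)
      -- Otherwise the degenerate triangle with apex `y` lies strictly between the two triangles,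
      -- which are then not consecutive.
      by_contra hne
      refine h4 ⟨c i, c i, y⟩ ((hT _).2 (Member.corner i y hy)) ⟨hpy, hl, ?_⟩
      rcases hcase with h | ⟨h, h'⟩
      · right; left
        rw [h]; exact S.outer.ne_succ i
      · right; right
        exact (List.pairwise_cons.1 hs).1 _ ((List.mem_cons.1 h').resolve_left hne)
  cases h1 with
  | edge i =>
    refine ⟨i + 1, rfl, by simp, key (i + 1) rfl h3.1 [] (mid (i + 1) ++ [f (i + 1)])
      (by simp [around]) (by simp) ?_ ?_ ?_ (by simp)⟩
    · intro x hx
      rw [List.dropLast_concat] at hx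
      exact ⟨hx, rfl, Or.inl (S.outer.ne_succ i)⟩
    · rw [List.dropLast_concat]
      cases h2 with
      | edge j =>
        left
        have e := (S.outer.eq_iff j (i + 1)).1 h3.1
        rw [(S.outer.eq_iff _ _).2 e, Y.f_eq_of_dvd e,
          (S.outer.eq_iff (j + 1) (i + 1 + 1)).2 (by rwa [add_sub_add_right_eq_sub])]
      | corner j x hx =>
        right
        have e := (S.outer.eq_iff j (i + 1)).1 h3.1
        rw [(S.outer.eq_iff _ _).2 e, ← Y.mid_eq_of_dvd e]
        exact ⟨rfl, hx⟩
    · rw [List.dropLast_concat]; exact Y.sorted _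
  | corner i x hx =>
    obtain ⟨l, r, hlr⟩ := List.append_of_mem hx
    have hs := Y.sorted i
    rw [hlr] at hs
    have hs2 := (List.pairwise_append.1 hs).2.1
    refine ⟨i, rfl, by simp [hx], key i rfl h3.1 (f (i - 1) :: l) (r ++ [f i])
      (by simp [around, hlr]) (by simp) ?_ ?_ ?_ (by simp)⟩
    · intro y hy
      rw [List.dropLast_concat] at hy
      exact ⟨by simp [hlr, hy], rfl, Or.inr (Or.inr ((List.pairwise_cons.1 hs2).1 y hy))⟩
    · rw [List.dropLast_concat]
      cases h2 with
      | edge j =>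
        left
        have e := (S.outer.eq_iff j i).1 h3.1
        rw [(S.outer.eq_iff _ _).2 e, Y.f_eq_of_dvd e,
          (S.outer.eq_iff (j + 1) (i + 1)).2 (by rwa [add_sub_add_right_eq_sub])]
      | corner j y hy =>
        right
        have e := (S.outer.eq_iff j i).1 h3.1
        rw [(S.outer.eq_iff _ _).2 e]
        refine ⟨rfl, ?_⟩
        rw [Y.mid_eq_of_dvd e, hlr] at hy
        have hxy : orient (c i) x y < 0 := by
          rcases h3.2 with h | h | h
          · exact absurd rfl h
          · exact absurd rfl h
          · exact h
        rcases List.mem_append.1 hy with hy | hy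
        · have := (List.pairwise_append.1 hs).2.2 y hy x (by simp)
          rw [orient_swap_right] at this
          linarith
        · rcases List.mem_cons.1 hy with rfl | hy
          · simp at hxy
          · exact hy
    · rw [List.dropLast_concat]; exact (List.pairwise_cons.1 hs2).2

end Layout


/-! ### How the triangles of a layout meet the inner hull and the hull of the deep points. -/

theorem mem_of_mem_convexHull_hullVertex {Q : Finset Plane} {p : Plane} (hp : p ∈ hullVertices Q)
    {T : Set Plane} (hT : ∀ x ∈ T, x ∈ Q) (h : p ∈ convexHull ℝ T) : p ∈ T := by
  by_contra hpT
  obtain ⟨w, hw⟩ := exists_halfplane hp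
  have := orient_pos_of_mem_convexHull (a := p) (b := w)
    (fun x hx => hw x (hT x hx) (by rintro rfl; exact hpT hx)) h
  simp at this

/-- A ray into a triangle from one of its corners. -/
theorem exists_mem_ray {o d x y : Plane} (h : 0 < orient o x y) (h1 : 0 < orient o x d)
    (h2 : 0 < orient o d y) : ∃ X ∈ convexHull ℝ {o, x, y}, X ∈ segment ℝ o d ∧ X ≠ o := by
  set A := orient o x y with hA
  set B := orient x y d
  have hpos : 0 < A + |B| := by positivity
  -- At most 1, and small enough that the barycentric weight at `o` stays nonnegative.
  set ε := A / (A + |B|) with hε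
  have e0 : 0 < ε := div_pos h hpos
  have e1 : ε ≤ 1 := (div_le_one hpos).2 (by linarith [abs_nonneg B])
  have e2 : ε * (A + |B|) = A := div_mul_cancel₀ _ hpos.ne'
  have e : ∀ a b, orient a b ((1 - ε) • o + ε • d) = (1 - ε) * orient a b o + ε * orient a b d :=
    fun a b => orient_add_smul a b o d (by ring)
  refine ⟨(1 - ε) • o + ε • d, (mem_triangle_iff h).2 ⟨?_, ?_, ?_⟩,
    ⟨1 - ε, ε, by linarith, e0.le, by ring, rfl⟩, fun hcon => ?_⟩
  · rw [e, orient_self_mid, mul_zero, zero_add]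
    exact (mul_pos e0 h1).le
  · rw [e, orient_rot]
    have : ε * -|B| ≤ ε * B := mul_le_mul_of_nonneg_left (neg_abs_le B) e0.le
    linarith
  · rw [e, orient_self_right, mul_zero, zero_add, ← orient_rot]
    exact (mul_pos e0 h2).le
  · have := e o x
    rw [hcon, orient_self_mid, mul_zero, zero_add] at this
    exact (mul_pos e0 h1).ne this

/-- A segment that enters a triangle over the line of the edge `e d` ends inside. -/
theorem mem_of_straddle {p q e d X : Plane} (hX : X ∈ openSegment ℝ p q) (h1 : orient p q e < 0)
    (h2 : 0 < orient p q d) (h3 : 0 < orient e d p) (h4 : 0 < orient e d q) :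
    q ∈ convexHull ℝ {e, d, X} := by
  obtain ⟨s, t, hs, ht, -, E⟩ := exists_orient_openSegment hX
  refine (mem_triangle_iff ?_).2 ⟨h4.le, ?_, ?_⟩
  · rw [E]; exact add_pos (mul_pos hs h3) (mul_pos ht h4)
  · have := E q d
    rw [orient_self_mid, mul_zero, add_zero] at this
    have e1 : orient d X q = orient q d X := orient_rot _ _ _
    have e2 : orient q d p = orient p q d := orient_rot _ _ _
    rw [e1, this, e2]
    exact (mul_pos hs h2).le
  · have := E q e
    rw [orient_self_mid, mul_zero, add_zero] at this
    have e1 : orient X e q = -orient q e X := by unfold orient; ring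
    have e2 : orient q e p = orient p q e := orient_rot _ _ _
    rw [e1, this, e2]
    linarith [mul_neg_of_pos_of_neg hs h1]

/-- The points on the near side of a chain, and beyond the line of sight of `d`, are deep. -/
theorem ChainPoint.deep_of_between {P : Finset Plane} {v w z a d x : Plane}
    (H : ChainPoint P v w z a) (hvw : IsHullEdge (innerPoints P) v w) (hd : 0 < orient z a d)
    (hdv : SeesFirst P d v) (hx : x ∈ innerPoints P) (h1 : 0 < orient z a x)
    (h2 : 0 < orient a d x) : x ∈ innerPoints (innerPoints P) := by
  have hav := ne_of_deep H.mem hvw.1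
  have haw := ne_of_deep H.mem hvw.2.1
  have hvd : 0 < orient a v d := by
    have := hdv a (deep_subset H.mem) hav
    have e : orient a v d = -orient d v a := by unfold orient; ring
    linarith
  have hvx : 0 < orient a v x := by
    have e := orient_pluecker a v d x z
    rw [orient_rot z a x, orient_rot z a d, orient_rot z a v] at e
    have n1 := mul_pos hvd h1
    have n2 := mul_pos H.left h2
    exact (pos_iff_pos_of_mul_pos (show 0 < orient a v x * orient z a d by linarith)).2 hd
  refine notMem_of_gate hvw H.mem hx ?_ hvx
  have hxw : x ≠ w := by
    rintro rfl
    rcases H.base with rfl | h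
    · simp at h1
    · linarith
  have hxv : x ≠ v := by rintro rfl; simp at hvx
  have h3 := hvw.pos hx hxv hxw
  have h4 := hvw.pos (deep_subset H.mem) hav haw
  have e := orient_affine z a v w a x
  rw [orient_self_right, mul_zero, add_zero] at e
  have hw : orient z a w ≤ 0 := by
    rcases H.base with rfl | h
    · simp
    · exact h.le
  have n1 := mul_pos h4 h1
  have n2 := mul_nonneg hvx.le (neg_nonneg.2 hw)
  exact (pos_iff_pos_of_mul_pos (show 0 < orient w a x * orient z a v by linarith)).2 H.left

theorem SeesFirst.unique {P : Finset Plane} {c v v' : Plane} (h : SeesFirst P c v)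
    (h' : SeesFirst P c v') (hv : v ∈ innerPoints P) (hv' : v' ∈ innerPoints P) : v = v' := by
  by_contra hne
  have h1 := h v' hv' (Ne.symm hne)
  have h2 := h' v hv hne
  rw [orient_swap_right] at h2
  linarith

section Views

variable {P : Finset Plane} {c u : ℤ → Plane} {k h : ℕ} {f : ℤ → Plane} {mid : ℤ → List Plane}
  {t : Triangle}

/-- Only a rule step can start at a deep point, and its result is again a target, hence a chain
point. -/
theorem Link.view (S : Rings P c u k h) {i : ℤ} {x y : Plane} (l : Link P c u i x y)
    (hx : x ∈ innerPoints (innerPoints P)) : ∃ v w z, IsHullEdge (innerPoints P) v w ∧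
      ChainPoint P v w z x ∧ 0 < orient z x (c i) ∧ 0 < orient w x (c i) ∧ SeesFirst P (c i) v := by
  cases l with
  | gate n hn => exact absurd rfl (ne_of_deep hx (S.inner.mem_hull n))
  | entry v w y hvw hv hy T => exact absurd rfl (ne_of_deep hx hvw.1)
  | step v w x y hvw hv T hr =>
    rcases hr.target hvw hv (Set.mem_singleton _) (fun l hl => Or.inl hl) T with rfl | ⟨z, H, hs⟩
    · exact absurd rfl (ne_of_deep hx hvw.2.1)
    · exact ⟨v, w, z, hvw, H, (hs _ rfl).1, (hs _ rfl).2, hv⟩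

theorem EdgeApex.view {i : ℤ} {a : Plane} (E : EdgeApex P c u i a) :
    (∃ n, a = u n ∧ Sees c u i n ∧ Sees c u (i + 1) (n + 1)) ∨
    ∃ v w z, IsHullEdge (innerPoints P) v w ∧ ChainPoint P v w z a ∧
      ∀ l ∈ ({c i, c (i + 1)} : Set Plane), 0 < orient z a l ∧ 0 < orient w a l ∧
        SeesFirst P l v := by
  cases E with
  | hull n h1 h2 => exact Or.inl ⟨n, rfl, h1, h2⟩
  | deep v w z a hvw H hl hr hl' hr' hlv hrv =>
    refine Or.inr ⟨v, w, z, hvw, H, ?_⟩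
    rintro l (rfl | rfl)
    · exact ⟨hl, hl', hlv⟩
    · exact ⟨hr, hr', hrv⟩

/-- For a degenerate triangle the information is taken from the link that starts at its apex; there
is one because the list at the corner continues up to `f i`. -/
theorem Layout.deep_view (Y : Layout P c u k f mid) (S : Rings P c u k h) (M : Member c f mid t)
    (ha : t.apex ∈ innerPoints (innerPoints P)) :
    ∃ v w z, IsHullEdge (innerPoints P) v w ∧ ChainPoint P v w z t.apex ∧
      ∀ l ∈ ({t.left, t.right} : Set Plane), 0 < orient z t.apex l ∧ 0 < orient w t.apex l ∧
        SeesFirst P l v := by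
  cases M with
  | edge i =>
    rcases (Y.edgeApex i).view with ⟨n, h1, -⟩ | h
    · exact absurd h1 (ne_of_deep ha (S.inner.mem_hull n))
    · exact h
  | corner i x hx =>
    obtain ⟨l, r, hlr⟩ := List.append_of_mem hx
    obtain ⟨y, r', hr⟩ := List.exists_cons_of_ne_nil (show r ++ [f i] ≠ [] by simp)
    have hl : Link P c u i x y := isChain_of_infix (Y.chain i) ⟨f (i - 1) :: l, r', by
      simp [hlr, ← hr]⟩
    obtain ⟨v, w, z, hvw, H, h1, h2, h3⟩ := hl.view S ha
    refine ⟨v, w, z, hvw, H, ?_⟩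
    simp only [Set.mem_insert_iff, Set.mem_singleton_iff, or_self]
    rintro l rfl
    exact ⟨h1, h2, h3⟩

theorem Member.apex_mem (M : Member c f mid t) (Y : Layout P c u k f mid) (S : Rings P c u k h) :
    t.apex ∈ innerPoints P := by
  obtain ⟨i, -, h⟩ := M.exists_right
  exact Y.mem_inner S h

theorem Member.edge_or (M : Member c f mid t) (S : Rings P c u k h) :
    t.left = t.right ∨ IsHullEdge P t.left t.right := by
  cases M with
  | edge i => exact Or.inr (S.outer.edge i)
  | corner i x hx => exact Or.inl rfl

theorem Member.corners (M : Member c f mid t) (S : Rings P c u k h) :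
    t.left ∈ hullVertices P ∧ t.right ∈ hullVertices P := by
  cases M with
  | edge i => exact ⟨S.outer.mem_hull _, S.outer.mem_hull _⟩
  | corner i x hx => exact ⟨S.outer.mem_hull _, S.outer.mem_hull _⟩

/-- A triangle of the layout meets the appropriate inner hull only in its inward vertex. -/
theorem Layout.region_eq (Y : Layout P c u k f mid) (S : Rings P c u k h) (M : Member c f mid t)
    {X : Plane} (hX : X ∈ t.region) (h1 : X ∈ convexHull ℝ (innerPoints P : Set Plane))
    (h2 : t.apex ∈ innerPoints (innerPoints P) →
      X ∈ convexHull ℝ (innerPoints (innerPoints P) : Set Plane)) : X = t.apex := by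
  by_cases ha : t.apex ∈ innerPoints (innerPoints P)
  · obtain ⟨v, w, z, hvw, H, hs⟩ := Y.deep_view S M ha
    refine (eq_or_pos_of_mem_convexHull (hs _ (by simp)).1 (hs _ (by simp)).1
      (by simp) hX).resolve_right (not_lt.2 (H.hull_nonpos (h2 ha)))
  · cases M with
    | edge i =>
      rcases (Y.edgeApex i).view with ⟨n, e, h3, h4⟩ | ⟨v, w, z, -, H, -⟩
      · simp only [Triangle.region] at hX ⊢
        rw [e] at hX ⊢
        exact S.typeOne_region h3 h4 h1 hX
      · exact absurd H.mem ha
    | corner i x hx =>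
      rcases Y.corner i x hx with ⟨n, rfl, h3⟩ | h3
      · rw [region_degenerate] at hX
        exact S.segment_region h3 h1 hX
      · exact absurd h3 ha

/-- The segment lies in the relevant hull, so it could touch the triangle only at the apex, which
would make three points of `P` collinear. -/
theorem Layout.not_meets (Y : Layout P c u k f mid) (S : Rings P c u k h) (M : Member c f mid t)
    {x y X : Plane} (hx : x ∈ innerPoints P) (hy : y ∈ innerPoints P) (hxy : x ≠ y)
    (hdeep : t.apex ∈ innerPoints (innerPoints P) →
      x ∈ innerPoints (innerPoints P) ∧ y ∈ innerPoints (innerPoints P))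
    (hX : X ∈ openSegment ℝ x y) : X ∉ t.region := by
  intro hXt
  have := Y.region_eq S M hXt
    ((convex_convexHull ℝ _).openSegment_subset (subset_convexHull ℝ _ hx)
      (subset_convexHull ℝ _ hy) hX)
    (fun ha => (convex_convexHull ℝ _).openSegment_subset (subset_convexHull ℝ _ (hdeep ha).1)
      (subset_convexHull ℝ _ (hdeep ha).2) hX)
  rw [this] at hX
  exact S.genInner.notMem_openSegment hx hy (M.apex_mem Y S) hxy hX

theorem region_subset {t : Triangle} {X : Plane} (hX : X ∈ t.region) {p q : Plane}
    (hp : p ∈ ({t.left, t.right, t.apex} : Set Plane))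
    (hq : q ∈ ({t.left, t.right, t.apex} : Set Plane)) :
    convexHull ℝ {p, q, X} ⊆ t.region := by
  refine convexHull_min ?_ (convex_convexHull ℝ _)
  rintro y (rfl | rfl | rfl)
  · exact subset_convexHull ℝ _ hp
  · exact subset_convexHull ℝ _ hq
  · exact hX

/-- The right edge does not enter an inner triangle at the inward vertex. -/
theorem Layout.not_cone (Y : Layout P c u k f mid) (S : Rings P c u k h) (M : Member c f mid t)
    {x y : Plane} (hx : x ∈ innerPoints P) (hy : y ∈ innerPoints P)
    (hdeep : t.apex ∈ innerPoints (innerPoints P) →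
      x ∈ innerPoints (innerPoints P) ∧ y ∈ innerPoints (innerPoints P))
    (h1 : 0 < orient t.apex x y) (h2 : 0 < orient t.apex x t.right)
    (h3 : 0 < orient t.apex t.right y) : False := by
  obtain ⟨X, hX, hX', hne⟩ := exists_mem_ray h1 h2 h3
  refine hne (Y.region_eq S M ?_ (convexHull_mono ?_ hX) fun ha => convexHull_mono ?_ hX)
  · exact (convex_convexHull ℝ _).segment_subset (subset_convexHull ℝ _ (by simp))
      (subset_convexHull ℝ _ (by simp)) hX'
  · rintro p (rfl | rfl | rfl)
    exacts [M.apex_mem Y S, hx, hy]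
  · rintro p (rfl | rfl | rfl)
    exacts [ha, (hdeep ha).1, (hdeep ha).2]

theorem Member.right_nonneg (M : Member c f mid t) (Y : Layout P c u k f mid) (S : Rings P c u k h)
    {X : Plane} (hX : X ∈ t.region) : 0 ≤ orient t.right t.apex X := by
  refine orient_nonneg_of_mem_convexHull ?_ hX
  rintro p (rfl | rfl | rfl)
  · rcases M.edge_or S with e | e
    · rw [e]; simp
    · rw [orient_rot]; exact e.nonneg (Rings.mem_P (M.apex_mem Y S))
  · simp
  · simp

theorem Member.left_nonneg (M : Member c f mid t) (Y : Layout P c u k f mid) (S : Rings P c u k h)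
    {X : Plane} (hX : X ∈ t.region) : 0 ≤ orient t.apex t.left X := by
  refine orient_nonneg_of_mem_convexHull ?_ hX
  rintro p (rfl | rfl | rfl)
  · simp
  · rcases M.edge_or S with e | e
    · rw [e]; simp
    · rw [← orient_rot]; exact e.nonneg (Rings.mem_P (M.apex_mem Y S))
  · simp

theorem Member.corner_mem (M : Member c f mid t) (Y : Layout P c u k f mid) (S : Rings P c u k h)
    {i : ℤ} (hX : c i ∈ t.region) : c i = t.left ∨ c i = t.right := by
  have := mem_of_mem_convexHull_hullVertex (S.outer.mem_hull i) (T := {t.left, t.right, t.apex}) (by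
    rintro x (rfl | rfl | rfl)
    exacts [mem_of_mem_hullVertices (M.corners S).1, mem_of_mem_hullVertices (M.corners S).2,
      Rings.mem_P (M.apex_mem Y S)]) hX
  rcases this with h | h | h
  · exact Or.inl h
  · exact Or.inr h
  · exact absurd h.symm (S.ne_c i (M.apex_mem Y S))

/-- The inward vertices at a corner appear in clockwise order. -/
theorem Layout.order (Y : Layout P c u k f mid) (S : Rings P c u k h) (i : ℤ) {y : Plane}
    (hy : y ∈ f (i - 1) :: mid i) : (f (i - 1) = y ∨ 0 < orient (c i) y (f (i - 1))) ∧
      (y = f i ∨ 0 < orient (c i) (f i) y) := by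
  obtain ⟨w, hw⟩ := S.exists_wide i
  -- Links compare neighbours only. All inner points lie in a half-plane at `c i`, so the comparison
  -- is transitive and extends to the whole list.
  let Q : Plane → Plane → Prop := fun p q => p ∈ innerPoints P ∧ q ∈ innerPoints P ∧
    (p = q ∨ 0 < orient (c i) q p)
  have htrans : IsTrans Plane Q := ⟨by
    rintro p q r ⟨h1, h2, h3⟩ ⟨-, h4, h5⟩
    refine ⟨h1, h4, ?_⟩
    rcases h3 with rfl | h3
    · exact h5
    rcases h5 with rfl | h5
    · exact Or.inr h3
    · exact Or.inr (orient_trans (hw _ h4) (hw _ h2) (hw _ h1) h5 h3)⟩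
  have hch : (around f mid i).IsChain Q := (Y.chain i).imp fun p q l =>
    ⟨(l.mem S).1, (l.mem S).2, l.pos⟩
  have hp := List.isChain_iff_pairwise.1 hch
  constructor
  · rcases List.mem_cons.1 hy with rfl | hy
    · exact Or.inl rfl
    · exact ((List.pairwise_cons.1 hp).1 y (by simp [hy])).2.2
  · rw [around, ← List.cons_append] at hp
    exact ((List.pairwise_append.1 hp).2.2 y hy (f i) (by simp)).2.2

end Views


/-! ### Segments to free points: the geometry behind conditions 7 and 8. -/

section Segments

variable {P : Finset Plane} {c u : ℤ → Plane} {k h : ℕ} {f : ℤ → Plane} {mid : ℤ → List Plane}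
  {s t t' : Triangle}

/-- A crossed triangle has no two corners whose edge separates the endpoints from the far side. -/
theorem Member.not_straddle (M : Member c f mid s) (S : Rings P c u k h)
    {p q X : Plane} (hp : p ∈ P) (hq : q ∈ P) (hX : X ∈ openSegment ℝ p q) (hXs : X ∈ s.region)
    (hqs : q ∉ s.region) (h1 : orient p q s.left < 0) (h2 : 0 < orient p q s.right) : False := by
  have hne : s.left ≠ s.right := by
    intro e; rw [e] at h1; linarith
  have he := (M.edge_or S).resolve_left hne
  refine hqs (region_subset hXs (by simp) (by simp) (mem_of_straddle hX h1 h2 ?_ ?_))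
  · exact he.pos hp (by rintro rfl; simp at h1) (by rintro rfl; simp at h2)
  · exact he.pos hq (by rintro rfl; simp at h1) (by rintro rfl; simp at h2)

theorem not_all_neg {p q X : Plane} (hXs : X ∈ s.region) (hX : orient p q X = 0)
    (h1 : orient p q s.left < 0) (h2 : orient p q s.right < 0) (h3 : orient p q s.apex < 0) :
    False := by
  have := orient_pos_of_mem_convexHull (a := q) (b := p) (by
    rintro y (rfl | rfl | rfl) <;> rw [orient_swap] <;> linarith) hXs
  rw [orient_swap, hX] at this
  simp at this

theorem not_all_pos {p q X : Plane} (hXs : X ∈ s.region) (hX : orient p q X = 0)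
    (h1 : 0 < orient p q s.left) (h2 : 0 < orient p q s.right) (h3 : 0 < orient p q s.apex) :
    False := by
  have := orient_pos_of_mem_convexHull (a := p) (b := q) (by
    rintro y (rfl | rfl | rfl) <;> assumption) hXs
  rw [hX] at this
  exact lt_irrefl _ this

theorem orient_parallel (p q a b : Plane) :
    orient p q a - orient p q b = orient a b q - orient a b p := by
  unfold orient; ring

theorem Layout.same_meets_of_right (Y : Layout P c u k f mid) (S : Rings P c u k h)
    (M : Member c f mid s) {i : ℤ} {x y X : Plane} (hy : y ∈ f (i - 1) :: mid i)
    (hxy : orient (c i) y x < 0) (hx : x ∈ innerPoints P) (hsx : s.apex ≠ x)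
    (hX : X ∈ openSegment ℝ (c i) x) (hXs : X ∈ s.region) (hd : s.right = c i) : False := by
  obtain ⟨σ, τ, hσ, hτ, -, e⟩ := exists_orient_openSegment hX
  have ha := M.apex_mem Y S
  have n1 := M.right_nonneg Y S hXs
  rw [hd, e, orient_self_mid, mul_zero, zero_add] at n1
  have n2 : 0 < orient (c i) s.apex x :=
    lt_of_le_of_ne (nonneg_of_mul_nonneg_right n1 hτ) (S.ne_zero i ha hx hsx).symm
  cases M with
  | edge j =>
    have hj := (S.outer.eq_iff _ _).1 hd
    have hf : f j = f (i - 1) := Y.f_eq_of_dvd (by rwa [show j - (i - 1) = j + 1 - i by ring])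
    simp only at n2 ha
    rw [hf] at n2 ha
    rcases (Y.order S i hy).1 with rfl | h
    · linarith
    · obtain ⟨w, hw⟩ := S.exists_wide i
      have := orient_trans (hw _ (Y.mem_inner S hy)) (hw _ ha) (hw _ hx) h n2
      linarith
  | corner j a hja =>
    have n3 := (Member.corner j a hja).left_nonneg (t := ⟨c j, c j, a⟩) Y S hXs
    simp only at hd n2 n3
    rw [hd, e, orient_self_right, mul_zero, zero_add, orient_swap] at n3
    linarith [mul_pos hτ n2]

theorem Layout.same_meets_of_left (Y : Layout P c u k f mid) (S : Rings P c u k h)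
    (M : Member c f mid s) {i : ℤ} {x y X : Plane} (hy : y ∈ f (i - 1) :: mid i)
    (hx : x ∈ innerPoints P) (hsx : s.apex ≠ x)
    (hX : X ∈ openSegment ℝ (c i) x) (hXs : X ∈ s.region) (he : s.left = c i)
    (hd : s.right ≠ c i) : orient (c i) x s.right < 0 ∧ 0 < orient (c i) x s.apex ∧
      (s.apex = y ∨ orient (c i) y s.apex < 0) := by
  obtain ⟨σ, τ, hσ, hτ, -, e⟩ := exists_orient_openSegment hX
  have ha := M.apex_mem Y S
  have n1 := M.left_nonneg Y S hXs
  rw [he, e, orient_self_right, mul_zero, zero_add] at n1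
  have n2 : 0 < orient s.apex (c i) x := by
    refine lt_of_le_of_ne (nonneg_of_mul_nonneg_right n1 hτ) ?_
    rw [orient_swap]
    exact (neg_ne_zero.2 (S.ne_zero i ha hx hsx)).symm
  have hE := (M.edge_or S).resolve_left (by rw [he]; exact hd.symm)
  rw [he] at hE
  have n3 := hE.pos (Rings.mem_P hx) (S.ne_c i hx) (by
    rintro rfl
    exact (mem_innerPoints.1 hx).2 (M.corners S).2)
  refine ⟨by rw [orient_swap_right]; linarith, by rw [orient_rot]; exact n2, ?_⟩
  cases M with
  | edge j =>
    have hf : f j = f i := Y.f_eq_of_dvd ((S.outer.eq_iff _ _).1 he)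
    simp only
    rw [hf]
    rcases (Y.order S i hy).2 with h | h
    · exact Or.inl h.symm
    · right; rw [orient_swap_right]; linarith
  | corner j a hja => exact absurd he hd

/-- If `c i` is not a corner of `s`, the line from `c i` through `x` has both corners of `s` on one
side and the apex on the other. Each unwanted position leads to a contradiction: the right edge of
`s` crosses the right edge from `c i` to `y`, or it enters the angle spanned by `x` and `y` at the
apex, or the outer vertex `s.right` lies in the triangle of `c i`, `x` and `y`. -/
theorem Layout.same_meets (Y : Layout P c u k f mid) (S : Rings P c u k h)
    (M : Member c f mid s) {i : ℤ} {x y : Plane} (hy : y ∈ f (i - 1) :: mid i)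
    (tight : ∀ x ∈ innerPoints (innerPoints P), x ≠ y → orient (c i) y x < 0)
    (hx : x ∈ innerPoints (innerPoints P)) (hxy : x ≠ y) (hsx : s.apex ≠ x)
    (hm : SegmentMeets (c i) x s) : orient (c i) x s.right < 0 ∧ 0 < orient (c i) x s.apex ∧
      (s.apex = y ∨ orient (c i) y s.apex < 0) := by
  obtain ⟨X, hX, hXs⟩ := hm
  have hxi := deep_subset hx
  have hyi := Y.mem_inner S hy
  have txy := tight x hx hxy
  by_cases hd : s.right = c i
  · exact (Y.same_meets_of_right S M hy txy hxi hsx hX hXs hd).elim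
  by_cases he : s.left = c i
  · exact Y.same_meets_of_left S M hy hxi hsx hX hXs he hd
  obtain ⟨σ, τ, hσ, hτ, -, e⟩ := exists_orient_openSegment hX
  obtain ⟨w, hw⟩ := exists_halfplane (S.outer.mem_hull i)
  have ha := M.apex_mem Y S
  obtain ⟨hL, hR⟩ := M.corners S
  have pa := Rings.mem_P ha
  have px := Rings.mem_P hxi
  have py := Rings.mem_P hyi
  have pd := mem_of_mem_hullVertices hR
  have pe := mem_of_mem_hullVertices hL
  have pc := S.c_mem i
  have nxc := S.ne_c i hxi
  have nyc := S.ne_c i hyi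
  have nac := S.ne_c i ha
  have nxd := ne_of_inner hxi hR
  have nyd := ne_of_inner hyi hR
  have nad := ne_of_inner ha hR
  have nxe := ne_of_inner hxi hL
  have hcs : c i ∉ s.region := fun hc => by
    rcases M.corner_mem Y S hc with h | h
    · exact he h.symm
    · exact hd h.symm
  have hxs : x ∉ s.region := fun hxs => hsx (Y.region_eq S M hxs (subset_convexHull ℝ _ hxi)
    fun _ => subset_convexHull ℝ _ hx).symm
  have hXc : orient (c i) x X = 0 := by rw [e]; simp
  have zd := S.gen _ pc _ px _ pd nxc.symm nxd (Ne.symm hd)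
  have ze := S.gen _ pc _ px _ pe nxc.symm nxe (Ne.symm he)
  have za := S.gen _ pc _ px _ pa nxc.symm hsx.symm nac.symm
  -- A hull edge of `P` has both ends of the segment on its left. If the line of the segment
  -- separated the ends of that edge, one end of the segment would lie in `s`.
  have str1 : orient (c i) x s.left < 0 → orient (c i) x s.right < 0 := fun h1 =>
    (lt_or_gt_of_ne zd).resolve_right fun h2 => M.not_straddle S pc px hX hXs hxs h1 h2
  have str2 : orient (c i) x s.right < 0 → orient (c i) x s.left < 0 := fun h1 =>
    (lt_or_gt_of_ne ze).resolve_right fun h2 => by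
      rw [openSegment_symm] at hX
      exact M.not_straddle S px pc hX hXs hcs (by rw [orient_swap]; linarith)
        (by rw [orient_swap]; linarith)
  have hxy' : 0 < orient (c i) x y := by rw [orient_swap_right]; linarith
  have nn := M.right_nonneg Y S hXs
  rw [e] at nn
  have par := orient_parallel (c i) x s.right s.apex
  have zc := S.gen _ pd _ pa _ pc nad.symm nac hd
  have zx := S.gen _ pd _ pa _ px nad.symm hsx nxd.symm
  have RX : ∀ Z ∈ openSegment ℝ (c i) y, Z ∉ openSegment ℝ s.right s.apex := by
    intro Z hZ hZ'
    obtain ⟨j, hj, hja⟩ := M.exists_right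
    rw [hj] at hZ' hd
    exact hd ((S.outer.eq_iff _ _).2 (Y.right_edges_disjoint S hy hja hZ hZ')).symm
  have r1 : ∀ p q, orient s.apex p q = orient p q s.apex := fun p q => (orient_rot _ _ _).symm
  rcases lt_or_gt_of_ne zd with hdn | hdp
  · have hap : 0 < orient (c i) x s.apex := (lt_or_gt_of_ne za).resolve_left fun h =>
      not_all_neg hXs hXc (str2 hdn) hdn h
    refine ⟨hdn, hap, ?_⟩
    by_contra! hcon
    obtain ⟨hay, hcon⟩ := hcon
    have hya : 0 < orient (c i) y s.apex := lt_of_le_of_ne hcon (S.ne_zero i hyi ha hay.symm).symm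
    have hdeep : s.apex ∉ innerPoints (innerPoints P) := fun h => by
      linarith [tight _ h hay]
    have lt : orient s.right s.apex x < orient s.right s.apex (c i) := by linarith
    have hc : 0 < orient s.right s.apex (c i) := by
      by_contra h
      have h' := not_lt.1 h
      linarith [mul_nonneg hσ.le (neg_nonneg.2 h'), mul_pos hτ (show 0 < -orient s.right s.apex x by
        linarith)]
    have hx' : orient s.right s.apex x < 0 := by
      exact (lt_or_gt_of_ne zx).resolve_right fun h => hxs (region_subset hXs
        (p := s.right) (q := s.apex) (by simp) (by simp) (mem_of_straddle hX hdn hap hc h))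
    have zy := S.gen _ pd _ pa _ py nad.symm hay nyd.symm
    -- With `y` to the right of the right edge, this edge crosses the segment from `c i` to `y`.
    -- With `y` to the left, the right edge leaves the apex between the directions of `y` and `x`.
    rcases lt_or_gt_of_ne zy with hyn | hyp
    · have hdx : 0 < orient (c i) s.right x := by rw [orient_swap_right]; linarith
      have hdy := orient_trans (hw _ pd hd) (hw _ px nxc) (hw _ py nyc) hdx hxy'
      obtain ⟨Z, hZ, hZ'⟩ := exists_mem_openSegments (p := c i) (q := y) (p' := s.right)
        (q' := s.apex) (mul_neg_of_neg_of_pos (by rw [orient_swap_right]; linarith) hya)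
        (mul_neg_of_pos_of_neg hc hyn)
      exact RX Z hZ hZ'
    · have e1 := orient_pluecker s.apex s.right y (c i) x
      have k1 : orient s.apex s.right y = -orient s.right s.apex y := orient_swap _ _ _
      have k2 : orient s.apex s.right (c i) = -orient s.right s.apex (c i) := orient_swap _ _ _
      have k3 : orient s.apex s.right x = -orient s.right s.apex x := orient_swap _ _ _
      have k4 : orient s.apex (c i) x = orient (c i) x s.apex := r1 _ _
      have k5 : orient s.apex y (c i) = -orient (c i) y s.apex := by rw [r1, orient_swap]
      rw [k1, k2, k3, k4, k5] at e1
      have m1 := mul_pos hyp hap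
      have m2 := mul_pos (neg_pos.2 hx') hya
      have k6 : 0 < orient s.apex y x := (pos_iff_pos_of_mul_pos (show
        0 < orient s.right s.apex (c i) * orient s.apex y x by linarith)).1 hc
      exact Y.not_cone S M hyi hxi (fun h => absurd h hdeep) k6
        (by rw [orient_rot]; exact hyp) (by rw [k3]; linarith)
  · exfalso
    have hep : 0 < orient (c i) x s.left := (lt_or_gt_of_ne ze).resolve_left fun h => by
      linarith [str1 h]
    have han : orient (c i) x s.apex < 0 := (lt_or_gt_of_ne za).resolve_right fun h =>
      not_all_pos hXs hXc hep hdp h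
    have lt : orient s.right s.apex (c i) < orient s.right s.apex x := by linarith
    have hx' : 0 < orient s.right s.apex x := by
      by_contra h
      have h' := not_lt.1 h
      linarith [mul_nonneg hτ.le (neg_nonneg.2 h'), mul_pos hσ (show
        0 < -orient s.right s.apex (c i) by linarith)]
    have hc : orient s.right s.apex (c i) < 0 := by
      refine (lt_or_gt_of_ne zc).resolve_right fun h => hcs (region_subset hXs
        (p := s.right) (q := s.apex) (by simp) (by simp) (mem_of_straddle (p := x) ?_ ?_ ?_ hx' h))
      · rwa [openSegment_symm]
      · rw [orient_swap]; linarith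
      · rw [orient_swap]; linarith
    have hax : 0 < orient (c i) s.apex x := by rw [orient_swap_right]; linarith
    have hay' := orient_trans (hw _ pa nac) (hw _ px nxc) (hw _ py nyc) hax hxy'
    have hay : s.apex ≠ y := by rintro h; rw [h] at hay'; simp at hay'
    have zy := S.gen _ pd _ pa _ py nad.symm hay nyd.symm
    rcases lt_or_gt_of_ne zy with hyn | hyp
    · have e1 := orient_pluecker s.apex s.right x (c i) y
      have k1 : orient s.apex s.right y = -orient s.right s.apex y := orient_swap _ _ _
      have k2 : orient s.apex s.right (c i) = -orient s.right s.apex (c i) := orient_swap _ _ _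
      have k3 : orient s.apex s.right x = -orient s.right s.apex x := orient_swap _ _ _
      have k4 : orient s.apex x (c i) = orient (c i) s.apex x := orient_rot _ _ _
      have k5 : orient s.apex (c i) y = -orient (c i) s.apex y := orient_swap _ _ _
      rw [k1, k2, k3, k4, k5] at e1
      have m1 := mul_pos hx' hay'
      have m2 := mul_pos (neg_pos.2 hyn) hax
      have k6 : 0 < orient s.apex x y := (pos_iff_pos_of_mul_pos (show
        0 < -orient s.right s.apex (c i) * orient s.apex x y by linarith)).1 (by linarith)
      have k7 : 0 < orient s.apex x s.right := by rw [orient_rot]; exact hx'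
      have k8 : 0 < orient s.apex s.right y := by linarith
      by_cases hdeep : s.apex ∈ innerPoints (innerPoints P)
      · by_cases hyd : y ∈ innerPoints (innerPoints P)
        · exact Y.not_cone S M hxi hyi (fun _ => ⟨hx, hyd⟩) k6 k7 k8
        -- Here the apex is deep and `y` is not, so `not_cone` does not apply; `deep_of_between`
        -- would make `y` deep.
        · obtain ⟨v, w, z, hvw, H, hs⟩ := Y.deep_view S M hdeep
          obtain ⟨v1, v2, v3⟩ := hs s.right (by simp)
          refine hyd (H.deep_of_between hvw v1 v3 hyi ?_ k8)
          have hzx : orient z s.apex x ≤ 0 := H.hull_nonpos (subset_convexHull ℝ _ hx)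
          have e2 := orient_pluecker s.apex x s.right y z
          rw [orient_rot z s.apex y, orient_rot z s.apex x, orient_rot z s.apex s.right] at e2
          have m3 := mul_pos k6 v1
          have m4 := mul_nonneg (neg_nonneg.2 hzx) k8.le
          exact (pos_iff_pos_of_mul_pos (show
            0 < orient s.apex x s.right * orient z s.apex y by linarith)).1 k7
      · exact Y.not_cone S M hxi hyi (fun h => absurd h hdeep) k6 k7 k8
    · have hdd : 0 ≠ orient (c i) y s.right := (S.gen _ pc _ py _ pd nyc.symm nyd (Ne.symm hd)).symm
      rcases lt_or_gt_of_ne hdd with h | h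
      · obtain ⟨Z, hZ, hZ'⟩ := exists_mem_openSegments (p := c i) (q := y) (p' := s.right)
          (q' := s.apex) (mul_neg_of_pos_of_neg h (by rw [orient_swap_right]; linarith))
          (mul_neg_of_neg_of_pos hc hyp)
        exact RX Z hZ hZ'
      · have e1 := orient_affine s.right s.apex (c i) x y s.right
        have k1 : orient y (c i) s.right = -orient (c i) y s.right := orient_swap _ _ _
        rw [orient_self_mid, mul_zero, k1] at e1
        have m1 := mul_pos (neg_pos.2 h) hx'
        have m2 := mul_pos hdp hyp
        have k2 : 0 < orient x y s.right := (pos_iff_pos_of_mul_pos (show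
          0 < orient x y s.right * -orient s.right s.apex (c i) by linarith)).2 (by linarith)
        have := mem_of_mem_convexHull_hullVertex hR (T := {c i, x, y}) (by
          rintro p (rfl | rfl | rfl) <;> assumption)
          ((mem_triangle_iff hxy').2 ⟨hdp.le, k2.le, by linarith⟩)
        rcases this with h | h | h
        · exact hd h
        · exact nxd h.symm
        · exact nyd h.symm

/-- A link from a deep point to `q` on the inner hull is a rule step with `q = w`. The gate is
determined by the vertex that the corner sees first, so the view of the apex refers to the same `w`.
-/
theorem Layout.step_sees (Y : Layout P c u k f mid) (S : Rings P c u k h) (M : Member c f mid t)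
    {i : ℤ} {q : Plane} (hi : t.right = c i) (l : Link P c u i t.apex q) (hq : q ≠ t.apex)
    (hdeep : t.apex ∈ innerPoints (innerPoints P)) (hqd : q ∉ innerPoints (innerPoints P)) :
    (∀ x ∈ innerPoints (innerPoints P), x ≠ t.apex → orient q t.apex x < 0) ∧
      0 < orient q t.apex t.left ∧ 0 < orient q t.apex t.right := by
  obtain ⟨v', w', z', hvw', H, hs⟩ := Y.deep_view S M hdeep
  have hv' := (hs t.right (by simp)).2.2
  rw [hi] at hv'
  generalize hp : t.apex = p at *
  cases l with
  | gate n hn => exact absurd rfl (ne_of_deep hdeep (S.inner.mem_hull n))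
  | entry v w y hvw hv hy T => exact absurd rfl (ne_of_deep hdeep hvw.1)
  | step v w x y hvw hv T hr =>
    rcases T with rfl | ⟨z, h, -⟩
    · obtain rfl : v' = v := hv'.unique hv hvw'.left_mem hvw.left_mem
      obtain rfl := hvw'.right_unique hvw
      refine ⟨fun x hx hxp => ?_, (hs _ (by simp)).2.1, (hs _ (by simp)).2.1⟩
      rcases hr with ⟨h, -⟩ | ⟨-, -, -, h⟩
      · exact absurd h.symm hq
      · exact h x hx (ne_of_deep hx hvw.2.1) hxp
    · exact absurd h.mem hqd

/-- The segments from the next inward vertex to the deep points do not meet the triangle. -/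
theorem Layout.next_not_meets (Y : Layout P c u k f mid) (S : Rings P c u k h)
    (M : Member c f mid t) {i : ℤ} {q x : Plane} (hi : t.right = c i)
    (l : Link P c u i t.apex q) (hq : q ≠ t.apex) (hx : x ∈ innerPoints (innerPoints P))
    (hqx : q ≠ x) : ¬ SegmentMeets q x t := by
  rintro ⟨X, hX, hXt⟩
  have hqi := (l.mem S).2
  by_cases hdeep : t.apex ∈ innerPoints (innerPoints P)
  · by_cases hqd : q ∈ innerPoints (innerPoints P)
    · exact Y.not_meets S M hqi (deep_subset hx) hqx (fun _ => ⟨hqd, hx⟩) hX hXt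
    · obtain ⟨h1, h2, h3⟩ := Y.step_sees S M hi l hq hdeep hqd
      obtain ⟨σ, τ, hσ, hτ, -, e⟩ := exists_orient_openSegment hX
      have e1 := e q t.apex
      rw [orient_self_mid, mul_zero, zero_add] at e1
      by_cases hxa : x = t.apex
      · rcases eq_or_pos_of_mem_convexHull h2 h3 (by simp) hXt with rfl | h4
        · rw [hxa] at hX
          exact hq (right_mem_openSegment_iff.1 hX)
        · rw [hxa, orient_self_right, mul_zero] at e1
          linarith
      · have h5 := mul_neg_of_pos_of_neg hτ (h1 x hx hxa)
        rcases eq_or_pos_of_mem_convexHull h2 h3 (by simp) hXt with rfl | h4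
        · rw [orient_self_right] at e1
          linarith
        · linarith
  · exact Y.not_meets S M hqi (deep_subset hx) hqx (fun h => absurd h hdeep) hX hXt

/-- By `not_meets` the apex is deep and `q` is not. The segment starts beyond the line `z s.apex`
that bounds the deep points, and `deep_of_between` forces `q` to the right of the rays from the apex
to both corners. These positions leave only one choice of signs. -/
theorem Layout.diff_meets (Y : Layout P c u k f mid) (S : Rings P c u k h)
    (M : Member c f mid s) {q x : Plane} (hq : q ∈ innerPoints P)
    (hx : x ∈ innerPoints (innerPoints P)) (hqx : q ≠ x) (hsx : s.apex ≠ x)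
    (hm : SegmentMeets q x s) : s.apex ∈ innerPoints (innerPoints P) ∧ q ≠ s.apex ∧
      orient q x s.right < 0 ∧ 0 < orient q x s.apex := by
  obtain ⟨X, hX, hXs⟩ := hm
  have hxi := deep_subset hx
  have ha := M.apex_mem Y S
  obtain ⟨hL, hR⟩ := M.corners S
  by_cases hdeep : s.apex ∈ innerPoints (innerPoints P)
  swap
  · exact absurd hXs (Y.not_meets S M hq hxi hqx (fun h => absurd h hdeep) hX)
  by_cases hqd : q ∈ innerPoints (innerPoints P)
  · exact absurd hXs (Y.not_meets S M hq hxi hqx (fun h => ⟨hqd, hx⟩) hX)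
  have hqa : q ≠ s.apex := by rintro rfl; exact hqd hdeep
  refine ⟨hdeep, hqa, ?_⟩
  obtain ⟨σ, τ, hσ, hτ, -, e⟩ := exists_orient_openSegment hX
  have pa := Rings.mem_P ha
  have px := Rings.mem_P hxi
  have pq := Rings.mem_P hq
  have pd := mem_of_mem_hullVertices hR
  have pe := mem_of_mem_hullVertices hL
  obtain ⟨v, w, z, hvw, H, hs⟩ := Y.deep_view S M hdeep
  have zx : orient z s.apex x ≤ 0 := H.hull_nonpos (subset_convexHull ℝ _ hx)
  have zX : 0 < orient z s.apex X := by
    refine (eq_or_pos_of_mem_convexHull (hs _ (by simp)).1 (hs _ (by simp)).1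
      (by simp) hXs).resolve_left ?_
    rintro rfl
    exact S.genInner.notMem_openSegment hq hxi ha hqx hX
  have zq : 0 < orient z s.apex q := by
    rw [e] at zX
    by_contra h
    have h' := not_lt.1 h
    linarith [mul_nonneg hσ.le (neg_nonneg.2 h'), mul_nonneg hτ.le (neg_nonneg.2 zx)]
  have side : ∀ l ∈ ({s.left, s.right} : Set Plane), l ∈ hullVertices P →
      orient s.apex l q < 0 := by
    intro l hl hlv
    have hlP := mem_of_mem_hullVertices hlv
    refine (lt_or_gt_of_ne (S.gen _ pa _ hlP _ pq (ne_of_inner ha hlv) (ne_of_inner hq hlv).symm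
      hqa.symm)).resolve_right fun h => hqd ?_
    exact H.deep_of_between hvw (hs l hl).1 (hs l hl).2.2 hq zq h
  have dq := side s.right (by simp) hR
  have eq := side s.left (by simp) hL
  have nr := M.right_nonneg Y S hXs
  have nl := M.left_nonneg Y S hXs
  have ex : 0 < orient s.apex s.left x := by
    rw [e] at nl
    by_contra h
    have h' := not_lt.1 h
    linarith [mul_neg_of_pos_of_neg hσ eq, mul_nonneg hτ.le (neg_nonneg.2 h')]
  have dx : 0 < orient s.apex s.right x := by
    rcases M.edge_or S with h | hE
    · rw [← h]; exact ex
    refine (lt_or_gt_of_ne (S.gen _ pa _ pd _ px (ne_of_inner ha hR) (ne_of_inner hxi hR).symm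
      hsx)).resolve_left fun h => ?_
    have h1 := hE.pos pa (ne_of_inner ha hL) (ne_of_inner ha hR)
    have p1 := orient_pluecker s.apex s.left s.right x z
    rw [orient_rot z s.apex x, orient_rot z s.apex s.right, orient_rot z s.apex s.left] at p1
    have h1' : 0 < orient s.apex s.left s.right := by rw [← orient_rot]; exact h1
    linarith [mul_nonneg h1'.le (neg_nonneg.2 zx), mul_pos ex (hs s.right (by simp)).1,
      mul_pos (hs s.left (by simp)).1 (neg_pos.2 h)]
  have par1 := orient_parallel q x s.apex s.right
  have par2 := orient_parallel q x s.apex s.left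
  have hXq : orient q x X = 0 := by rw [e]; simp
  have hxs : x ∉ s.region := fun hxs => hsx (Y.region_eq S M hxs (subset_convexHull ℝ _ hxi)
    fun _ => subset_convexHull ℝ _ hx).symm
  have ap : 0 < orient q x s.apex := by
    refine (lt_or_gt_of_ne (S.gen _ pq _ px _ pa hqx hsx.symm hqa)).resolve_left fun h => ?_
    exact not_all_neg hXs hXq (by linarith) (by linarith) h
  refine ⟨?_, ap⟩
  refine (lt_or_gt_of_ne (S.gen _ pq _ px _ pd hqx (ne_of_inner hxi hR)
    (ne_of_inner hq hR))).resolve_right fun h => ?_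
  rcases lt_or_gt_of_ne (S.gen _ pq _ px _ pe hqx (ne_of_inner hxi hL) (ne_of_inner hq hL))
    with h' | h'
  · exact M.not_straddle S pq px hX hXs hxs h' h
  · exact not_all_pos hXs hXq h' h ap

/-- A gap contains no deep point by `Link.avoids`. For a gate it is outside the inner hull; for the
other links it lies to the left of `w a` and `a v` for a deep point `a`, where `notMem_of_gate`
makes every inner point deep. -/
theorem Link.empty (S : Rings P c u k h) {i : ℤ} {p q x : Plane} (l : Link P c u i p q)
    (hx : x ∈ innerPoints P) : x ∉ openTriangle (c i) q p := by
  intro hy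
  have h0 := orient_pos_of_mem_openTriangle hy
  have gate : ∀ v w a, IsHullEdge (innerPoints P) v w → a ∈ innerPoints (innerPoints P) →
      (x ∈ innerPoints (innerPoints P) → False) →
      (∀ y ∈ ({c i, q, p} : Set Plane), 0 ≤ orient w a y) →
      (∀ y ∈ ({c i, q, p} : Set Plane), 0 ≤ orient a v y) → False := by
    intro v w a hvw ha hnd h1 h2
    rw [openTriangle_eq h0] at hy
    exact hnd (notMem_of_gate hvw ha hx
      (orient_pos_of_mem_interior (ne_of_deep ha hvw.2.1).symm
        (fun y hy => orient_nonneg_of_mem_convexHull h1 hy) hy)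
      (orient_pos_of_mem_interior (ne_of_deep ha hvw.1)
        (fun y hy => orient_nonneg_of_mem_convexHull h2 hy) hy))
  have hnd : x ∉ innerPoints (innerPoints P) := fun h => by
    rcases l.avoids S hy with h' | ⟨-, h'⟩
    · exact h' (subset_convexHull ℝ _ hx)
    · exact h' (subset_convexHull ℝ _ h)
  cases l with
  | gate n hn =>
    have h1 := (S.hull_cone n (subset_convexHull ℝ _ hx)).1
    have h2 := hy.2.1
    rw [orient_swap] at h2
    linarith
  | entry v w q hvw hv hq T =>
    rcases T with rfl | ⟨z, H, hs⟩
    · exact ne_of_deep hq hvw.2.1 rfl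
    · refine gate _ w q hvw hq (fun h => hnd h) ?_ ?_
      · rintro y (rfl | rfl | rfl)
        · exact (hs _ rfl).2.le
        · simp
        · rw [orient_rot]; exact hvw.nonneg (deep_subset hq)
      · rintro y (rfl | rfl | rfl)
        · rw [orient_rot]; exact h0.le
        · simp
        · simp
  | step v w p q hvw hv T hr =>
    rcases hr.eq_or_chainPoint hvw hv (Set.mem_singleton _) (fun l hl => Or.inl hl) T with
      rfl | ⟨H, hs⟩
    · simp at h0
    · refine gate v w p hvw H.mem (fun h => hnd h) ?_ ?_
      · rintro y (rfl | rfl | rfl)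
        · exact (hs _ rfl).2.le
        · rcases H.base with rfl | h
          · simp
          · have e : orient w p y = -orient y p w := by unfold orient; ring
            linarith
        · simp
      · rintro y (rfl | rfl | rfl)
        · have h := hv p (deep_subset H.mem) (ne_of_deep H.mem hvw.1)
          have e : orient p v (c i) = -orient (c i) v p := by unfold orient; ring
          linarith
        · rw [orient_rot]; exact H.left.le
        · simp

/-- A repeated inward vertex arises only if the rule keeps `y`, and it does so under exactly this
condition. -/
theorem Link.tight (S : Rings P c u k h) {i : ℤ} {x y : Plane} (l : Link P c u i x y)
    (hxy : y = x) : ∀ p ∈ innerPoints (innerPoints P), p ≠ x → orient (c i) x p < 0 := by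
  cases l with
  | gate n hn =>
    have := S.three_le_h
    exact absurd hxy.symm (S.u_ne (by omega) (by omega))
  | entry v w y hvw hv hy T => exact absurd hxy (ne_of_deep hy hvw.1)
  | step v w x y hvw hv T hr =>
    rcases hr with ⟨h, h'⟩ | ⟨-, h, -⟩
    · subst h; exact h'
    · exact absurd hxy.symm h

end Segments

/-! ### Assembling the good multiset. -/

section Good

variable {P : Finset Plane} {c u : ℤ → Plane} {k h : ℕ} {f : ℤ → Plane} {mid : ℤ → List Plane}

theorem Layout.isGoodSet (Y : Layout P c u k f mid) (S : Rings P c u k h) {T : Multiset Triangle}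
    (hT : ∀ t, t ∈ T ↔ Member c f mid t) (hcard : Multiset.card T = (innerPoints P).card)
    (hnodup : ∀ t T', t.left ≠ t.right → T = t ::ₘ T' → t ∉ T') : IsGoodSet P T := by
  have covers : ∀ v ∈ hullVertices (innerPoints P), ∃ t ∈ T, t.apex = v := by
    intro v hv
    obtain ⟨n, rfl⟩ := S.inner.surj v hv
    rcases Y.covers n with ⟨i, hi⟩ | ⟨i, hi⟩
    · exact ⟨_, (hT _).2 (Member.edge i), hi⟩
    · exact ⟨_, (hT _).2 (Member.corner i _ hi), rfl⟩
  have free : ∀ {x}, IsFree P T x → x ∈ innerPoints (innerPoints P) := by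
    intro x hx
    refine mem_innerPoints.2 ⟨hx.1, fun hv => ?_⟩
    obtain ⟨t, ht, e⟩ := covers x hv
    exact hx.2 t ht e
  have next : ∀ {t t'}, IsNext T t t' → ∃ i, t.right = c i ∧ t.apex ∈ f (i - 1) :: mid i ∧
      Link P c u i t.apex t'.apex := fun hn => Y.link_of_isNext S hT hn
  refine
    { inward := fun t ht => ?_
      nodup := fun t ht T' => hnodup t T' ht.1.2.2.1
      card_eq := hcard
      not_forbidden := fun t ht => ?_
      disjoint := fun t ht t' ht' hne => Y.disjoint S ((hT t).1 ht) ((hT t').1 ht') hne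
      covers_vertices := covers
      covers_edges := fun b d hbd => ?_
      free_segment := fun x y hx hy hxy t ht => ?_
      same_right := fun t t' hn he x hx => ?_
      same_meets := fun t t' hn he x hx s hs hm => ?_
      diff_segment := fun t t' hn he x hx => ?_
      diff_meets := fun t t' hn he x hx s hs hm => ?_
      diff_empty := fun t t' hn he p hp => ?_ }
  · have M := (hT t).1 ht
    have hm := M.apex_mem Y S
    cases M with
    | edge i =>
      left
      rcases (Y.edgeApex i).view with ⟨n, e, h1, h2⟩ | ⟨v, w, z, hvw, H, hs⟩
      · rw [e]; exact S.typeOne_isInward h1 h2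
      · obtain ⟨l1, l2, l3⟩ := hs (c i) (by simp)
        obtain ⟨r1, r2, r3⟩ := hs (c (i + 1)) (by simp)
        exact S.isInwardTriangle_of_forall hm fun x hx hx' =>
          H.region_inner hvw (S.edge_pos i hm) l1 r1 l2 r2 l3 r3 hx hx'
    | corner i x hx => exact Or.inr ⟨rfl, S.outer.mem_hull i, hm⟩
  · have M := (hT t).1 ht
    cases M with
    | edge i =>
      refine ⟨?_, fun h => S.outer.ne_succ i h.1.1⟩
      rcases (Y.edgeApex i).view with ⟨n, e, h1, h2⟩ | ⟨v, w, z, hvw, H, hs⟩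
      · rw [e]; exact S.typeOne_not_forbidden h1 h2
      · exact not_isForbiddenTriangle_of_notMem (mem_innerPoints.1 H.mem).2
    | corner i x hx =>
      refine ⟨fun h => h.1.1.2.2.1 rfl, ?_⟩
      rcases Y.corner i x hx with ⟨n, rfl, h1⟩ | h1
      · exact S.not_isForbiddenSegment h1
      · exact fun h => (mem_innerPoints.1 h1).2 h.2.1
  · obtain ⟨i, -, -, h1, h2⟩ := S.outer.exists_edge hbd 0
    exact ⟨_, (hT _).2 (Member.edge i), h1, h2⟩
  · rintro ⟨X, hX, hXt⟩
    exact Y.not_meets S ((hT t).1 ht) hx.1 hy.1 hxy (fun _ => ⟨free hx, free hy⟩) hX hXt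
  · obtain ⟨i, h1, -, l⟩ := next hn
    show orient t.right t.apex x < 0
    rw [h1]
    exact l.tight S he x (free hx) (hx.2 t hn.1).symm
  · obtain ⟨i, h1, h2, l⟩ := next hn
    show orient _ _ _ < 0 ∧ 0 < orient _ _ _ ∧ (_ ∨ orient _ _ _ < 0)
    rw [h1] at hm ⊢
    exact Y.same_meets S ((hT s).1 hs) h2 (l.tight S he) (free hx) (hx.2 t hn.1).symm
      (hx.2 s hs) hm
  · obtain ⟨i, h1, -, l⟩ := next hn
    exact Y.next_not_meets S ((hT t).1 hn.1) h1 l he (free hx) (hx.2 t' hn.2.1)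
  · obtain ⟨i, h1, -, l⟩ := next hn
    obtain ⟨h2, h3, h4, h5⟩ := Y.diff_meets S ((hT s).1 hs) (l.mem S).2 (free hx)
      (hx.2 t' hn.2.1) (hx.2 s hs) hm
    exact ⟨h4, h5, Y.next_not_meets S ((hT t).1 hn.1) h1 l he h2 h3⟩
  · obtain ⟨i, h1, -, l⟩ := next hn
    have h2 := l.pos.resolve_left (Ne.symm he)
    have e : ({t.apex, t.right, t'.apex} : Set Plane) = {c i, t'.apex, t.apex} := by
      rw [h1]; ext x; simp only [Set.mem_insert_iff, Set.mem_singleton_iff]; tauto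
    rw [e, ← openTriangle_eq h2]
    exact l.empty S hp

end Good


theorem three_le_card_of_mem_innerPoints {Q : Finset Plane} {p : Plane} (hp : p ∈ innerPoints Q) :
    3 ≤ Q.card := by
  by_contra hcard
  obtain ⟨hpQ, hph⟩ := mem_innerPoints.1 hp
  apply hph
  by_cases hx : ∃ x ∈ Q, x ≠ p
  · obtain ⟨x, hx, hxp⟩ := hx
    obtain ⟨w, hw⟩ := exists_orient_pos hxp
    refine mem_hullVertices_of_halfplane (w := w) hpQ fun y hy hyp => ?_
    have : y = x := by
      by_contra hyx
      exact hcard (Finset.two_lt_card.2 ⟨p, hpQ, x, hx, y, hy, hxp.symm, hyp.symm, Ne.symm hyx⟩)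
    rw [this, orient_rot]
    exact hw
  · push Not at hx
    exact mem_hullVertices_of_halfplane (w := p) hpQ fun y hy hyp => absurd (hx y hy) hyp

theorem card_hullPart_le {P : Finset Plane} {T : Finset Triangle} (hT : IsCompatible P T) :
    (hullPart P T).card ≤ (innerPoints P).card := by
  classical
  refine Finset.card_le_card_of_injOn Triangle.apex (fun t ht => ?_) fun t ht t' ht' e => ?_
  · exact (hT.1 t (Finset.mem_filter.1 ht).1).1.2.1
  · by_contra hne
    exact (hT.2 t (Finset.mem_filter.1 ht).1 t' (Finset.mem_filter.1 ht').1 hne).2.1 e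

theorem isGoodSet_zero {P : Finset Plane} (hinner : innerPoints P = ∅) (hhull : hullVertices P = ∅) :
    IsGoodSet P 0 where
  inward := by simp
  nodup t _ S' e := absurd e (Multiset.zero_ne_cons)
  card_eq := by simp [hinner]
  not_forbidden := by simp
  disjoint := by simp
  covers_vertices u hu := by
    have := mem_of_mem_hullVertices hu
    simp [hinner] at this
  covers_edges b d hbd := by
    have := hbd.1
    simp [hhull] at this
  free_segment := by simp
  same_right t t' hn := absurd hn.1 (Multiset.notMem_zero _)
  same_meets t t' hn := absurd hn.1 (Multiset.notMem_zero _)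
  diff_segment t t' hn := absurd hn.1 (Multiset.notMem_zero _)
  diff_meets t t' hn := absurd hn.1 (Multiset.notMem_zero _)
  diff_empty t t' hn := absurd hn.1 (Multiset.notMem_zero _)

/-- Necessary Condition 3 is enough for a good multiset of inward triangles. -/
theorem exists_isGoodSet {P : Finset Plane} (hP : GeneralPosition P) (h : NecessaryCondition3 P) :
    ∃ S : Multiset Triangle, IsGoodSet P S := by
  classical
  obtain ⟨m, ⟨⟨T, hmax, hTm⟩, -⟩, hineq⟩ := h
  have hT : IsCompatible P T := hmax.prop
  have gen := hP.orientGeneral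
  have hle := card_hullPart_le hT
  have hcard := card_hull_add_card_inner (innerPoints P)
  rcases (innerPoints P).eq_empty_or_nonempty with hempty | ⟨p, hp⟩
  -- Without inner points the maximum in the condition is 0, and the inequality leaves no hull
  -- vertices.
  · refine ⟨0, isGoodSet_zero hempty (Finset.card_eq_zero.1 ?_)⟩
    rw [hempty, Finset.card_empty] at hle hineq
    omega
  obtain ⟨c, k, hc⟩ := exists_hullEnum gen (three_le_card_of_mem_innerPoints hp)
  have hk3 := hc.three_le (three_le_card_of_mem_innerPoints hp)
  have hk := hc.card_eq
  -- With one or two inner points none is deep, so the condition asks for at least `k ≥ 3` triangles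
  -- with different inward vertices.
  have h3 : 3 ≤ (innerPoints P).card := by
    by_contra hlt
    have : innerPoints (innerPoints P) = ∅ := by
      by_contra hne
      obtain ⟨q, hq⟩ := Finset.nonempty_iff_ne_empty.2 hne
      exact hlt (three_le_card_of_mem_innerPoints hq)
    rw [this, Finset.card_empty] at hcard
    omega
  obtain ⟨u, h, hu⟩ := exists_hullEnum (gen.mono (innerPoints_subset P)) h3
  have S : Rings P c u k h := ⟨gen, h3, hc, hu⟩
  have hh := hu.card_eq
  obtain ⟨L, R, Λ⟩ := S.exists_lifts
  obtain ⟨I, n, hI, hn, hv, hlt, hsel⟩ := Λ.exists_selection S hT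
  obtain ⟨a₀, b₀, A₀, hA₀⟩ := Allocation.exists_of_selection hc.pos Λ.period_L Λ.mono_L Λ.le hI hn
    hv hlt hu.pos
  -- Necessary Condition 3 for the maximal compatible set `T`: at least `k - d` edges are served by
  -- inner hull vertices.
  have hM : (k : ℤ) - (innerPoints (innerPoints P)).card ≤ Allocation.count k a₀ b₀ := by
    have := hsel
    omega
  obtain ⟨a, b, A⟩ := A₀.exists_tight hk3 hu.pos Λ.period_L Λ.period_R Λ.mono_L Λ.mono_R Λ.lt hM
  obtain ⟨Y, g, B⟩ := exists_beams S Λ A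
  obtain ⟨f, mid, T', lay, hmem, hcardT, hnodup⟩ := exists_layout S Λ A B
  refine ⟨T', lay.isGoodSet S (fun t => (hmem t).trans ⟨?_, ?_⟩) hcardT hnodup⟩
  · rintro (⟨i, rfl⟩ | ⟨i, x, hx, rfl⟩)
    · exact Member.edge i
    · exact Member.corner i x hx
  · rintro (i | ⟨i, x, hx⟩)
    · exact Or.inl ⟨i, rfl⟩
    · exact Or.inr ⟨i, x, hx, rfl⟩

end PlanarPoints

theorem mainTheorem8 (P : Finset PlanarPoints.Plane) (hP : PlanarPoints.GeneralPosition P)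
    (h : PlanarPoints.NecessaryCondition3 P) :
    ∃ S : Multiset PlanarPoints.Triangle, PlanarPoints.IsGoodSet P S :=
  PlanarPoints.exists_isGoodSet hP h
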